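/- Let $R$ be a commutative ring of Krull dimension $2$ and $I\subseteq R$ an ideal. Let $E_n(R,I)\subseteq SL_n(R)$ be the subgroup generated by all $\beta\, e_{ij}(a)\,\beta^{-1}$ with $\beta\in E_n(R)$, $i\ne j$, $a\in I$, and let $Um_3(R,I)$ be the set of unimodular rows $b\in R^3$ with $b\equiv(1,0,0)\pmod I$, on which $E_3(R,I)$ acts by right multiplication. Let $\chi_1=\begin{pmatrix}0&1\\-1&0\end{pmatrix}$, $\chi_{r+1}=\chi_r\perp\chi_1$, and let $Alt_{2n}(R,I)$ be the set of invertible alternating $2n\times 2n$ matrices over $R$ with Pfaffian $1$ that are congruent to $\chi_n$ modulo $I$. For $\alpha\in Alt_{2m}(R,I)$ and $\beta\in Alt_{2n}(R,I)$ write $\alpha\sim_I\beta$ if there are $t\ge 0$ and $\varepsilon\in E_{2(m+n+t)}(R,I)$ with $\alpha\perp\chi_{n+t}=\varepsilon^{T}(\beta\perp\chi_{m+t})\varepsilon$. Let $W_E(R,I)$ be the set of equivalence classes of $\bigcup_n Alt_{2n}(R,I)$ under $\sim_I$. For $a,b\in Um_3(R,I)$ with $a_1b_1+a_2b_2+a_3b_3=1$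 put $$\theta(a,b)=\begin{pmatrix}0&-b_1&-b_2&-b_3\\ b_1&0&-a_3&a_2\\ b_2&a_3&0&-a_1\\ b_3&-a_2&a_1&0\end{pmatrix},$$ and let $\sigma$ be the permutation matrix of $(1\,2)(3\,4)$. Then $\theta(a,b)\equiv\chi_2^{-1}\pmod I$ and $\sigma^T\theta(a,b)\sigma\in Alt_4(R,I)$. Then $b\mapsto[\sigma^T\theta(a,b)\sigma]$, where $a\in Um_3(R,I)$ is any row with $a_1b_1+a_2b_2+a_3b_3=1$ (such an $a$ always exists), induces a well-defined map, the relative Vaserstein symbol $$V_{R,I}\colon Um_3(R,I)/E_3(R,I)\longrightarrow W_E(R,I),$$ and this map is a bijection. -/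

import Mathlib

open Matrix

namespace RelVaserstein

universe u

variable {R : Type u} [CommRing R]

/-! ### Elementary groups -/

/-- The elementary group `E_n(R)`: the subgroup of `SL_n(R)` generated by the matrices
`e_{ij}(a) = 1 + a E_{ij}` with `i ≠ j` and `a ∈ R`. -/
def elementary (R : Type u) [CommRing R] (n : ℕ) : Subgroup (Matrix.SpecialLinearGroup (Fin n) R) :=
  Subgroup.closure
    {g | ∃ (i j : Fin n) (h : i ≠ j) (a : R), g = Matrix.SpecialLinearGroup.transvection h a}

/-- The relative elementary group `E_n(R, I)`: the subgroup generated by the matrices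
`β e_{ij}(a) β⁻¹` with `β ∈ E_n(R)`, `i ≠ j` and `a ∈ I`. -/
def relElementary (I : Ideal R) (n : ℕ) : Subgroup (Matrix.SpecialLinearGroup (Fin n) R) :=
  Subgroup.closure
    {g | ∃ β ∈ elementary R n, ∃ (i j : Fin n) (h : i ≠ j), ∃ a ∈ I,
      g = β * Matrix.SpecialLinearGroup.transvection h a * β⁻¹}

/-! ### Relative unimodular rows of length three -/

/-- `Um_3(R, I)`: unimodular rows congruent to `(1, 0, 0)` modulo `I`. -/
structure Um3 (I : Ideal R) where
  row : Fin 3 → R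
  unimodular : ∃ w : Fin 3 → R, row ⬝ᵥ w = 1
  congr_zero : row 0 - 1 ∈ I
  congr_one : row 1 ∈ I
  congr_two : row 2 ∈ I

/-- Two rows are equivalent if they lie in one orbit of the action `v ↦ v ε` of `E_3(R, I)`. -/
def orbitSetoid (I : Ideal R) : Setoid (Um3 I) where
  r v w := ∃ ε ∈ relElementary I 3, w.row = v.row ᵥ* (ε : Matrix (Fin 3) (Fin 3) R)
  iseqv :=
    { refl := fun v => ⟨1, Subgroup.one_mem _, by simp⟩
      symm := by
        rintro v w ⟨ε, hε, h⟩
        refine ⟨ε⁻¹, Subgroup.inv_mem _ hε, ?_⟩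
        have e := Matrix.SpecialLinearGroup.coe_mul ε ε⁻¹
        rw [mul_inv_cancel, Matrix.SpecialLinearGroup.coe_one] at e
        rw [h, Matrix.vecMul_vecMul, ← e, Matrix.vecMul_one]
      trans := by
        rintro u v w ⟨ε, hε, h⟩ ⟨δ, hδ, h'⟩
        refine ⟨ε * δ, Subgroup.mul_mem _ hε hδ, ?_⟩
        rw [h', h, Matrix.vecMul_vecMul]
        exact congrArg _ (Matrix.SpecialLinearGroup.coe_mul ε δ).symm }

/-- The orbit set `Um_3(R, I) / E_3(R, I)`. -/
def MSE3 (I : Ideal R) : Type u := Quotient (orbitSetoid I)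

/-- The orbit of a row. -/
def MSE3.mk {I : Ideal R} (b : Um3 I) : MSE3 I := Quotient.mk (orbitSetoid I) b

/-! ### Alternating matrices and the relative elementary symplectic Witt group -/

/-- The standard alternating matrix `χ_n = χ_1 ⊥ ⋯ ⊥ χ_1` of size `2n`, where
`χ_1 = (0 1; -1 0)`. -/
def chi (R : Type u) [CommRing R] (n : ℕ) : Matrix (Fin (2 * n)) (Fin (2 * n)) R :=
  Matrix.of fun i j =>
    if i.val % 2 = 0 ∧ j.val = i.val + 1 then 1
    else if j.val % 2 = 0 ∧ i.val = j.val + 1 then -1 else 0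

/-- The orthogonal sum `A ⊥ B`, the block diagonal matrix with blocks `A` and `B`.  Its size is
recorded as `2N`, where `N` is any expression equal to `m + n`. -/
def perp {m n N : ℕ} (h : m + n = N) (A : Matrix (Fin (2 * m)) (Fin (2 * m)) R)
    (B : Matrix (Fin (2 * n)) (Fin (2 * n)) R) : Matrix (Fin (2 * N)) (Fin (2 * N)) R :=
  Matrix.reindex (finSumFinEquiv.trans (finCongr (by omega)))
    (finSumFinEquiv.trans (finCongr (by omega))) (Matrix.fromBlocks A 0 0 B)

/-- The Pfaffian of an alternating matrix of size `2n`, by expansion along the first row: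
`Pf A = ∑_j (-1)^j a_{0,j+1} Pf (A with rows and columns 0 and j+1 deleted)`. -/
def pfaffian : (n : ℕ) → Matrix (Fin (2 * n)) (Fin (2 * n)) R → R
  | 0, _ => 1
  | n + 1, A => ∑ j : Fin (2 * n + 1), (-1) ^ j.val * A 0 j.succ *
      pfaffian n (A.submatrix (fun k => (j.succAbove k).succ) (fun k => (j.succAbove k).succ))

/-- `Alt_{2n}(R, I)`: the invertible alternating matrices of size `2n` (skew-symmetric with zero
diagonal) which have Pfaffian `1` and are congruent to `χ_n` modulo `I`. -/
structure Alt (I : Ideal R) (n : ℕ) where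
  mat : Matrix (Fin (2 * n)) (Fin (2 * n)) R
  skew : matᵀ = -mat
  diag_zero : ∀ i, mat i i = 0
  isUnit : IsUnit mat
  pf_one : pfaffian n mat = 1
  congr_chi : ∀ i j, mat i j - chi R n i j ∈ I

/-- The relation `α ∼_I β` for `α` of size `2m` and `β` of size `2n`: there are `t` and
`ε ∈ E_{2(m+n+t)}(R, I)` with `α ⊥ χ_{n+t} = εᵀ (β ⊥ χ_{m+t}) ε`. -/
def AltRel (I : Ideal R) (α β : Σ n, Alt I n) : Prop :=
  ∃ t : ℕ, ∃ ε ∈ relElementary I (2 * (α.1 + β.1 + t)),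
    perp (show α.1 + (β.1 + t) = α.1 + β.1 + t by omega) α.2.mat (chi R (β.1 + t)) =
      (ε : Matrix (Fin (2 * (α.1 + β.1 + t))) (Fin (2 * (α.1 + β.1 + t))) R)ᵀ *
        perp (show β.1 + (α.1 + t) = α.1 + β.1 + t by omega) β.2.mat (chi R (α.1 + t)) *
        (ε : Matrix (Fin (2 * (α.1 + β.1 + t))) (Fin (2 * (α.1 + β.1 + t))) R)

/-- The set `W_E(R, I)`, the quotient of the union of all `Alt_{2n}(R, I)` by the equivalence
relation (generated by) `∼_I`. Since `α ∼_I α ⊥ χ_k`, this is also the quotient of the direct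
limit along `α ↦ α ⊥ χ_k`. -/
def WE (I : Ideal R) : Type u := Quot (AltRel I)

/-- The class `[α]` in `W_E(R, I)`. -/
def WE.mk {I : Ideal R} {n : ℕ} (α : Alt I n) : WE I := Quot.mk (AltRel I) ⟨n, α⟩

/-! ### The Vaserstein symbol -/

/-- The matrix `θ(a, b)`. It is alternating of Pfaffian `a · b`, and congruent to
`χ_2⁻¹ = - χ_2` modulo `I` when `a, b ∈ Um_3(R, I)`. -/
def theta (a b : Fin 3 → R) : Matrix (Fin 4) (Fin 4) R :=
  !![0, -b 0, -b 1, -b 2;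
     b 0, 0, -a 2, a 1;
     b 1, a 2, 0, -a 0;
     b 2, -a 1, a 0, 0]

/-- The permutation matrix of `(0 1)(2 3)`. It lies in `E_4(ℤ)` and satisfies
`σᵀ (χ_2⁻¹) σ = χ_2`. -/
def sigma (R : Type u) [CommRing R] : Matrix (Fin 4) (Fin 4) R :=
  !![0, 1, 0, 0;
     1, 0, 0, 0;
     0, 0, 0, 1;
     0, 0, 1, 0]

theorem normTheta_eq (a b : Fin 3 → R) :
    (sigma R)ᵀ * theta a b * sigma R =
      !![0, b 0, a 1, -a 2;
         -b 0, 0, -b 2, -b 1;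
         -a 1, b 2, 0, a 0;
         a 2, b 1, -a 0, 0] := by
  ext i j
  fin_cases i <;> fin_cases j <;> simp [sigma, theta, Matrix.mul_apply, Fin.sum_univ_four]

/-- Every `b ∈ Um_3(R, I)` has a partner `a ∈ Um_3(R, I)` with `a · b = 1`. -/
theorem exists_partner {I : Ideal R} (b : Um3 I) : ∃ a : Um3 I, a.row ⬝ᵥ b.row = 1 := by
  obtain ⟨w, hw⟩ := b.unimodular
  have h0 := b.congr_zero
  have h1 := b.congr_one
  have h2 := b.congr_two
  simp only [dotProduct, Fin.sum_univ_three] at hw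
  set x := b.row 0
  set y := b.row 1
  set z := b.row 2
  have key : ![w 0 + w 1 * y + w 2 * z, w 1 - w 1 * x, w 2 - w 2 * x] ⬝ᵥ b.row = 1 := by
    simp only [dotProduct, Fin.sum_univ_three, Matrix.cons_val]
    linear_combination hw
  refine ⟨⟨![w 0 + w 1 * y + w 2 * z, w 1 - w 1 * x, w 2 - w 2 * x], ⟨b.row, key⟩, ?_, ?_, ?_⟩,
    key⟩
  · have : w 0 + w 1 * y + w 2 * z - 1 = -(w 0 * (x - 1)) := by linear_combination hw
    simpa [this] using I.mul_mem_left (w 0) h0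
  · have : w 1 - w 1 * x = -(w 1 * (x - 1)) := by ring
    simpa [this] using I.mul_mem_left (w 1) h0
  · have : w 2 - w 2 * x = -(w 2 * (x - 1)) := by ring
    simpa [this] using I.mul_mem_left (w 2) h0

/-- For `a, b ∈ Um_3(R, I)` with `a · b = 1`, the matrix `σᵀ θ(a, b) σ` as an element of
`Alt_4(R, I)`. -/
def thetaAlt {I : Ideal R} (a b : Um3 I) (h : a.row ⬝ᵥ b.row = 1) : Alt I 2 where
  mat := (sigma R)ᵀ * theta a.row b.row * sigma R
  skew := by
    rw [normTheta_eq]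
    ext i j
    fin_cases i <;> fin_cases j <;> simp
  diag_zero := by
    rw [normTheta_eq]
    intro i
    fin_cases i <;> simp
  isUnit := by
    rw [Matrix.isUnit_iff_isUnit_det, normTheta_eq]
    simp only [dotProduct, Fin.sum_univ_three] at h
    refine IsUnit.of_mul_eq_one 1 ?_
    rw [mul_one]
    simp [Matrix.det_succ_row_zero, Fin.sum_univ_succ, Fin.succAbove, Matrix.submatrix]
    linear_combination
      (a.row 0 * b.row 0 + a.row 1 * b.row 1 + a.row 2 * b.row 2 + 1) * h
  pf_one := by
    rw [normTheta_eq]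
    simp only [dotProduct, Fin.sum_univ_three] at h
    simp [pfaffian, Fin.sum_univ_succ, Fin.succAbove]
    linear_combination h
  congr_chi := by
    rw [normTheta_eq]
    have a0 := a.congr_zero
    have a1 := a.congr_one
    have a2 := a.congr_two
    have b0 := b.congr_zero
    have b1 := b.congr_one
    have b2 := b.congr_two
    have a0' : -a.row 0 + 1 ∈ I := by simpa [neg_add_eq_sub] using I.neg_mem a0
    have b0' : -b.row 0 + 1 ∈ I := by simpa [neg_add_eq_sub] using I.neg_mem b0
    intro i j
    fin_cases i <;> fin_cases j <;> simp [chi, *]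

end RelVaserstein

namespace RelVaserstein

/-! ### Stable rank and Krull dimension -/

/-! The relative statement is reduced to an absolute one over the double D of R along I, the ring of
pairs in R × R congruent modulo I. Every element of E_n(D) is a pair (e, eρ) with e ∈ E_n(R) and ρ ∈
E_n(R, I) (`exists_relElementary_of_mem_elem`), so E_n(R, I) is the part of E_n(D) with trivial
first component. The dimension enters only through the stable rank: dimension 2 gives stable rank at
most 3 by Kronecker's theorem, and D inherits this bound (`StableRankLE.double`).

Over any ring, the action of E_4 on the matrices θ(a, b) by congruence mirrors the action of E_3 on
the rows b. Three kinds of elementary matrices occur: some act on b as elementary matrices of size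
three, some change only a, and some add to b a Koszul relation of a, which is an elementary
operation by Suslin's lemma. This yields `exists_normTheta_vecMul` and its converse
`exists_normTheta_of_mem_elem`. The former, applied over D, makes the symbol well defined.

For injectivity, a stable congruence over D is brought down to size four by cancelling hyperbolic
planes (`IsHyperbolicAt.exists_mem_elemOn_erase`). Elementary Eichler transformations correct the
congruence until it fixes the plane. Injective stability for K_1, proved through the
Dennis–Vaserstein decomposition (`mem_elemOn_erase`), then makes the remaining block elementary.

For surjectivity, transitivity of relative elementary groups on unimodular rows splits a hyperbolic
plane off every alternating matrix of size at least six (`exists_stablyCongruent_of_succ`). The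
Pfaffian stays 1 because it is invariant under congruences of determinant one, and in size four
Pfaffian 1 says exactly that the matrix is some θ(a, b) up to σ, with a · b = 1. -/

/-- The smallest prime of a chain in V(J) is not minimal in R, so the chain can be prolonged
downwards by a minimal prime. -/
theorem ringKrullDim_quotient_succ_le_of_forall_notMem_minimalPrimes {R : Type*} [CommRing R]
    (J : Ideal R) (hJ : ∀ p ∈ minimalPrimes R, ¬ J ≤ p) :
    ringKrullDim (R ⧸ J) + 1 ≤ ringKrullDim R := by
  by_cases hr' : J = ⊤
  · rw [hr', ringKrullDim_eq_bot_of_subsingleton]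
    simp
  have : Nonempty (PrimeSpectrum.zeroLocus (R := R) J) := by
    rwa [Set.nonempty_coe_sort, Set.nonempty_iff_ne_empty, ne_eq,
      PrimeSpectrum.zeroLocus_empty_iff_eq_top]
  have := Ideal.Quotient.nontrivial_iff.mpr hr'
  have := (Ideal.Quotient.mk J).domain_nontrivial
  rw [ringKrullDim_quotient, Order.krullDim_eq_iSup_length, ringKrullDim,
    Order.krullDim_eq_iSup_length, ← WithBot.coe_one, ← WithBot.coe_add,
    ENat.iSup_add, WithBot.coe_le_coe, iSup_le_iff]
  intro l
  obtain ⟨p, hp, hp'⟩ := Ideal.exists_minimalPrimes_le (J := l.head.1.asIdeal) bot_le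
  let p' : PrimeSpectrum R := ⟨p, hp.1.1⟩
  have hp' : p' < l.head := lt_of_le_of_ne hp' fun h ↦
    hJ p hp (by simpa [← h] using l.head.2)
  have hmono : StrictMono (Subtype.val : PrimeSpectrum.zeroLocus (R := R) J → PrimeSpectrum R) :=
    fun _ _ h => h
  have hlt : (p', (l.map Subtype.val hmono).head) ∈
      {(a, b) : PrimeSpectrum R × PrimeSpectrum R | a < b} := hp'
  refine le_trans ?_ (le_iSup _ ((l.map Subtype.val hmono).cons p' hlt))
  have hlen : ((l.map Subtype.val hmono).cons p' hlt).length = l.length + 1 := by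
    rw [RelSeries.cons_length]
    rfl
  rw [hlen]
  simp

/-- Otherwise the multiplicative set generated by x and the complement of p avoids 0, and a prime
disjoint from it lies in p and misses x, against minimality. -/
theorem exists_isNilpotent_mul_of_mem_minimalPrimes {R : Type*} [CommRing R] {p : Ideal R}
    (hp : p ∈ minimalPrimes R) {x : R} (hx : x ∈ p) : ∃ y ∉ p, IsNilpotent (y * x) := by
  have := hp.1.1
  have h0 : (0 : R) ∈ Submonoid.powers x ⊔ p.primeCompl := by
    by_contra h0
    obtain ⟨q, hq, -, hdisj⟩ := Ideal.exists_le_prime_disjoint (⊥ : Ideal R)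
      (Submonoid.powers x ⊔ p.primeCompl)
      (Set.disjoint_left.mpr fun z hz hz' => h0 (by rwa [← Ideal.mem_bot.mp hz]))
    have hqp : q ≤ p := fun z hz => by
      by_contra hzp
      exact Set.disjoint_left.mp hdisj hz (Submonoid.mem_sup_right hzp)
    exact Set.disjoint_left.mp hdisj (hp.2 ⟨hq, bot_le⟩ hqp hx)
      (Submonoid.mem_sup_left (Submonoid.mem_powers x))
  obtain ⟨_, ⟨n, rfl⟩, y, hy, hxy⟩ := Submonoid.mem_sup.mp h0
  refine ⟨y, hy, n + 1, ?_⟩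
  rw [mul_pow, pow_succ x, pow_succ y]
  linear_combination (y ^ n * x) * hxy

/-- Kronecker's theorem: over a ring of dimension less than `n`, the ideal generated by `n + 1`
elements has the same radical as one generated by `n` elements. -/
theorem exists_mem_radical_span_of_ringKrullDim_lt {ι : Type*} [DecidableEq ι] (n : ℕ) :
    ∀ (R : Type u) [CommRing R], ringKrullDim R < n → ∀ S : Finset ι, S.card = n →
      ∀ (a : R) (b : ι → R), ∃ c : ι → R,
        a ∈ (Ideal.span ((fun i => b i + c i * a) '' (S : Set ι))).radical := by
  induction n with
  | zero =>
    intro R _ h S hS a b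
    have : Subsingleton R := by
      by_contra hn
      rw [not_subsingleton_iff_nontrivial] at hn
      exact absurd (ringKrullDim_nonneg_of_nontrivial (R := R)) (not_le.mpr (by simpa using h))
    exact ⟨0, by rw [Subsingleton.elim a 0]; exact Ideal.zero_mem _⟩
  | succ n ih =>
    intro R _ h S hS a b
    obtain ⟨s, T, hs, rfl, hT⟩ := Finset.card_eq_succ.mp hS
    -- The boundary ideal of b_s: it lies in no minimal prime, so passing to the quotient lowers the
    -- dimension and the induction hypothesis applies to the other entries.
    set J : Ideal R := Ideal.span {b s} ⊔ (nilradical R).colon {b s} with hJdef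
    have hJ : ∀ p ∈ minimalPrimes R, ¬ J ≤ p := by
      intro p hp hle
      have hx : b s ∈ p := hle (Ideal.mem_sup_left (Ideal.mem_span_singleton_self _))
      obtain ⟨y, hy, hxy⟩ := exists_isNilpotent_mul_of_mem_minimalPrimes hp hx
      exact hy (hle (Ideal.mem_sup_right (by
        simpa [Submodule.mem_colon_singleton, mem_nilradical] using hxy)))
    have hdim : ringKrullDim (R ⧸ J) < n := by
      have := (ringKrullDim_quotient_succ_le_of_forall_notMem_minimalPrimes J hJ).trans_lt h
      push_cast at this
      exact lt_of_add_lt_add_right this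
    obtain ⟨c', hc'⟩ := ih (R ⧸ J) hdim T hT (Ideal.Quotient.mk J a)
      (fun i => Ideal.Quotient.mk J (b i))
    choose c hc using fun i => Ideal.Quotient.mk_surjective (c' i)
    obtain ⟨m, hm⟩ := hc'
    have himg : ((fun i => Ideal.Quotient.mk J (b i) + c' i * Ideal.Quotient.mk J a) '' (T : Set ι))
        = Ideal.Quotient.mk J '' ((fun i => b i + c i * a) '' (T : Set ι)) := by
      rw [Set.image_image]
      exact Set.image_congr fun i _ => by simp [hc]
    rw [himg, ← Ideal.map_span, ← map_pow, Ideal.mem_map_iff_of_surjective _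
      Ideal.Quotient.mk_surjective] at hm
    obtain ⟨l, hl, hlm⟩ := hm
    rw [eq_comm, Ideal.Quotient.mk_eq_mk_iff_sub_mem, Submodule.mem_sup] at hlm
    obtain ⟨z, hz, y, hy, hzy⟩ := hlm
    obtain ⟨t, rfl⟩ := Ideal.mem_span_singleton'.mp hz
    have hyb : y * b s ∈ nilradical R := by
      simpa [Submodule.mem_colon_singleton] using hy
    -- In R, a^m = l + t b_s + y with y b_s nilpotent. If a prime P contains b_s + y a but not a,
    -- then each of y, b_s lies in P as soon as the other does, and one of them does. So both lie in
    -- P, and a^m ∈ P follows.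
    refine ⟨Function.update c s y, ?_⟩
    rw [Ideal.radical_eq_sInf, Submodule.mem_sInf]
    rintro P ⟨hP, hprime⟩
    by_contra ha
    have hle : Ideal.span ((fun i => b i + c i * a) '' (T : Set ι)) ≤ P := by
      rw [Ideal.span_le]
      rintro _ ⟨i, hi, rfl⟩
      refine hP (Ideal.subset_span ⟨i, by simp [Finset.mem_coe.mp hi], ?_⟩)
      have : i ≠ s := fun e => hs (e ▸ hi)
      simp [this]
    have hsP : b s + y * a ∈ P :=
      hP (Ideal.subset_span ⟨s, by simp, by simp⟩)
    have hyP : y ∈ P := by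
      rcases hprime.mem_or_mem (nilradical_le_prime P hyb) with h1 | h1
      · exact h1
      · have : y * a ∈ P := by simpa using P.sub_mem hsP h1
        exact (hprime.mem_or_mem this).resolve_right ha
    have hbP : b s ∈ P := by simpa using P.sub_mem hsP (Ideal.mul_mem_right a P hyP)
    refine ha (hprime.mem_of_pow_mem m ?_)
    have : a ^ m = l + (t * b s + y) := by rw [hzy]; ring
    rw [this]
    exact P.add_mem (hle hl) (P.add_mem (Ideal.mul_mem_left P _ hbP) hyP)

/-- The row of entries `u i`, `i ∈ S`, is unimodular. -/
def Unimod {R ι : Type*} [CommRing R] (S : Finset ι) (u : ι → R) : Prop :=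
  ∃ w : ι → R, ∑ i ∈ S, w i * u i = 1

theorem unimod_iff_span {R ι : Type*} [CommRing R] {S : Finset ι} {u : ι → R} :
    Unimod S u ↔ Ideal.span (u '' (S : Set ι)) = ⊤ := by
  rw [Ideal.eq_top_iff_one, Submodule.mem_span_image_finset_iff_exists_fun']
  simp [Unimod]

/-- `StableRankLE R k`: for rows of length at least `k + 1`, adding multiples of one entry to the
others makes these others unimodular. -/
def StableRankLE (R : Type*) [CommRing R] (k : ℕ) : Prop :=
  ∀ (ι : Type) [DecidableEq ι] (S : Finset ι), k ≤ S.card → ∀ (a : R) (b : ι → R),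
    (∃ (w : ι → R) (w' : R), ∑ i ∈ S, w i * b i + w' * a = 1) →
    ∃ c : ι → R, Unimod S fun i => b i + c i * a

/-- Kronecker's theorem is used on k of the entries, the others being left alone. A maximal ideal
containing all new entries contains a, hence all old entries. -/
theorem StableRankLE.of_ringKrullDim_lt {R : Type*} [CommRing R] {k : ℕ}
    (h : ringKrullDim R < k) : StableRankLE R k := by
  intro ι _ S hS a b ⟨w, w', hw⟩
  obtain ⟨T, hTS, hT⟩ := Finset.exists_subset_card_eq hS
  obtain ⟨c, hc⟩ := exists_mem_radical_span_of_ringKrullDim_lt k R h T hT a b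
  refine ⟨fun i => if i ∈ T then c i else 0, ?_⟩
  rw [unimod_iff_span]
  by_contra hne
  obtain ⟨m, hm, hle⟩ := Ideal.exists_le_maximal _ hne
  have ha : a ∈ m := by
    refine hm.isPrime.radical_le_iff.mpr ?_ hc
    refine le_trans (Ideal.span_le.mpr ?_) hle
    rintro _ ⟨i, hi, rfl⟩
    exact Ideal.subset_span ⟨i, hTS hi, by simp [Finset.mem_coe.mp hi]⟩
  have hb : ∀ i ∈ S, b i ∈ m := by
    intro i hi
    have := m.sub_mem (hle (Ideal.subset_span ⟨i, hi, rfl⟩))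
      (m.mul_mem_left (if i ∈ T then c i else 0) ha)
    simpa using this
  refine hm.ne_top (m.eq_top_iff_one.mpr ?_)
  rw [← hw]
  exact m.add_mem (m.sum_mem fun i hi => m.mul_mem_left _ (hb i hi)) (m.mul_mem_left _ ha)

/-- The double of `R` along `I`, the ring of pairs congruent modulo `I`. -/
def Double {R : Type*} [CommRing R] (I : Ideal R) : Subring (R × R) :=
  RingHom.eqLocus ((Ideal.Quotient.mk I).comp (RingHom.fst R R))
    ((Ideal.Quotient.mk I).comp (RingHom.snd R R))

namespace Double

variable {R : Type*} [CommRing R] {I : Ideal R}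

/-- The first projection of the double. -/
def fst (I : Ideal R) : Double I →+* R := (RingHom.fst R R).comp (Double I).subtype

/-- The second projection of the double. -/
def snd (I : Ideal R) : Double I →+* R := (RingHom.snd R R).comp (Double I).subtype

theorem mem_iff {x : R × R} : x ∈ Double I ↔ x.2 - x.1 ∈ I := by
  rw [← Ideal.Quotient.mk_eq_mk_iff_sub_mem]
  exact eq_comm

/-- The element of the double with given components. -/
def mk (x y : R) (h : y - x ∈ I) : Double I := ⟨(x, y), mem_iff.mpr h⟩

@[simp] theorem fst_mk (x y : R) (h : y - x ∈ I) : fst I (mk x y h) = x := rfl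

@[simp] theorem snd_mk (x y : R) (h : y - x ∈ I) : snd I (mk x y h) = y := rfl

theorem snd_sub_fst_mem (z : Double I) : snd I z - fst I z ∈ I := mem_iff.mp z.2

theorem ext {z w : Double I} (h₁ : fst I z = fst I w) (h₂ : snd I z = snd I w) : z = w :=
  Subtype.ext (Prod.ext h₁ h₂)

end Double

/-- The stable rank condition is used twice in R: once for the first components, then to correct the
second components by multiples lying in I, so that the two solutions still form pairs of the double.
-/
theorem StableRankLE.double {R : Type*} [CommRing R] {k : ℕ} (h : StableRankLE R k) (I : Ideal R) :
    StableRankLE (Double I) k := by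
  intro ι _ S hS a b ⟨w, w', hw⟩
  set p := Double.fst I
  set q := Double.snd I
  have hp := congrArg p hw
  have hq := congrArg q hw
  simp only [map_add, map_sum, map_mul, map_one] at hp hq
  obtain ⟨c, v, hv⟩ := h ι S hS (p a) (fun i => p (b i)) ⟨fun i => p (w i), p w', hp⟩
  -- the second components, after adding the same multiples of the second component of `a`
  set y : ι → R := fun i => q (b i) + c i * q a with hy
  set x : ι → R := fun i => p (b i) + c i * p a with hx
  have hyx : ∀ i, y i - x i ∈ I := fun i => by
    have h1 := Double.snd_sub_fst_mem (b i)
    have h2 := I.mul_mem_left (c i) (Double.snd_sub_fst_mem a)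
    have : y i - x i = (q (b i) - p (b i)) + c i * (q a - p a) := by simp only [hy, hx]; ring
    rw [this]
    exact I.add_mem h1 h2
  have hI : 1 - ∑ i ∈ S, v i * y i ∈ I := by
    rw [← hv, ← Finset.sum_sub_distrib]
    refine I.sum_mem fun i _ => ?_
    rw [← mul_sub]
    exact I.mul_mem_left _ (by simpa using I.neg_mem (hyx i))
  set e := 1 - ∑ i ∈ S, v i * y i with he
  -- Replacing q a by e * q a with e ∈ I keeps the row unimodular, because v · y = 1 - e, and it
  -- forces the correction c' e into I.
  obtain ⟨c', v', hv'⟩ := h ι S hS (e * q a) y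
    ⟨fun i => v i + e * q (w i), q w' - ∑ i ∈ S, q (w i) * c i, by
      have h1 : ∑ i ∈ S, (v i + e * q (w i)) * y i = ∑ i ∈ S, v i * y i +
          e * (∑ i ∈ S, q (w i) * q (b i) + (∑ i ∈ S, q (w i) * c i) * q a) := by
        simp only [hy, Finset.sum_mul, Finset.mul_sum, ← Finset.sum_add_distrib]
        exact Finset.sum_congr rfl fun i _ => by ring
      rw [h1]
      linear_combination e * hq - he⟩
  have hz : ∀ i, (y i + c' i * (e * q a)) - x i ∈ I := fun i => by
    have : (y i + c' i * (e * q a)) - x i = (y i - x i) + (c' i * q a) * e := by ring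
    rw [this]
    exact I.add_mem (hyx i) (I.mul_mem_left _ hI)
  refine ⟨fun i => Double.mk (c i) (c i + c' i * e) (by simpa using I.mul_mem_left _ hI), ?_⟩
  -- The coefficients v' need not be congruent to v; v + k v' is, and it still gives the value (1 -
  -- k) + k = 1.
  set k := 1 - ∑ i ∈ S, v i * (y i + c' i * (e * q a)) with hk
  have hkI : k ∈ I := by
    rw [hk, ← hv, ← Finset.sum_sub_distrib]
    refine I.sum_mem fun i _ => ?_
    rw [← mul_sub]
    exact I.mul_mem_left _ (by simpa using I.neg_mem (hz i))
  refine ⟨fun i => Double.mk (v i) (v i + k * v' i)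
    (by simpa using I.mul_mem_right _ hkI), Double.ext ?_ ?_⟩
  · simpa using hv
  · have : ∑ i ∈ S, (v i + k * v' i) * (y i + c' i * (e * q a)) =
        ∑ i ∈ S, v i * (y i + c' i * (e * q a)) +
          k * ∑ i ∈ S, v' i * (y i + c' i * (e * q a)) := by
      rw [Finset.mul_sum, ← Finset.sum_add_distrib]
      exact Finset.sum_congr rfl fun i _ => by ring
    rw [hv'] at this
    simp only [map_sum, map_mul, map_add, map_one, Double.snd_mk]
    trans ∑ i ∈ S, (v i + k * v' i) * (y i + c' i * (e * q a))
    · exact Finset.sum_congr rfl fun i _ => by simp only [hy]; ring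
    · rw [this, hk]; ring

/-! ### Rank one perturbations of the identity -/

section Tv

set_option linter.unusedSectionVars false

variable {R : Type*} [CommRing R] {ι : Type*} [Fintype ι] [DecidableEq ι]

/-- The matrix `1 + u vᵀ`. -/
def tv (u v : ι → R) : Matrix ι ι R := 1 + vecMulVec u v

theorem tv_mulVec (u v x : ι → R) : tv u v *ᵥ x = x + (v ⬝ᵥ x) • u := by
  rw [tv, add_mulVec, one_mulVec, vecMulVec_mulVec]
  simp

theorem vecMul_tv (u v x : ι → R) : x ᵥ* tv u v = x + (x ⬝ᵥ u) • v := by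
  rw [tv, vecMul_add, vecMul_one, vecMul_vecMulVec]

theorem tv_mul_tv (u v x y : ι → R) :
    tv u v * tv x y = 1 + vecMulVec u v + vecMulVec x y + (v ⬝ᵥ x) • vecMulVec u y := by
  rw [tv, tv, add_mul, mul_add, mul_add, vecMulVec_mul_vecMulVec, vecMulVec_smul]
  simp [add_assoc, add_comm, add_left_comm]

theorem tv_zero_left (v : ι → R) : tv 0 v = 1 := by simp [tv]

theorem tv_zero_right (v : ι → R) : tv v 0 = 1 := by simp [tv]

theorem tv_smul_left (r : R) (u v : ι → R) : tv (r • u) v = tv u (r • v) := by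
  simp [tv, smul_vecMulVec]

theorem tv_mul_tv_same_right {u u' v : ι → R} (h : v ⬝ᵥ u' = 0) :
    tv u v * tv u' v = tv (u + u') v := by
  rw [tv_mul_tv, h, tv, add_vecMulVec]
  simp [add_assoc]

theorem tv_mul_tv_same_left {u v v' : ι → R} (h : v ⬝ᵥ u = 0) :
    tv u v * tv u v' = tv u (v + v') := by
  rw [tv_mul_tv, h, tv, vecMulVec_add]
  simp [add_assoc]

theorem tv_mul_neg {u v : ι → R} (h : v ⬝ᵥ u = 0) : tv u v * tv (-u) v = 1 := by
  rw [tv_mul_tv_same_right (by simp [h]), add_neg_cancel, tv_zero_left]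

theorem tv_neg_mul {u v : ι → R} (h : v ⬝ᵥ u = 0) : tv (-u) v * tv u v = 1 := by
  rw [tv_mul_tv_same_right h, neg_add_cancel, tv_zero_left]

theorem mul_tv {A B : Matrix ι ι R} (h : B * A = 1) (u v : ι → R) :
    A * tv u v = tv (A *ᵥ u) (v ᵥ* B) * A := by
  rw [tv, tv, mul_add, add_mul, mul_vecMulVec, vecMulVec_mul, vecMul_vecMul, h]
  simp

theorem transvection_eq_tv (i j : ι) (r : R) :
    transvection i j r = tv (Pi.single i r) (Pi.single j 1) := by
  ext a b
  simp only [transvection, tv, vecMulVec_apply, Matrix.single_apply, Pi.single_apply, Matrix.add_apply]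
  split_ifs <;> simp_all

theorem transvection_eq_tv' (i j : ι) (r : R) :
    transvection i j r = tv (Pi.single i 1) (Pi.single j r) := by
  ext a b
  simp only [transvection, tv, vecMulVec_apply, Matrix.single_apply, Pi.single_apply, Matrix.add_apply]
  split_ifs <;> simp_all

theorem transpose_tv (u v : ι → R) : (tv u v)ᵀ = tv v u := by
  ext i j
  simp [tv, vecMulVec_apply, one_apply, eq_comm, mul_comm]

/-! ### Monoids generated by elementary matrices -/

/-- The monoid (in fact a group) generated by the elementary matrices `e_{ij}(r)` at the
positions `(i, j)`, `i ≠ j`, such that `P i j`. -/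
def elem (R : Type*) [CommRing R] (P : ι → ι → Prop) : Submonoid (Matrix ι ι R) :=
  Submonoid.closure {g | ∃ i j, i ≠ j ∧ P i j ∧ ∃ r : R, g = transvection i j r}

/-- The elementary group on the indices in `S`. -/
abbrev elemOn (R : Type*) [CommRing R] (S : Finset ι) : Submonoid (Matrix ι ι R) :=
  elem R fun i j => i ∈ S ∧ j ∈ S

variable {P Q : ι → ι → Prop}

theorem transvection_mem_elem {i j : ι} (h : i ≠ j) (hP : P i j) (r : R) :
    transvection i j r ∈ elem R P :=
  Submonoid.subset_closure ⟨i, j, h, hP, r, rfl⟩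

theorem elem_mono (h : ∀ i j, P i j → Q i j) : elem R P ≤ elem R Q :=
  Submonoid.closure_mono fun _ ⟨i, j, hij, hP, r, hr⟩ => ⟨i, j, hij, h i j hP, r, hr⟩

theorem elemOn_mono {S T : Finset ι} (h : S ⊆ T) : elemOn R S ≤ elemOn R T :=
  elem_mono fun _ _ hij => ⟨h hij.1, h hij.2⟩

/-- Induction on an element of an elementary group, multiplying by generators on the left. -/
theorem elem_induction_left {p : ∀ g : Matrix ι ι R, g ∈ elem R P → Prop}
    (one : p 1 (Submonoid.one_mem _))
    (mul : ∀ i j (hij : i ≠ j) (hP : P i j) (r : R) (g) (hg : g ∈ elem R P), p g hg →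
      p (transvection i j r * g) (Submonoid.mul_mem _ (transvection_mem_elem hij hP r) hg))
    {g : Matrix ι ι R} (hg : g ∈ elem R P) : p g hg := by
  refine Submonoid.closure_induction_left (motive := p) one ?_ hg
  rintro _ ⟨i, j, hij, hP, r, rfl⟩ y hy ih
  exact mul i j hij hP r y hy ih

/-- Induction on an element of an elementary group, multiplying by generators on the right. -/
theorem elem_induction_right {p : ∀ g : Matrix ι ι R, g ∈ elem R P → Prop}
    (one : p 1 (Submonoid.one_mem _))
    (mul : ∀ i j (hij : i ≠ j) (hP : P i j) (r : R) (g) (hg : g ∈ elem R P), p g hg →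
      p (g * transvection i j r) (Submonoid.mul_mem _ hg (transvection_mem_elem hij hP r)))
    {g : Matrix ι ι R} (hg : g ∈ elem R P) : p g hg := by
  refine Submonoid.closure_induction_right (motive := p) one ?_ hg
  rintro y hy _ ⟨i, j, hij, hP, r, rfl⟩ ih
  exact mul i j hij hP r y hy ih

theorem tv_single_right_mem_elem {j : ι} {c : ι → R} (h : ∀ i, c i ≠ 0 → i ≠ j ∧ P i j) :
    tv c (Pi.single j 1) ∈ elem R P := by
  classical
  have key : ∀ s : Finset ι, tv (∑ i ∈ s, Pi.single i (c i)) (Pi.single j 1) ∈ elem R P := by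
    intro s
    induction s using Finset.induction_on with
    | empty => simp [tv_zero_left]
    | insert a s ha ih =>
      rw [Finset.sum_insert ha]
      by_cases hc : c a = 0
      · simpa [hc] using ih
      · rw [add_comm, ← tv_mul_tv_same_right (by simp [(h a hc).1.symm]), ← transvection_eq_tv]
        exact Submonoid.mul_mem _ ih (transvection_mem_elem (h a hc).1 (h a hc).2 _)
  simpa [Finset.univ_sum_single] using key Finset.univ

theorem tv_single_left_mem_elem {i : ι} {c : ι → R} (h : ∀ j, c j ≠ 0 → i ≠ j ∧ P i j) :
    tv (Pi.single i 1) c ∈ elem R P := by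
  classical
  have key : ∀ s : Finset ι, tv (Pi.single i 1) (∑ j ∈ s, Pi.single j (c j)) ∈ elem R P := by
    intro s
    induction s using Finset.induction_on with
    | empty => simp [tv_zero_right]
    | insert a s ha ih =>
      rw [Finset.sum_insert ha]
      by_cases hc : c a = 0
      · simpa [hc] using ih
      · rw [← tv_mul_tv_same_left (by simp [(h a hc).1.symm]), ← transvection_eq_tv']
        exact Submonoid.mul_mem _ (transvection_mem_elem (h a hc).1 (h a hc).2 _) ih
  simpa [Finset.univ_sum_single] using key Finset.univ

theorem exists_inverse_mem_elem {g : Matrix ι ι R} (hg : g ∈ elem R P) :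
    ∃ h ∈ elem R P, g * h = 1 ∧ h * g = 1 := by
  induction hg using elem_induction_left with
  | one => exact ⟨1, Submonoid.one_mem _, by simp⟩
  | mul i j hij hP r g hg ih =>
    obtain ⟨h, hh, h1, h2⟩ := ih
    refine ⟨h * transvection i j (-r), Submonoid.mul_mem _ hh (transvection_mem_elem hij hP _),
      ?_, ?_⟩
    · rw [mul_assoc, ← mul_assoc g, h1, one_mul, transvection_mul_transvection_same _ _ hij]
      simp
    · rw [mul_assoc, ← mul_assoc (transvection i j (-r)), transvection_mul_transvection_same _ _ hij]
      simp [h2]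

theorem det_eq_one_of_mem_elem {g : Matrix ι ι R} (hg : g ∈ elem R P) : g.det = 1 := by
  induction hg using elem_induction_left with
  | one => simp
  | mul i j hij hP r g hg ih => rw [det_mul, ih, det_transvection_of_ne _ _ hij, mul_one]

theorem mulVec_single_of_mem_elem {g : Matrix ι ι R} (hg : g ∈ elem R P) {p : ι}
    (hp : ∀ i j, P i j → j ≠ p) : g *ᵥ Pi.single p 1 = Pi.single p 1 := by
  induction hg using elem_induction_right with
  | one => exact one_mulVec _
  | mul i j hij hP r g hg ih =>
    rw [← mulVec_mulVec, transvection_eq_tv, tv_mulVec]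
    simpa [hp i j hP] using ih

theorem single_vecMul_of_mem_elem {g : Matrix ι ι R} (hg : g ∈ elem R P) {q : ι}
    (hq : ∀ i j, P i j → i ≠ q) : Pi.single q 1 ᵥ* g = Pi.single q 1 := by
  induction hg using elem_induction_left with
  | one => simp
  | mul i j hij hP r g hg ih =>
    rw [← vecMul_vecMul, transvection_eq_tv, vecMul_tv]
    simpa [(hq i j hP).symm] using ih

theorem submatrix_mem_elem {κ : Type*} [Fintype κ] [DecidableEq κ] (e : κ ≃ ι)
    {g : Matrix ι ι R} (hg : g ∈ elem R P) :
    g.submatrix e e ∈ elem R fun i j => P (e i) (e j) := by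
  induction hg using elem_induction_left with
  | one => simp
  | mul i j hij hP r g hg ih =>
    rw [← submatrix_mul_equiv _ _ e e e]
    refine Submonoid.mul_mem _ ?_ ih
    have : (transvection i j r).submatrix e e = transvection (e.symm i) (e.symm j) r := by
      ext a b
      simp [transvection, Matrix.single_apply, one_apply, Equiv.symm_apply_eq]
    rw [this]
    exact transvection_mem_elem (by simpa using hij) (by simpa using hP) r

theorem map_mem_elem {S : Type*} [CommRing S] (f : R →+* S) {g : Matrix ι ι R}
    (hg : g ∈ elem R P) : g.map f ∈ elem S P := by
  induction hg using elem_induction_left with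
  | one => simp
  | mul i j hij hP r g hg ih =>
    rw [Matrix.map_mul]
    refine Submonoid.mul_mem _ ?_ ih
    have : (transvection i j r).map f = transvection i j (f r) := by
      simp [transvection, Matrix.map_add]
    rw [this]
    exact transvection_mem_elem hij hP _

end Tv

/-! ### The Dennis–Vaserstein decomposition and injective stability for `K₁` -/

section Stability

set_option linter.unusedSectionVars false

variable {R : Type*} [CommRing R] {ι : Type} [Fintype ι] [DecidableEq ι]

/-- Semidirect decomposition of a parabolic group: the generators in row p form a normal unipotent
part and are moved to the right past the block on the remaining indices. -/
theorem exists_mul_tv_single_left {S : Finset ι} {p : ι} (hp : p ∈ S) {g : Matrix ι ι R}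
    (hg : g ∈ elem R fun i j => (i ∈ S ∧ j ∈ S) ∧ j ≠ p) :
    ∃ A ∈ elemOn R (S.erase p), ∃ a : ι → R, a p = 0 ∧ (∀ i ∉ S, a i = 0) ∧
      g = A * tv (Pi.single p 1) a := by
  induction hg using elem_induction_left with
  | one => exact ⟨1, Submonoid.one_mem _, 0, rfl, fun _ _ => rfl, by simp [tv_zero_right]⟩
  | mul i j hij hP r g hg ih =>
    obtain ⟨A, hA, a, hap, haS, rfl⟩ := ih
    by_cases hi : i = p
    · subst hi
      obtain ⟨B, hB, hAB, hBA⟩ := exists_inverse_mem_elem hA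
      have hfix : ∀ x, x ∉ S.erase i → (Pi.single j r ᵥ* A) x = (Pi.single j r : ι → R) x := by
        intro x hx
        have := mulVec_single_of_mem_elem hA (p := x) fun _ _ h e => hx (e ▸ h.2)
        have h2 : (Pi.single j r ᵥ* A) ⬝ᵥ Pi.single x 1 = Pi.single j r ⬝ᵥ Pi.single x 1 := by
          rw [← dotProduct_mulVec, this]
        simpa [-single_vecMul] using h2
      have hA' : B *ᵥ Pi.single i 1 = Pi.single i 1 :=
        mulVec_single_of_mem_elem hB fun _ _ h e => by simp [e] at h
      refine ⟨A, hA, Pi.single j r ᵥ* A + a, ?_, ?_, ?_⟩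
      · rw [Pi.add_apply, hfix i (by simp), hap]
        simp [hij]
      · intro x hx
        rw [Pi.add_apply, hfix x (by simp [hx]), haS x hx]
        have : x ≠ j := fun e => hx (e ▸ hP.1.2)
        simp [this]
      · rw [← tv_mul_tv_same_left, ← mul_assoc, ← mul_assoc, mul_tv hBA, transvection_eq_tv',
          vecMul_vecMul, hAB, vecMul_one]
        · congr 3
          rw [← hA', mulVec_mulVec, hAB, one_mulVec, hA']
        · rw [dotProduct_single, mul_one, hfix i (by simp)]
          simp [hij]
    · refine ⟨transvection i j r * A, Submonoid.mul_mem _ (transvection_mem_elem hij ?_ r) hA, a,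
        hap, haS, by rw [mul_assoc]⟩
      simp [hi, hP.1, hP.2]

theorem exists_mul_tv_single_right {S : Finset ι} {q : ι} (hq : q ∈ S) {g : Matrix ι ι R}
    (hg : g ∈ elem R fun i j => (i ∈ S ∧ j ∈ S) ∧ i ≠ q) :
    ∃ A ∈ elemOn R (S.erase q), ∃ c : ι → R, c q = 0 ∧ (∀ i ∉ S, c i = 0) ∧
      g = A * tv c (Pi.single q 1) := by
  induction hg using elem_induction_right with
  | one => exact ⟨1, Submonoid.one_mem _, 0, rfl, fun _ _ => rfl, by simp [tv_zero_left]⟩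
  | mul i j hij hP r g hg ih =>
    obtain ⟨A, hA, c, hcq, hcS, rfl⟩ := ih
    by_cases hj : j = q
    · subst hj
      refine ⟨A, hA, c + Pi.single i r, ?_, ?_, ?_⟩
      · simp [hcq, hij.symm]
      · intro x hx
        have : x ≠ i := fun e => hx (e ▸ hP.1.1)
        simp [hcS x hx, this]
      · rw [mul_assoc, transvection_eq_tv, tv_mul_tv_same_right]
        simp [hij.symm]
    · refine ⟨A * transvection i j r, Submonoid.mul_mem _ hA (transvection_mem_elem hij ?_ r),
        c - (Pi.single j 1 ⬝ᵥ c) • Pi.single i r, ?_, ?_, ?_⟩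
      · simp [hj, hP.1, hP.2]
      · simp [hcq, hP.2.symm]
      · intro x hx
        have : x ≠ i := fun e => hx (e ▸ hP.1.1)
        simp [hcS x hx, this]
      · rw [mul_assoc, mul_assoc, transvection_eq_tv, mul_tv (B := tv (-Pi.single i r)
          (Pi.single j 1)) (A := tv (Pi.single i r) (Pi.single j 1)), tv_mulVec, vecMul_tv]
        · congr 3
          · ext x
            simp [hij.symm, sub_eq_add_neg]
          · simp [hP.2]
        · exact tv_neg_mul (by simp [hij.symm])

/-- The Steinberg commutator relation without coordinates; the next lemma is another form of it. -/
theorem tv_mul_tv_eq_mul_mul {d x y z : ι → R} (hy : y ⬝ᵥ d = 0) (hz : z ⬝ᵥ d = 0) :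
    tv d z * tv x y = tv x y * (tv d z * tv ((z ⬝ᵥ x) • d) y) := by
  rw [tv_mul_tv, tv_mul_tv]
  simp only [tv, add_mul, mul_add, one_mul, mul_one, vecMulVec_mul_vecMulVec, vecMulVec_smul,
    dotProduct_smul, hy, hz, zero_smul, smul_zero, vecMulVec_zero, add_zero, smul_vecMulVec,
    mul_smul_comm]
  abel

theorem tv_eq_mul_mul_mul {c x y z : ι → R} (hx : c ⬝ᵥ x = 0) (hz : c ⬝ᵥ z = 0) :
    tv x y = tv z c * tv x ((y ⬝ᵥ z) • c) * tv x y * tv z (-c) := by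
  have hd : ((y ⬝ᵥ z) • c) ⬝ᵥ x = 0 := by rw [smul_dotProduct, hx, smul_zero]
  rw [mul_assoc, mul_assoc, ← mul_assoc (tv x _) (tv x y), tv_mul_tv_same_left hd, tv_mul_tv]
  simp only [tv, add_mul, mul_add, one_mul, mul_one, vecMulVec_mul_vecMulVec, vecMulVec_smul,
    dotProduct_smul, hx, hz, hd, zero_smul, smul_zero, vecMulVec_zero, add_zero, zero_add,
    smul_vecMulVec, mul_smul_comm, add_dotProduct, smul_dotProduct, vecMulVec_add, vecMulVec_neg,
    smul_neg, smul_mul_assoc, mul_neg, neg_zero]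
  abel

/-- Moved to the right past A, the generator e_{ip}(r) becomes 1 + w e_pᵀ with w = r A⁻¹ e_i, which
passes the row part 1 + e_p aᵀ well only if a · w = 0. The stable rank condition allows A and a to
be modified so that this holds, at the cost of factors that commute with e_{qp}(s) up to elements of
the two parabolic groups. -/
theorem exists_dennis_vaserstein_step {k : ℕ} (hR : StableRankLE R k) {S : Finset ι} {p q : ι}
    (hp : p ∈ S) (hq : q ∈ S) (hpq : p ≠ q) (hk : k ≤ ((S.erase p).erase q).card)
    {A : Matrix ι ι R} (hA : A ∈ elemOn R (S.erase p)) {a : ι → R} (hap : a p = 0)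
    (haS : ∀ i ∉ S, a i = 0) {i : ι} (hi : i ∈ S) (hip : i ≠ p) (r s : R) :
    ∃ X ∈ elem R fun i j => (i ∈ S ∧ j ∈ S) ∧ j ≠ p, ∃ s' : R,
      ∃ Y ∈ elem R fun i j => (i ∈ S ∧ j ∈ S) ∧ i ≠ q,
      transvection i p r * (A * tv (Pi.single p 1) a) * transvection q p s =
        X * transvection q p s' * Y := by
  obtain ⟨B, hB, hAB, hBA⟩ := exists_inverse_mem_elem hA
  set w0 := B *ᵥ Pi.single i 1 with hw0
  have hfix : ∀ C ∈ elemOn R (S.erase p), ∀ (v : ι → R) (x), x ∉ S.erase p →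
      (C *ᵥ v) x = v x := by
    intro C hC v x hx
    have := single_vecMul_of_mem_elem hC (q := x) fun _ _ h e => hx (e ▸ h.1)
    have h2 : Pi.single x 1 ⬝ᵥ (C *ᵥ v) = Pi.single x 1 ⬝ᵥ v := by
      rw [dotProduct_mulVec, this]
    simpa using h2
  have hfix' : ∀ C ∈ elemOn R (S.erase p), ∀ (v : ι → R) (x), x ∉ S.erase p →
      (v ᵥ* C) x = v x := by
    intro C hC v x hx
    have := mulVec_single_of_mem_elem hC (p := x) fun _ _ h e => hx (e ▸ h.2)
    have h2 : (v ᵥ* C) ⬝ᵥ Pi.single x 1 = v ⬝ᵥ Pi.single x 1 := by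
      rw [← dotProduct_mulVec, this]
    simpa using h2
  have hw0S : ∀ x ∉ S.erase p, w0 x = 0 := fun x hx => by
    have : x ≠ i := fun e => hx (by simp [e, hi, hip])
    rw [hw0, hfix B hB _ x hx]
    simp [this]
  set J := (S.erase p).erase q with hJ
  have hpJ : p ∉ J := by simp [hJ]
  have hqJ : q ∉ J := by simp [hJ]
  have hJS : J ⊆ S := (Finset.erase_subset _ _).trans (Finset.erase_subset _ _)
  have huni : ∃ (w : ι → R) (w' : R), ∑ i ∈ J, w i * w0 i + w' * w0 q = 1 := by
    refine ⟨Pi.single i 1 ᵥ* A, (Pi.single i 1 ᵥ* A) q, ?_⟩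
    rw [hJ, Finset.sum_erase_add (S.erase p) (fun x => (Pi.single i 1 ᵥ* A) x * w0 x)
      (by simp [hq, hpq.symm])]
    have : (Pi.single i 1 ᵥ* A) ⬝ᵥ w0 = 1 := by
      rw [hw0, dotProduct_mulVec, vecMul_vecMul, hAB, vecMul_one, dotProduct_single, mul_one]
      exact Pi.single_eq_same (M := fun _ => R) i 1
    refine Eq.trans ?_ this
    refine Finset.sum_subset (Finset.subset_univ (S.erase p)) fun x _ hx => ?_
    rw [hw0S x hx, mul_zero]
  -- T, built from d, makes the entries of T w0 away from p and q unimodular, with coefficients l.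
  -- Hence a vector c supported away from p and q can cancel a · w0.
  obtain ⟨d0, l0, hl0⟩ := hR ι J hk (w0 q) w0 huni
  set d : ι → R := fun x => if x ∈ J then d0 x else 0 with hd
  set l : ι → R := fun x => if x ∈ J then l0 x else 0 with hl
  have hdp : d p = 0 := by simp [hd, hpJ]
  have hdq : d q = 0 := by simp [hd, hqJ]
  have hdJ : ∀ x, d x ≠ 0 → x ∈ J := fun x hx => by
    by_contra h
    simp [hd, h] at hx
  set T := tv d (Pi.single q 1) with hT
  set T' := tv (-d) (Pi.single q 1) with hT'
  have hTT' : T' * T = 1 := tv_neg_mul (by simp [hdq])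
  have hTT : T * T' = 1 := tv_mul_neg (by simp [hdq])
  have hlT : l ⬝ᵥ (T *ᵥ w0) = 1 := by
    rw [hT, tv_mulVec, single_one_dotProduct]
    refine Eq.trans ?_ hl0
    simp only [dotProduct, Pi.add_apply, Pi.smul_apply, hl, hd, ite_mul,
      zero_mul, Finset.sum_ite_mem, Finset.univ_inter]
    refine Finset.sum_congr rfl fun x hx => ?_
    simp [hx, mul_comm (w0 q)]
  set c : ι → R := -(a ⬝ᵥ w0) • l with hc
  have hcp : c p = 0 := by simp [hc, hl, hpJ]
  have hcq : c q = 0 := by simp [hc, hl, hqJ]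
  have hcJ : ∀ x, c x ≠ 0 → x ∈ J := fun x hx => by
    by_contra h
    simp [hc, hl, h] at hx
  set U := tv (Pi.single q 1) (s • c) with hU
  set U' := tv (Pi.single q 1) (-(s • c)) with hU'
  have hUU : U * U' = 1 := by
    rw [hU, hU', tv_mul_tv_same_left (by simp [hcq]), add_neg_cancel, tv_zero_right]
  have hUU' : U' * U = 1 := by
    rw [hU, hU', tv_mul_tv_same_left (by simp [hcq]), neg_add_cancel, tv_zero_right]
  have hTm : T ∈ elemOn R (S.erase p) := tv_single_right_mem_elem fun x hx => by
    have := hdJ x hx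
    simp only [hJ, Finset.mem_erase] at this
    simp [this, hq, hpq.symm]
  have hTm' : T' ∈ elemOn R (S.erase p) := tv_single_right_mem_elem fun x hx => by
    have := hdJ x (by simpa using hx)
    simp only [hJ, Finset.mem_erase] at this
    simp [this, hq, hpq.symm]
  have hUm : U ∈ elemOn R (S.erase p) := tv_single_left_mem_elem fun x hx => by
    have := hcJ x fun h => hx (by simp [h])
    simp only [hJ, Finset.mem_erase] at this
    simp [this, hq, hpq.symm, this.1.symm]
  have hUm' : U' ∈ elemOn R (S.erase p) := tv_single_left_mem_elem fun x hx => by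
    have := hcJ x fun h => hx (by simp [h])
    simp only [hJ, Finset.mem_erase] at this
    simp [this, hq, hpq.symm, this.1.symm]
  set A2 := A * T' * U with hA2
  set B2 := U' * T * B with hB2
  have hA2m : A2 ∈ elemOn R (S.erase p) :=
    Submonoid.mul_mem _ (Submonoid.mul_mem _ hA hTm') hUm
  have hB2m : B2 ∈ elemOn R (S.erase p) :=
    Submonoid.mul_mem _ (Submonoid.mul_mem _ hUm' hTm) hB
  have hAB2 : A2 * B2 = 1 := by
    calc A2 * B2 = A * (T' * (U * U') * T) * B := by simp only [hA2, hB2, mul_assoc]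
      _ = 1 := by rw [hUU, mul_one, hTT', mul_one, hAB]
  have hBA2 : B2 * A2 = 1 := by
    calc B2 * A2 = U' * (T * (B * A) * T') * U := by simp only [hA2, hB2, mul_assoc]
      _ = 1 := by rw [hBA, mul_one, hTT, mul_one, hUU']
  set a2 := (a ᵥ* T' + c) ᵥ* U with ha2
  set w := r • (B2 *ᵥ Pi.single i 1) with hw
  have ha2w : a2 ⬝ᵥ w = 0 := by
    have : B2 *ᵥ Pi.single i 1 = U' *ᵥ (T *ᵥ w0) := by
      rw [hB2, hw0, mulVec_mulVec, mulVec_mulVec, mul_assoc]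
    rw [hw, ha2, this, dotProduct_smul, ← dotProduct_mulVec, mulVec_mulVec, hUU, one_mulVec,
      add_dotProduct, ← dotProduct_mulVec, mulVec_mulVec, hTT', one_mulVec, hc, smul_dotProduct,
      hlT]
    simp
  have ha2S : ∀ x ∉ S.erase p, a2 x = 0 := fun x hx => by
    rw [ha2, hfix' U hUm _ x hx, Pi.add_apply, hfix' T' hTm' _ x hx]
    have h1 : a x = 0 := by
      by_cases h : x = p
      · rw [h, hap]
      · exact haS x fun h' => hx (by simp [h, h'])
    have h2 : c x = 0 := by
      by_contra h
      exact hx (Finset.mem_of_mem_erase (hcJ x h))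
    rw [h1, h2, add_zero]
  have ha2p : a2 p = 0 := ha2S p (by simp)
  have hwS : ∀ x ∉ S.erase p, w x = 0 := fun x hx => by
    have : x ≠ i := fun e => hx (by simp [e, hi, hip])
    rw [hw, Pi.smul_apply, hfix B2 hB2m _ x hx]
    simp [this]
  have hwp : w p = 0 := hwS p (by simp)
  set rho := a2 ᵥ* B2 with hrho
  set D := tv (Pi.single i r) rho with hD
  -- D is a single row operation in row i whose diagonal entry r rho_i equals a2 · w = 0; the
  -- orthogonality is needed exactly here and in `e3`.
  have hDm : D ∈ elemOn R (S.erase p) := by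
    have h1 : (Pi.single i r : ι → R) = r • Pi.single i 1 := by
      rw [← Pi.single_smul, smul_eq_mul, mul_one]
    rw [hD, h1, tv_smul_left]
    refine tv_single_left_mem_elem fun x hx => ?_
    have hxS : x ∈ S.erase p := by
      by_contra h
      refine hx ?_
      rw [Pi.smul_apply, hrho, hfix' B2 hB2m _ x h, ha2S x h, smul_zero]
    have hxi : i ≠ x := by
      rintro rfl
      refine hx ?_
      have : (r • rho) i = a2 ⬝ᵥ w := by
        rw [hw, dotProduct_smul, dotProduct_mulVec, ← hrho]
        simp
      rw [this, ha2w]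
    exact ⟨hxi, by simp [hi, hip], hxS⟩
  -- the identities
  have e1 : T * transvection q p s = transvection q p s * (T * tv (s • d) (Pi.single p 1)) := by
    rw [transvection_eq_tv, hT, tv_mul_tv_eq_mul_mul (by simp [hdp]) (by simp [hdq])]
    simp
  have e2 : transvection q p s =
      tv (Pi.single p 1) c * U * transvection q p s * tv (Pi.single p 1) (-c) := by
    rw [transvection_eq_tv', hU]
    conv_lhs => rw [tv_eq_mul_mul_mul (c := c) (z := Pi.single p 1) (by simp [hcq])
      (by simp [hcp])]
    simp
  have e3 : tv w (Pi.single p 1) * tv (Pi.single p 1) a2 =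
      tv w a2 * tv (Pi.single p 1) a2 * tv w (Pi.single p 1) := by
    rw [tv_mul_tv, tv_mul_tv]
    simp only [tv, add_mul, mul_add, one_mul, mul_one, vecMulVec_mul_vecMulVec, dotProduct_single,
      ha2p, ha2w, zero_smul, vecMulVec_zero, add_zero, Pi.single_eq_same, one_smul]
    abel
  have e4 : tv w (Pi.single p 1) * transvection q p s =
      transvection q p (s + w q) * tv (w - Pi.single q (w q)) (Pi.single p 1) := by
    rw [transvection_eq_tv, transvection_eq_tv, tv_mul_tv_same_right, tv_mul_tv_same_right]
    · congr 1
      rw [Pi.single_add]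
      abel
    · simp [hwp, hpq]
    · simp [hpq]
  have e5 : tv (Pi.single p 1) a * T' = T' * tv (Pi.single p 1) (a ᵥ* T') := by
    rw [mul_tv hTT, vecMul_vecMul, hTT', vecMul_one,
      mulVec_single_of_mem_elem hTm' fun _ _ h e => by simp [e] at h]
  have e6 : tv (Pi.single p 1) (a ᵥ* T') * tv (Pi.single p 1) c * U =
      U * tv (Pi.single p 1) a2 := by
    rw [tv_mul_tv_same_left, mul_tv hUU', ha2, vecMul_vecMul, hUU, vecMul_one,
      mulVec_single_of_mem_elem hUm fun _ _ h e => by simp [e] at h]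
    rw [dotProduct_single, hfix' T' hTm' _ p (by simp), hap, zero_mul]
  have e7 : transvection i p r * A2 = A2 * tv w (Pi.single p 1) := by
    rw [mul_tv hBA2, hw, mulVec_smul, mulVec_mulVec, hAB2, one_mulVec, transvection_eq_tv]
    congr 2
    · rw [← Pi.single_smul, smul_eq_mul, mul_one]
    · rw [single_vecMul_of_mem_elem hB2m fun _ _ h e => by simp [e] at h]
  have e8 : A2 * tv w a2 = D * A2 := by
    rw [mul_tv hBA2, hD, hw, mulVec_smul, mulVec_mulVec, hAB2, one_mulVec, ← Pi.single_smul,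
      smul_eq_mul, mul_one]
  refine ⟨D * A2 * tv (Pi.single p 1) a2, ?_, s + w q,
    tv (w - Pi.single q (w q)) (Pi.single p 1) * tv (Pi.single p 1) (-c) *
      (T * tv (s • d) (Pi.single p 1)), ?_, ?_⟩
  · have hle : elemOn R (S.erase p) ≤ elem R fun i j => (i ∈ S ∧ j ∈ S) ∧ j ≠ p :=
      elem_mono fun i j h => by
        simp only [Finset.mem_erase] at h
        exact ⟨⟨h.1.2, h.2.2⟩, h.2.1⟩
    refine Submonoid.mul_mem _ (hle (Submonoid.mul_mem _ hDm hA2m))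
      (tv_single_left_mem_elem fun x hx => ?_)
    have hxS : x ∈ S.erase p := by
      by_contra h
      exact hx (ha2S x h)
    rw [Finset.mem_erase] at hxS
    exact ⟨hxS.1.symm, ⟨hp, hxS.2⟩, hxS.1⟩
  · refine Submonoid.mul_mem _ (Submonoid.mul_mem _ ?_ ?_) (Submonoid.mul_mem _ ?_ ?_)
    · refine tv_single_right_mem_elem fun x hx => ?_
      have hxq : x ≠ q := by
        rintro rfl
        simp at hx
      have hxS : x ∈ S.erase p := by
        by_contra h
        exact hx (by simp [hwS x h, hxq])
      rw [Finset.mem_erase] at hxS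
      exact ⟨hxS.1, ⟨hxS.2, hp⟩, hxq⟩
    · refine tv_single_left_mem_elem fun x hx => ?_
      have := hcJ x (by simpa using hx)
      exact ⟨fun e => hpJ (e ▸ this), ⟨hp, hJS this⟩, hpq⟩
    · refine tv_single_right_mem_elem fun x hx => ?_
      have := hdJ x hx
      exact ⟨fun e => hqJ (e ▸ this), ⟨hJS this, hq⟩, fun e => hqJ (e ▸ this)⟩
    · refine tv_single_right_mem_elem fun x hx => ?_
      have := hdJ x fun h => hx (by simp [h])
      exact ⟨fun e => hpJ (e ▸ this), ⟨hJS this, hp⟩, fun e => hqJ (e ▸ this)⟩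
  · set E := transvection q p s with hE
    set Y1 := T * tv (s • d) (Pi.single p 1)
    set ea := tv (Pi.single p 1) a
    set e' := transvection i p r
    set Rc := tv (Pi.single p 1) c
    set Rc' := tv (Pi.single p 1) (-c)
    calc e' * (A * ea) * E = e' * (A * ea) * (T' * (T * E)) := by
          rw [← mul_assoc T', hTT', one_mul]
      _ = e' * A * (ea * T') * E * Y1 := by rw [e1]; simp only [mul_assoc]
      _ = e' * A * (ea * T') * (Rc * U * E * Rc') * Y1 := by rw [← e2]
      _ = e' * A * T' * (tv (Pi.single p 1) (a ᵥ* T') * Rc * U) * E * Rc' * Y1 := by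
          rw [e5]; simp only [mul_assoc]
      _ = e' * A2 * tv (Pi.single p 1) a2 * E * Rc' * Y1 := by
          rw [e6]; simp only [hA2, mul_assoc]
      _ = A2 * (tv w (Pi.single p 1) * tv (Pi.single p 1) a2) * E * Rc' * Y1 := by
          rw [e7]; simp only [mul_assoc]
      _ = A2 * tv w a2 * tv (Pi.single p 1) a2 * (tv w (Pi.single p 1) * E) * Rc' * Y1 := by
          rw [e3]; simp only [mul_assoc]
      _ = _ := by rw [e8, e4]; simp only [mul_assoc]

end Stability

/-! ### Dennis–Vaserstein decomposition of the whole group and injective stability. -/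

section Stability

set_option linter.unusedSectionVars false

variable {R : Type*} [CommRing R] {ι : Type} [Fintype ι] [DecidableEq ι]

theorem exists_dennis_vaserstein {k : ℕ} (hR : StableRankLE R k) {S : Finset ι} {p q : ι}
    (hp : p ∈ S) (hq : q ∈ S) (hpq : p ≠ q) (hk : k ≤ ((S.erase p).erase q).card)
    {g : Matrix ι ι R} (hg : g ∈ elemOn R S) :
    ∃ X ∈ elem R fun i j => (i ∈ S ∧ j ∈ S) ∧ j ≠ p, ∃ s : R,
      ∃ Y ∈ elem R fun i j => (i ∈ S ∧ j ∈ S) ∧ i ≠ q, g = X * transvection q p s * Y := by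
  induction hg using elem_induction_left with
  | one => exact ⟨1, Submonoid.one_mem _, 0, 1, Submonoid.one_mem _, by simp⟩
  | mul i j hij hP r g hg ih =>
    obtain ⟨X, hX, s, Y, hY, rfl⟩ := ih
    by_cases hj : j = p
    · subst hj
      obtain ⟨A, hA, a, haj, haS, rfl⟩ := exists_mul_tv_single_left hp hX
      obtain ⟨X', hX', s', Y', hY', h⟩ :=
        exists_dennis_vaserstein_step hR hp hq hpq hk hA haj haS hP.1 hij r s
      refine ⟨X', hX', s', Y' * Y, Submonoid.mul_mem _ hY' hY, ?_⟩
      rw [← mul_assoc, ← mul_assoc, h]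
      simp only [mul_assoc]
    · refine ⟨transvection i j r * X, Submonoid.mul_mem _ ?_ hX, s, Y, hY, by
        simp only [mul_assoc]⟩
      exact transvection_mem_elem hij ⟨hP, hj⟩ r

/-- An elementary matrix on the indices `S` that fixes one of them is elementary on the others,
if `S` has at least two elements more than the stable rank. -/
theorem mem_elemOn_erase {k : ℕ} (hR : StableRankLE R k) {S : Finset ι} (hk : k + 2 ≤ S.card)
    {q : ι} (hq : q ∈ S) {g : Matrix ι ι R} (hg : g ∈ elemOn R S)
    (hcol : g *ᵥ Pi.single q 1 = Pi.single q 1) (hrow : Pi.single q 1 ᵥ* g = Pi.single q 1) :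
    g ∈ elemOn R (S.erase q) := by
  have hcard : (S.erase q).card + 1 = S.card := Finset.card_erase_add_one hq
  obtain ⟨p, hp⟩ : (S.erase q).Nonempty := Finset.card_pos.mp (by omega)
  rw [Finset.mem_erase] at hp
  have hk' : k ≤ ((S.erase p).erase q).card := by
    rw [Finset.erase_right_comm]
    have := Finset.card_erase_add_one (s := S.erase q) (a := p) (by simp [hp])
    omega
  obtain ⟨X, hX, s, Y, hY, hXY⟩ := exists_dennis_vaserstein hR hp.2 hq hp.1 hk' hg
  obtain ⟨Y', hY', hYY', hY'Y⟩ := exists_inverse_mem_elem hY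
  obtain ⟨A, hA, a, hap, haS, rfl⟩ := exists_mul_tv_single_left hp.2 hX
  -- the row of index `q`
  have hrowY' : Pi.single q 1 ᵥ* Y' = Pi.single q 1 :=
    single_vecMul_of_mem_elem hY' fun _ _ h => h.2
  have hApcol : A *ᵥ Pi.single p 1 = Pi.single p 1 :=
    mulVec_single_of_mem_elem hA fun _ _ h e => by simp [e] at h
  have hAprow : Pi.single p 1 ᵥ* A = Pi.single p 1 :=
    single_vecMul_of_mem_elem hA fun _ _ h e => by simp [e] at h
  -- Both g and Y fix the row of index q, so X e_{qp}(s) does as well. Comparing entries gives s = 0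
  -- and shows that A fixes this row.
  have h1 : Pi.single q 1 ᵥ* A ᵥ* tv (Pi.single p 1) a ᵥ* transvection q p s = Pi.single q 1 := by
    conv_rhs => rw [← hrowY', ← hrow, hXY]
    rw [vecMul_vecMul, vecMul_vecMul, vecMul_vecMul, mul_assoc _ Y, hYY', mul_one]
    simp only [mul_assoc]
  have hAqp : (Pi.single q 1 ᵥ* A) ⬝ᵥ Pi.single p 1 = 0 := by
    rw [← dotProduct_mulVec, hApcol]
    simp [hp.1]
  rw [vecMul_tv, hAqp, zero_smul, add_zero, transvection_eq_tv', vecMul_tv] at h1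
  have hAqq : (Pi.single q 1 ᵥ* A) q = 1 := by
    have := congrFun h1 q
    simpa [-single_vecMul, hp.1.symm] using this
  have hs : s = 0 := by
    have := congrFun h1 p
    rw [dotProduct_single] at hAqp
    simpa [-single_vecMul, hp.1, hAqq, (mul_one (_ : R)).symm.trans hAqp] using this
  have hAq : Pi.single q 1 ᵥ* A = Pi.single q 1 := by
    rw [hs] at h1
    simpa [-single_vecMul] using h1
  -- clear the column of index `q` of `A`
  set y := A *ᵥ Pi.single q 1 - Pi.single q 1 with hy
  have hyq : y q = 0 := by
    have : Pi.single q 1 ⬝ᵥ (A *ᵥ Pi.single q 1) = 1 := by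
      rw [dotProduct_mulVec, hAq]
      simp
    rw [single_one_dotProduct] at this
    rw [hy, Pi.sub_apply, this, Pi.single_eq_same, sub_self]
  have hyS : ∀ x ∉ S.erase p, y x = 0 := fun x hx => by
    have h2 : Pi.single x 1 ᵥ* A = Pi.single x 1 :=
      single_vecMul_of_mem_elem hA fun _ _ h e => hx (e ▸ h.1)
    have h3 : Pi.single x 1 ⬝ᵥ (A *ᵥ Pi.single q 1) = Pi.single x 1 ⬝ᵥ Pi.single q 1 := by
      rw [dotProduct_mulVec, h2]
    rw [single_one_dotProduct, single_one_dotProduct] at h3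
    rw [hy, Pi.sub_apply, h3, sub_self]
  have hyne : ∀ x, y x ≠ 0 → x ≠ q ∧ x ≠ p ∧ x ∈ S := fun x hx => by
    refine ⟨fun e => hx (e ▸ hyq), ?_⟩
    have : x ∈ S.erase p := by
      by_contra h
      exact hx (hyS x h)
    simpa using this
  set A' := tv (-y) (Pi.single q 1) * A with hA'
  have hAA' : A = tv y (Pi.single q 1) * A' := by
    rw [hA', ← mul_assoc, tv_mul_neg (by simpa using hyq), one_mul]
  have hA'm : A' ∈ elemOn R (S.erase p) := by
    refine Submonoid.mul_mem _ (tv_single_right_mem_elem fun x hx => ?_) hA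
    have := hyne x (by simpa using hx)
    simp [this, hq, hp.1.symm]
  have hA'pcol : A' *ᵥ Pi.single p 1 = Pi.single p 1 :=
    mulVec_single_of_mem_elem hA'm fun _ _ h e => by simp [e] at h
  have hA'prow : Pi.single p 1 ᵥ* A' = Pi.single p 1 :=
    single_vecMul_of_mem_elem hA'm fun _ _ h e => by simp [e] at h
  have hA'qrow : Pi.single q 1 ᵥ* A' = Pi.single q 1 := by
    rw [hA', ← vecMul_vecMul, vecMul_tv, single_one_dotProduct, Pi.neg_apply, hyq, neg_zero,
      zero_smul, add_zero, hAq]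
  have hA'qcol : A' *ᵥ Pi.single q 1 = Pi.single q 1 := by
    have : A *ᵥ Pi.single q 1 = y + Pi.single q 1 := by rw [hy, sub_add_cancel]
    rw [hA', ← mulVec_mulVec, this, tv_mulVec, single_one_dotProduct, Pi.add_apply, hyq,
      Pi.single_eq_same]
    simp
  -- `A'` is invariant under swapping `p` and `q`
  have hswap : A'.submatrix (Equiv.swap p q) (Equiv.swap p q) = A' := by
    have hrow' : ∀ x, (x = p ∨ x = q) → ∀ j, A' x j = (Pi.single x 1 : ι → R) j := by
      rintro x (rfl | rfl) j
      · rw [single_one_vecMul] at hA'prow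
        exact congrFun hA'prow j
      · rw [single_one_vecMul] at hA'qrow
        exact congrFun hA'qrow j
    have hcol' : ∀ x, (x = p ∨ x = q) → ∀ j, A' j x = (Pi.single x 1 : ι → R) j := by
      rintro x (rfl | rfl) j
      · rw [mulVec_single_one] at hA'pcol
        exact congrFun hA'pcol j
      · rw [mulVec_single_one] at hA'qcol
        exact congrFun hA'qcol j
    ext i j
    rw [submatrix_apply]
    by_cases hi : i = p ∨ i = q
    · have hi' : Equiv.swap p q i = p ∨ Equiv.swap p q i = q := by
        rcases hi with rfl | rfl <;> simp
      rw [hrow' i hi, hrow' _ hi']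
      simp [Pi.single_apply]
    · by_cases hj : j = p ∨ j = q
      · have hj' : Equiv.swap p q j = p ∨ Equiv.swap p q j = q := by
          rcases hj with rfl | rfl <;> simp
        rw [hcol' j hj, hcol' _ hj']
        simp [Pi.single_apply]
      · rw [Equiv.swap_apply_of_ne_of_ne (fun e => hi (.inl e)) (fun e => hi (.inr e)),
          Equiv.swap_apply_of_ne_of_ne (fun e => hj (.inl e)) (fun e => hj (.inr e))]
  -- A' is the identity at p and at q, so conjugating by the swap leaves the matrix unchanged while
  -- exchanging the roles of the two indices in its elementary factorization.
  have hA'm' : A' ∈ elemOn R (S.erase q) := by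
    rw [← hswap]
    refine elem_mono ?_ (submatrix_mem_elem (Equiv.swap p q) hA'm)
    have key : ∀ i, Equiv.swap p q i ∈ S.erase p → i ∈ S.erase q := by
      intro i hi
      rw [Finset.mem_erase] at hi ⊢
      refine ⟨?_, ?_⟩
      · rintro rfl
        simp at hi
      · by_cases h : i = p
        · exact h ▸ hp.2
        · by_cases h' : i = q
          · exact h' ▸ hq
          · rw [Equiv.swap_apply_of_ne_of_ne h h'] at hi
            exact hi.2
    exact fun i j h => ⟨key i h.1, key j h.2⟩
  have hgY : g ∈ elem R fun i j => (i ∈ S ∧ j ∈ S) ∧ i ≠ q := by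
    have hle : elemOn R (S.erase q) ≤ elem R fun i j => (i ∈ S ∧ j ∈ S) ∧ i ≠ q :=
      elem_mono fun i j h => by
        simp only [Finset.mem_erase] at h
        exact ⟨⟨h.1.2, h.2.2⟩, h.1.1⟩
    rw [hXY, hs, transvection_zero, mul_one, hAA']
    refine Submonoid.mul_mem _ (Submonoid.mul_mem _ (Submonoid.mul_mem _ ?_ (hle hA'm')) ?_) hY
    · refine tv_single_right_mem_elem fun x hx => ?_
      have := hyne x hx
      exact ⟨this.1, ⟨this.2.2, hq⟩, this.1⟩
    · refine tv_single_left_mem_elem fun x hx => ?_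
      exact ⟨fun e => hx (e ▸ hap), ⟨hp.2, by_contra fun h => hx (haS x h)⟩, hp.1⟩
  -- Now g lies in the parabolic group of row q, and the condition on column q kills its unipotent
  -- part.
  obtain ⟨C, hC, c, hcq, hcS, rfl⟩ := exists_mul_tv_single_right hq hgY
  have hCq : C *ᵥ Pi.single q 1 = Pi.single q 1 :=
    mulVec_single_of_mem_elem hC fun _ _ h e => by simp [e] at h
  have hc : c = 0 := by
    obtain ⟨C', -, -, hC'C⟩ := exists_inverse_mem_elem hC
    have h2 : C *ᵥ (Pi.single q 1 + c) = C *ᵥ Pi.single q 1 := by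
      rw [← mulVec_mulVec, tv_mulVec] at hcol
      rw [hCq]
      simpa using hcol
    have h3 := congrArg (C' *ᵥ ·) h2
    simpa [-mulVec_single, -mulVec_single_one, hC'C] using h3
  rwa [hc, tv_zero_left, mul_one]

end Stability

/-! ### Transitivity on unimodular rows and cancellation of hyperbolic planes -/

section Cancellation

set_option linter.unusedSectionVars false

variable {R : Type*} [CommRing R] {ι : Type} [Fintype ι] [DecidableEq ι]

/-- If the row `u`, supported on `S`, is unimodular, then adding multiples of one entry makes the
row of the other entries unimodular. -/
theorem StableRankLE.exists_dotProduct_eq_one {k : ℕ} (hR : StableRankLE R k) {S : Finset ι}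
    {p : ι} (hp : p ∈ S) (hk : k + 1 ≤ S.card) {u w : ι → R} (hu : ∀ x ∉ S, u x = 0)
    (hw : w ⬝ᵥ u = 1) :
    ∃ c W : ι → R, (∀ x ∉ S.erase p, c x = 0) ∧ (∀ x ∉ S.erase p, W x = 0) ∧
      W ⬝ᵥ (u + u p • c) = 1 := by
  have hcard : (S.erase p).card + 1 = S.card := Finset.card_erase_add_one hp
  obtain ⟨c, l, hl⟩ := hR ι (S.erase p) (by omega) (u p) u ⟨w, w p, by
    rw [Finset.sum_erase_add S (fun x => w x * u x) hp]
    refine Eq.trans ?_ hw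
    refine Finset.sum_subset (Finset.subset_univ S) fun x _ hx => ?_
    rw [hu x hx, mul_zero]⟩
  refine ⟨fun x => if x ∈ S.erase p then c x else 0, fun x => if x ∈ S.erase p then l x else 0,
    fun x hx => if_neg hx, fun x hx => if_neg hx, Eq.trans ?_ hl⟩
  simp only [dotProduct, ite_mul, zero_mul, Finset.sum_ite_mem, Finset.univ_inter, Pi.add_apply,
    Pi.smul_apply, smul_eq_mul]
  refine Finset.sum_congr rfl fun x hx => ?_
  rw [if_pos hx, mul_comm (u p)]

/-- Three operations suffice: make the entries away from p unimodular, use them to turn the entry at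
p into 1, and clear the rest with it. -/
theorem exists_vecMul_eq_single {k : ℕ} (hR : StableRankLE R k) {S : Finset ι}
    {p : ι} (hp : p ∈ S) (hk : k + 1 ≤ S.card) {u w : ι → R} (hu : ∀ x ∉ S, u x = 0)
    (hw : w ⬝ᵥ u = 1) : ∃ g ∈ elemOn R S, u ᵥ* g = Pi.single p 1 := by
  obtain ⟨c, W, hc, hW, hcW⟩ := hR.exists_dotProduct_eq_one hp hk hu hw
  have hS : ∀ {v : ι → R}, (∀ x ∉ S.erase p, v x = 0) → ∀ x, v x ≠ 0 → p ≠ x ∧ x ∈ S := by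
    intro v hv x hx
    have : x ∈ S.erase p := by
      by_contra h
      exact hx (hv x h)
    rw [Finset.mem_erase] at this
    exact ⟨this.1.symm, this.2⟩
  have hcp : c p = 0 := hc p (by simp)
  have hWp : W p = 0 := hW p (by simp)
  set u2 := u + u p • c + (1 - u p) • Pi.single p 1 with hu2
  have hu2p : u2 p = 1 := by simp [hu2, hcp]
  refine ⟨tv (Pi.single p 1) c * tv ((1 - u p) • W) (Pi.single p 1) *
    tv (Pi.single p 1) (-(u2 - Pi.single p 1)), Submonoid.mul_mem _ (Submonoid.mul_mem _
      (tv_single_left_mem_elem fun x hx => ?_) (tv_single_right_mem_elem fun x hx => ?_))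
      (tv_single_left_mem_elem fun x hx => ?_), ?_⟩
  · exact ⟨(hS hc x hx).1, hp, (hS hc x hx).2⟩
  · have := hS hW x fun h => hx (by simp [h])
    exact ⟨this.1.symm, this.2, hp⟩
  · have := hS (v := u2 - Pi.single p 1) (fun x hx => ?_) x (by
      intro h
      exact hx (by rw [Pi.neg_apply, h, neg_zero]))
    · exact ⟨this.1, hp, this.2⟩
    · by_cases h : x = p
      · subst h
        simp [hu2p]
      · have hxS : x ∉ S := fun h' => hx (by simp [h, h'])
        simp [hu2, h, hu x hxS, hc x hx]
  · have e1 : u ᵥ* tv (Pi.single p 1) c = u + u p • c := by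
      rw [vecMul_tv, dotProduct_single, mul_one]
    have e2 : (u + u p • c) ᵥ* tv ((1 - u p) • W) (Pi.single p 1) = u2 := by
      rw [vecMul_tv, dotProduct_smul, dotProduct_comm, hcW, smul_eq_mul, mul_one]
    rw [← vecMul_vecMul, ← vecMul_vecMul, e1, e2, vecMul_tv, dotProduct_single, hu2p]
    simp

/-- `φ` is an alternating matrix for which the basis vectors `e_p`, `e_q` span a hyperbolic plane
orthogonal to the other basis vectors. -/
structure IsHyperbolicAt (φ : Matrix ι ι R) (p q : ι) : Prop where
  skew : φᵀ = -φ
  diag_zero : ∀ i, φ i i = 0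
  row_left : Pi.single p 1 ᵥ* φ = Pi.single q 1
  row_right : Pi.single q 1 ᵥ* φ = -Pi.single p 1

theorem mulVec_eq_neg_vecMul {φ : Matrix ι ι R} (h : φᵀ = -φ) (v : ι → R) :
    φ *ᵥ v = -(v ᵥ* φ) := by
  rw [← mulVec_transpose, h, neg_mulVec, neg_neg]

/-- The terms at (i, j) and (j, i) cancel and those at (i, i) vanish; skew symmetry alone would only
give twice the value equal to zero. -/
theorem vecMul_dotProduct_self {φ : Matrix ι ι R} (h : φᵀ = -φ) (hd : ∀ i, φ i i = 0)
    (v : ι → R) : (v ᵥ* φ) ⬝ᵥ v = 0 := by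
  have hs : ∀ i j, φ j i = -φ i j := fun i j => congrFun (congrFun h i) j
  simp only [dotProduct, vecMul, Finset.sum_mul]
  rw [← Finset.sum_product']
  refine Finset.sum_involution (fun x _ => (x.2, x.1)) ?_ ?_ ?_ ?_
  · intro x _
    rw [hs x.1 x.2]
    ring
  · intro x _ hx e
    have : x.2 = x.1 := congrArg Prod.fst e
    exact hx (by rw [this, hd]; ring)
  · intros
    simp
  · intros
    rfl

/-- The Eichler–Siegel transformation `x ↦ x + B(z, x) v + B(v, x) z + r B(z, x) z`. -/
def eichler (φ : Matrix ι ι R) (z v : ι → R) (r : R) : Matrix ι ι R :=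
  1 + vecMulVec v (z ᵥ* φ) + vecMulVec z (v ᵥ* φ) + r • vecMulVec z (z ᵥ* φ)

theorem eichler_mulVec (φ : Matrix ι ι R) (z v : ι → R) (r : R) (x : ι → R) :
    eichler φ z v r *ᵥ x = x + ((z ᵥ* φ) ⬝ᵥ x) • v + ((v ᵥ* φ) ⬝ᵥ x + r * ((z ᵥ* φ) ⬝ᵥ x)) • z := by
  simp only [eichler, add_mulVec, one_mulVec, vecMulVec_mulVec, smul_mulVec, add_smul, mul_smul,
    op_smul_eq_smul]
  abel

theorem transpose_eichler_mul_mul {φ : Matrix ι ι R} (h : φᵀ = -φ) (hd : ∀ i, φ i i = 0)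
    {z v : ι → R} (hzv : (z ᵥ* φ) ⬝ᵥ v = 0) (r : R) :
    (eichler φ z v r)ᵀ * φ * eichler φ z v r = φ := by
  have hvv := vecMul_dotProduct_self h hd v
  have hzz := vecMul_dotProduct_self h hd z
  have hvz : (v ᵥ* φ) ⬝ᵥ z = 0 := by
    rw [← dotProduct_mulVec, mulVec_eq_neg_vecMul h, dotProduct_neg, dotProduct_comm, hzv, neg_zero]
  have h1 : φ * eichler φ z v r = φ - vecMulVec (v ᵥ* φ) (z ᵥ* φ) - vecMulVec (z ᵥ* φ) (v ᵥ* φ)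
      - r • vecMulVec (z ᵥ* φ) (z ᵥ* φ) := by
    simp only [eichler, mul_add, mul_one, mul_vecMulVec, mul_smul_comm, mulVec_eq_neg_vecMul h,
      neg_vecMulVec, smul_neg]
    abel
  have h2 : v ᵥ* (φ * eichler φ z v r) = v ᵥ* φ := by
    rw [← vecMul_vecMul]
    simp only [eichler, vecMul_add, vecMul_one, vecMul_vecMulVec, vecMul_smul, hvv, hvz, zero_smul,
      smul_zero, add_zero]
  have h3 : z ᵥ* (φ * eichler φ z v r) = z ᵥ* φ := by
    rw [← vecMul_vecMul]
    simp only [eichler, vecMul_add, vecMul_one, vecMul_vecMulVec, vecMul_smul, hzv, hzz, zero_smul,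
      smul_zero, add_zero]
  have h4 : (eichler φ z v r)ᵀ = 1 + vecMulVec (z ᵥ* φ) v + vecMulVec (v ᵥ* φ) z +
      r • vecMulVec (z ᵥ* φ) z := by
    simp [eichler, transpose_add, transpose_smul, transpose_vecMulVec]
  rw [mul_assoc, h4, add_mul, add_mul, add_mul, one_mul, vecMulVec_mul, vecMulVec_mul,
    smul_mul_assoc, vecMulVec_mul, h2, h3, h1]
  abel

namespace IsHyperbolicAt

variable {φ : Matrix ι ι R} {p q : ι} (h : IsHyperbolicAt φ p q)

include h

theorem mulVec_left : φ *ᵥ Pi.single p 1 = -Pi.single q 1 := by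
  rw [mulVec_eq_neg_vecMul h.skew, h.row_left]

theorem mulVec_right : φ *ᵥ Pi.single q 1 = Pi.single p 1 := by
  rw [mulVec_eq_neg_vecMul h.skew, h.row_right, neg_neg]

theorem vecMul_apply_left (v : ι → R) : (v ᵥ* φ) p = -v q := by
  have : (v ᵥ* φ) ⬝ᵥ Pi.single p 1 = v ⬝ᵥ -Pi.single q 1 := by
    rw [← dotProduct_mulVec, h.mulVec_left]
  simpa [-single_vecMul] using this

theorem vecMul_apply_right (v : ι → R) : (v ᵥ* φ) q = v p := by
  have : (v ᵥ* φ) ⬝ᵥ Pi.single q 1 = v ⬝ᵥ Pi.single p 1 := by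
    rw [← dotProduct_mulVec, h.mulVec_right]
  simpa [-single_vecMul] using this

variable {S : Finset ι} (hp : p ∈ S) (hq : q ∈ S) (hpq : p ≠ q)
  (hS : ∀ i ∈ S, ∀ j ∉ S, φ i j = 0) {v : ι → R} (hv : ∀ x ∉ (S.erase p).erase q, v x = 0)
include hp hq hpq hv

include hS in
theorem vecMul_eq_zero (x) (hx : x ∉ (S.erase p).erase q) : (v ᵥ* φ) x = 0 := by
  have hvp : v p = 0 := hv p (by simp)
  have hvq : v q = 0 := hv q (by simp)
  by_cases hxp : x = p
  · rw [hxp, h.vecMul_apply_left, hvq, neg_zero]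
  by_cases hxq : x = q
  · rw [hxq, h.vecMul_apply_right, hvp]
  have hxS : x ∉ S := fun h' => hx (by simp [hxp, hxq, h'])
  refine Finset.sum_eq_zero fun i _ => ?_
  change v i * φ i x = 0
  by_cases hi : i ∈ (S.erase p).erase q
  · rw [hS i (Finset.mem_of_mem_erase (Finset.mem_of_mem_erase hi)) x hxS, mul_zero]
  · rw [hv i hi, zero_mul]

include hS in
-- When z is a basis vector of the hyperbolic plane and v is supported off the plane, the
-- transformation is one row operation times one column operation, hence elementary.
theorem eichler_left (r : R) : eichler φ (Pi.single p 1) v r ∈ elemOn R S ∧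
    (eichler φ (Pi.single p 1) v r)ᵀ * φ * eichler φ (Pi.single p 1) v r = φ ∧
    ∀ x, eichler φ (Pi.single p 1) v r *ᵥ x =
      x + x q • v + ((v ᵥ* φ) ⬝ᵥ x + r * x q) • Pi.single p 1 := by
  have hvp : v p = 0 := hv p (by simp)
  have hvq : v q = 0 := hv q (by simp)
  have hν := h.vecMul_eq_zero hp hq hpq hS hv
  have hmem : ∀ x, x ∈ (S.erase p).erase q → x ∈ S ∧ x ≠ p ∧ x ≠ q := fun x hx => by
    simp only [Finset.mem_erase] at hx
    exact ⟨hx.2.2, hx.2.1, hx.1⟩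
  refine ⟨?_, transpose_eichler_mul_mul h.skew h.diag_zero ?_ r, fun x => ?_⟩
  · have : eichler φ (Pi.single p 1) v r =
        tv (Pi.single p 1) (v ᵥ* φ + r • Pi.single q 1) * tv v (Pi.single q 1) := by
      rw [tv_mul_tv, eichler, h.row_left, add_dotProduct,
        vecMul_dotProduct_self h.skew h.diag_zero, smul_dotProduct, single_one_dotProduct, hvq,
        vecMulVec_add, vecMulVec_smul]
      simp only [smul_zero, add_zero, zero_smul]
      abel
    rw [this]
    refine Submonoid.mul_mem _ (tv_single_left_mem_elem fun x hx => ?_)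
      (tv_single_right_mem_elem fun x hx => ?_)
    · by_cases hxq : x = q
      · exact hxq ▸ ⟨hpq, hp, hq⟩
      · have := hmem x (by_contra fun h' => hx (by simp [hν x h', hxq]))
        exact ⟨this.2.1.symm, hp, this.1⟩
    · have := hmem x (by_contra fun h' => hx (hv x h'))
      exact ⟨this.2.2, this.1, hq⟩
  · rw [h.row_left, single_one_dotProduct, hvq]
  · rw [eichler_mulVec, h.row_left, single_one_dotProduct]

include hS in
theorem eichler_right (r : R) : eichler φ (Pi.single q 1) v r ∈ elemOn R S ∧
    (eichler φ (Pi.single q 1) v r)ᵀ * φ * eichler φ (Pi.single q 1) v r = φ ∧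
    ∀ x, eichler φ (Pi.single q 1) v r *ᵥ x =
      x - x p • v + ((v ᵥ* φ) ⬝ᵥ x - r * x p) • Pi.single q 1 := by
  have hvp : v p = 0 := hv p (by simp)
  have hvq : v q = 0 := hv q (by simp)
  have hν := h.vecMul_eq_zero hp hq hpq hS hv
  have hmem : ∀ x, x ∈ (S.erase p).erase q → x ∈ S ∧ x ≠ p ∧ x ≠ q := fun x hx => by
    simp only [Finset.mem_erase] at hx
    exact ⟨hx.2.2, hx.2.1, hx.1⟩
  refine ⟨?_, transpose_eichler_mul_mul h.skew h.diag_zero ?_ r, fun x => ?_⟩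
  · have : eichler φ (Pi.single q 1) v r =
        tv (Pi.single q 1) (v ᵥ* φ + (-r) • Pi.single p 1) * tv (-v) (Pi.single p 1) := by
      rw [tv_mul_tv, eichler, h.row_right, add_dotProduct, dotProduct_neg,
        vecMul_dotProduct_self h.skew h.diag_zero, smul_dotProduct, single_one_dotProduct,
        Pi.neg_apply, hvp, vecMulVec_add, vecMulVec_smul, vecMulVec_neg, vecMulVec_neg,
        neg_vecMulVec]
      simp only [smul_zero, add_zero, zero_smul, neg_zero, smul_neg, neg_smul]
      abel
    rw [this]
    refine Submonoid.mul_mem _ (tv_single_left_mem_elem fun x hx => ?_)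
      (tv_single_right_mem_elem fun x hx => ?_)
    · by_cases hxp : x = p
      · exact hxp ▸ ⟨hpq.symm, hq, hp⟩
      · have := hmem x (by_contra fun h' => hx (by simp [hν x h', hxp]))
        exact ⟨this.2.2.symm, hq, this.1⟩
    · have := hmem x (by_contra fun h' => hx (by simp [hv x h']))
      exact ⟨this.2.1, this.1, hp⟩
  · rw [h.row_right, neg_dotProduct, single_one_dotProduct, hvp, neg_zero]
  · rw [eichler_mulVec, h.row_right, neg_dotProduct, single_one_dotProduct, neg_smul, mul_neg,
      ← sub_eq_add_neg, ← sub_eq_add_neg]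

end IsHyperbolicAt

end Cancellation

/-! ### Elementary isometries and removal of a hyperbolic plane. -/

section Cancellation

set_option linter.unusedSectionVars false

variable {R : Type*} [CommRing R] {ι : Type} [Fintype ι] [DecidableEq ι]

/-- Being block diagonal means commuting with the diagonal idempotent of S, a property inherited by
the inverse. -/
theorem apply_eq_zero_of_mul_eq_one {S : Finset ι} {φ φi : Matrix ι ι R} (h : φ * φi = 1)
    (hS : ∀ i ∈ S, ∀ j ∉ S, φ i j = 0) (hS' : ∀ i ∉ S, ∀ j ∈ S, φ i j = 0) :
    ∀ i ∈ S, ∀ j ∉ S, φi i j = 0 := by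
  have h' : φi * φ = 1 := mul_eq_one_comm.mp h
  set d : Matrix ι ι R := diagonal fun i => if i ∈ S then 1 else 0 with hd
  have hcomm : φ * d = d * φ := by
    ext i j
    rw [hd, mul_diagonal, diagonal_mul]
    by_cases hi : i ∈ S <;> by_cases hj : j ∈ S
    · simp [hi, hj]
    · simp [hi, hj, hS i hi j hj]
    · simp [hi, hj, hS' i hi j hj]
    · simp [hi, hj]
  have hcomm' : φi * d = d * φi := by
    calc φi * d = φi * (d * φ) * φi := by rw [mul_assoc, mul_assoc, h, mul_one]
      _ = d * φi := by rw [← hcomm, ← mul_assoc, h', one_mul]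
  intro i hi j hj
  have := congrFun (congrFun hcomm' i) j
  rw [hd, mul_diagonal, diagonal_mul] at this
  simpa [hi, hj] using this.symm

/-- A unimodular column is moved to a basis vector of a hyperbolic plane by an elementary
isometry. -/
theorem IsHyperbolicAt.exists_isometry {k : ℕ} (hR : StableRankLE R k) {φ φi : Matrix ι ι R}
    {p q : ι} (h : IsHyperbolicAt φ p q) {S : Finset ι} (hp : p ∈ S) (hq : q ∈ S) (hpq : p ≠ q)
    (hS : ∀ i ∈ S, ∀ j ∉ S, φ i j = 0) (hφ : φ * φi = 1) (hk : k + 1 ≤ S.card)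
    {u w : ι → R} (hu : ∀ x ∉ S, u x = 0) (hw : w ⬝ᵥ u = 1) :
    ∃ τ ∈ elemOn R S, τᵀ * φ * τ = φ ∧ τ *ᵥ u = Pi.single p 1 := by
  have hφ' : φi * φ = 1 := mul_eq_one_comm.mp hφ
  have hS' : ∀ i ∉ S, ∀ j ∈ S, φ i j = 0 := fun i hi j hj => by
    have := congrFun (congrFun h.skew i) j
    rw [transpose_apply, hS j hj i hi, neg_apply, zero_eq_neg] at this
    exact this
  have hSi := apply_eq_zero_of_mul_eq_one hφ hS hS'
  set S0 := (S.erase p).erase q with hS0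
  have hne : ∀ {x}, x ∉ S0 → x = p ∨ x = q ∨ x ∉ S := by
    intro x hx
    by_contra! hx'
    exact hx (by simp [hS0, hx'.1, hx'.2.1, hx'.2.2])
  obtain ⟨c, W, hc, hW, hcW⟩ := hR.exists_dotProduct_eq_one hp hk hu hw
  have hcp : c p = 0 := hc p (by simp)
  have hWp : W p = 0 := hW p (by simp)
  have hSp : ∀ {x}, x ∉ S → x ∉ S.erase p := fun hx h' => hx (Finset.mem_of_mem_erase h')
  have hxp : ∀ {x}, x ∉ S → x ≠ p := fun hx e => hx (e ▸ hp)
  have hxq : ∀ {x}, x ∉ S → x ≠ q := fun hx e => hx (e ▸ hq)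
  -- the entries other than `u p` are made unimodular
  set v1 := -(c - c q • Pi.single q 1) with hv1
  have hv1S : ∀ x ∉ S0, v1 x = 0 := fun x hx => by
    rcases hne hx with rfl | rfl | hx
    · simp [hv1, hcp, hpq]
    · simp [hv1]
    · simp [hv1, hc x (hSp hx), hxq hx]
  obtain ⟨hτ1, hτ1', hτ1x⟩ := h.eichler_right hp hq hpq hS hv1S (-c q)
  set τ1 := eichler φ (Pi.single q 1) v1 (-c q)
  set u1 := τ1 *ᵥ u with hu1
  have hν1 := h.vecMul_eq_zero hp hq hpq hS hv1S
  have hu1' : u1 = u + u p • c + ((v1 ᵥ* φ) ⬝ᵥ u) • Pi.single q 1 := by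
    rw [hu1, hτ1x, hv1]
    ext x
    simp
    ring
  have hu1S : ∀ x ∉ S, u1 x = 0 := fun x hx => by
    simp [hu1', hu x hx, hc x (hSp hx), hxq hx]
  -- The isometry τ1 adds u_p c as desired, but also an unwanted multiple of e_q; this change of
  -- coefficients compensates for it.
  set W1 := W - W q • (v1 ᵥ* φ) with hW1
  have hW1S : ∀ x ∉ S.erase p, W1 x = 0 := fun x hx => by
    simp [hW1, hW x hx, hν1 x fun h' => hx (Finset.mem_of_mem_erase h')]
  have hW1u : W1 ⬝ᵥ u1 = 1 := by
    have h1 : (v1 ᵥ* φ) ⬝ᵥ c = 0 := by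
      have : c = -v1 + c q • Pi.single q 1 := by rw [hv1]; abel
      rw [this, dotProduct_add, dotProduct_neg, vecMul_dotProduct_self h.skew h.diag_zero,
        dotProduct_smul, dotProduct_single, hν1 q (by simp [hS0])]
      simp
    have h2 : (v1 ᵥ* φ) ⬝ᵥ (Pi.single q 1 : ι → R) = 0 := by
      rw [dotProduct_single, hν1 q (by simp [hS0]), zero_mul]
    rw [hW1, hu1', dotProduct_add, sub_dotProduct, hcW, sub_dotProduct, smul_dotProduct,
      smul_dotProduct, dotProduct_add, dotProduct_smul, dotProduct_smul, h1, dotProduct_smul, h2,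
      dotProduct_single]
    simp [mul_comm]
  -- the entry at `p` becomes `1`
  set t := (1 - u1 p) • (W1 - W1 q • Pi.single q 1) with ht
  have htS : ∀ x ∉ S0, t x = 0 := fun x hx => by
    rcases hne hx with rfl | rfl | hx
    · simp [ht, hW1S x (by simp), hpq]
    · simp [ht]
    · simp [ht, hW1S x (hSp hx), hxq hx]
  -- Invertibility of φ turns the linear functional t into B(v2, ·), which is what an Eichler
  -- transformation adds to the coordinate p. The coordinate q, left out of t, is supplied by the
  -- parameter r = (1 - u1 p) W1 q.
  set v2 := t ᵥ* φi with hv2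
  have hv2φ : v2 ᵥ* φ = t := by rw [hv2, vecMul_vecMul, hφ', vecMul_one]
  have hv2S : ∀ x ∉ S0, v2 x = 0 := fun x hx => by
    rcases hne hx with rfl | rfl | hx
    · rw [← h.vecMul_apply_right v2, hv2φ, htS q (by simp [hS0])]
    · rw [← neg_eq_zero, ← h.vecMul_apply_left v2, hv2φ, htS p (by simp [hS0])]
    · refine Finset.sum_eq_zero fun i _ => ?_
      change t i * φi i x = 0
      by_cases hi : i ∈ S
      · rw [hSi i hi x hx, mul_zero]
      · rw [htS i fun h' => hi (Finset.mem_of_mem_erase (Finset.mem_of_mem_erase h')), zero_mul]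
  obtain ⟨hτ2, hτ2', hτ2x⟩ := h.eichler_left hp hq hpq hS hv2S ((1 - u1 p) * W1 q)
  set τ2 := eichler φ (Pi.single p 1) v2 ((1 - u1 p) * W1 q)
  set u2 := τ2 *ᵥ u1 with hu2
  have hu2p : u2 p = 1 := by
    rw [hu2, hτ2x, hv2φ, ht, smul_dotProduct, sub_dotProduct, smul_dotProduct, hW1u,
      single_one_dotProduct]
    simp [hv2S p (by simp [hS0])]
    ring
  have hu2S : ∀ x ∉ S, u2 x = 0 := fun x hx => by
    rw [hu2, hτ2x]
    simp [hu1S x hx, hxp hx, hv2S x fun h' => hx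
      (Finset.mem_of_mem_erase (Finset.mem_of_mem_erase h'))]
  -- the other entries are cleared
  set v3 := u2 - Pi.single p 1 - u2 q • Pi.single q 1 with hv3
  have hv3S : ∀ x ∉ S0, v3 x = 0 := fun x hx => by
    rcases hne hx with rfl | rfl | hx
    · simp [hv3, hu2p, hpq]
    · simp [hv3, hpq.symm]
    · simp [hv3, hu2S x hx, hxq hx, hxp hx]
  obtain ⟨hτ3, hτ3', hτ3x⟩ := h.eichler_right hp hq hpq hS hv3S (u2 q + (v3 ᵥ* φ) ⬝ᵥ u2)
  set τ3 := eichler φ (Pi.single q 1) v3 (u2 q + (v3 ᵥ* φ) ⬝ᵥ u2)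
  refine ⟨τ3 * τ2 * τ1, Submonoid.mul_mem _ (Submonoid.mul_mem _ hτ3 hτ2) hτ1, ?_, ?_⟩
  · calc (τ3 * τ2 * τ1)ᵀ * φ * (τ3 * τ2 * τ1)
        = τ1ᵀ * (τ2ᵀ * (τ3ᵀ * φ * τ3) * τ2) * τ1 := by
          simp only [transpose_mul, mul_assoc]
      _ = φ := by rw [hτ3', hτ2', hτ1']
  · rw [← mulVec_mulVec, ← mulVec_mulVec, ← hu1, ← hu2, hτ3x, hu2p, hv3]
    ext x
    simp
    ring

/-- Cancellation of a hyperbolic plane: an elementary isometry between forms on the indices `S`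
with a hyperbolic plane at `p`, `q` can be replaced by one on the remaining indices. -/
theorem IsHyperbolicAt.exists_mem_elemOn_erase {k : ℕ} (hR : StableRankLE R k)
    {φ φ' φi : Matrix ι ι R} {p q : ι} (h : IsHyperbolicAt φ p q) (h' : IsHyperbolicAt φ' p q)
    {S : Finset ι} (hp : p ∈ S) (hq : q ∈ S) (hpq : p ≠ q)
    (hS : ∀ i ∈ S, ∀ j ∉ S, φ i j = 0) (hφ : φ * φi = 1) (hk : k + 3 ≤ S.card)
    {g : Matrix ι ι R} (hg : g ∈ elemOn R S) (hgφ : gᵀ * φ * g = φ') :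
    ∃ g' ∈ elemOn R ((S.erase p).erase q), g'ᵀ * φ * g' = φ' := by
  have hfix : ∀ C ∈ elemOn R S, ∀ (v : ι → R) (x), x ∉ S → (C *ᵥ v) x = v x := by
    intro C hC v x hx
    have := single_vecMul_of_mem_elem hC (q := x) fun _ _ h e => hx (e ▸ h.1)
    have h2 : Pi.single x 1 ⬝ᵥ (C *ᵥ v) = Pi.single x 1 ⬝ᵥ v := by
      rw [dotProduct_mulVec, this]
    simpa using h2
  have hxp : ∀ {x}, x ∉ S → x ≠ p := fun hx e => hx (e ▸ hp)
  have hxq : ∀ {x}, x ∉ S → x ≠ q := fun hx e => hx (e ▸ hq)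
  obtain ⟨gi, hgi, hggi, hgig⟩ := exists_inverse_mem_elem hg
  obtain ⟨τ, hτ, hτφ, hτu⟩ := h.exists_isometry hR hp hq hpq hS hφ (by omega)
    (u := g *ᵥ Pi.single p 1) (w := Pi.single p 1 ᵥ* gi)
    (fun x hx => by rw [hfix g hg _ x hx, Pi.single_eq_of_ne (hxp hx)])
    (by
      rw [dotProduct_mulVec, vecMul_vecMul, hgig, vecMul_one, single_one_dotProduct,
        Pi.single_eq_same])
  obtain ⟨a, ha⟩ : ∃ a, a = τ * g := ⟨_, rfl⟩
  have ham : a ∈ elemOn R S := ha ▸ Submonoid.mul_mem _ hτ hg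
  have haφ : aᵀ * φ * a = φ' := by
    rw [ha, ← hgφ]
    conv_rhs => rw [← hτφ]
    simp only [transpose_mul, mul_assoc]
  have hap : a *ᵥ Pi.single p 1 = Pi.single p 1 := by rw [ha, ← mulVec_mulVec, hτu]
  set y := a *ᵥ Pi.single q 1 with hy
  -- The matrix a carries φ to φ' and fixes e_p, so B_φ(e_p, a e_q) = B_φ'(e_p, e_q) = 1.
  have hyq : y q = 1 := by
    have : Pi.single q 1 ⬝ᵥ y = (Pi.single p 1 ᵥ* (aᵀ * φ * a)) ⬝ᵥ Pi.single q 1 := by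
      rw [← vecMul_vecMul, ← vecMul_vecMul, vecMul_transpose, hap, h.row_left, ← dotProduct_mulVec]
    rw [haφ, h'.row_left] at this
    simpa using this
  have hyS : ∀ x ∉ S, y x = 0 := fun x hx => by
    rw [hy, hfix a ham _ x hx, Pi.single_eq_of_ne (hxq hx)]
  set v := -(y - y p • Pi.single p 1 - Pi.single q 1) with hv
  have hvS : ∀ x ∉ (S.erase p).erase q, v x = 0 := fun x hx => by
    have : x = p ∨ x = q ∨ x ∉ S := by
      by_contra! hx'
      exact hx (by simp [hx'.1, hx'.2.1, hx'.2.2])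
    rcases this with rfl | rfl | hx
    · simp [hv, hpq]
    · simp [hv, hpq.symm, hyq]
    · simp [hv, hyS x hx, hxp hx, hxq hx]
  obtain ⟨hσ, hσφ, hσx⟩ := h.eichler_left hp hq hpq hS hvS (-(y p + (v ᵥ* φ) ⬝ᵥ y))
  set σ := eichler φ (Pi.single p 1) v (-(y p + (v ᵥ* φ) ⬝ᵥ y))
  obtain ⟨b, hb⟩ : ∃ b, b = σ * a := ⟨_, rfl⟩
  have hbm : b ∈ elemOn R S := hb ▸ Submonoid.mul_mem _ hσ ham
  have hbφ : bᵀ * φ * b = φ' := by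
    rw [hb, ← haφ]
    conv_rhs => rw [← hσφ]
    simp only [transpose_mul, mul_assoc]
  have hbp : b *ᵥ Pi.single p 1 = Pi.single p 1 := by
    rw [hb, ← mulVec_mulVec, hap, hσx, Pi.single_eq_of_ne hpq.symm, dotProduct_single,
      h.vecMul_apply_left, hvS q (by simp)]
    simp
  have hbq : b *ᵥ Pi.single q 1 = Pi.single q 1 := by
    rw [hb, ← mulVec_mulVec, ← hy, hσx, hyq, hv]
    ext x
    simp
    ring
  -- A congruence that fixes the columns of the plane also fixes its rows, since bᵀ φ b = φ' and
  -- both forms pair e_p with e_q in the same way.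
  have hbp' : Pi.single p 1 ᵥ* b = Pi.single p 1 := by
    have : Pi.single q 1 ᵥ* φ ᵥ* b = Pi.single q 1 ᵥ* (bᵀ * φ * b) := by
      conv_lhs => rw [← hbq]
      rw [← vecMul_transpose, vecMul_vecMul, vecMul_vecMul]
      simp only [mul_assoc]
    rw [hbφ, h.row_right, h'.row_right, neg_vecMul, neg_inj] at this
    exact this
  have hbq' : Pi.single q 1 ᵥ* b = Pi.single q 1 := by
    have : Pi.single p 1 ᵥ* φ ᵥ* b = Pi.single p 1 ᵥ* (bᵀ * φ * b) := by
      conv_lhs => rw [← hbp]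
      rw [← vecMul_transpose, vecMul_vecMul, vecMul_vecMul]
      simp only [mul_assoc]
    rwa [hbφ, h.row_left, h'.row_left] at this
  -- Injective stability is applied twice, to remove p and then q; the second use accounts for the
  -- bound k + 3.
  refine ⟨b, mem_elemOn_erase hR ?_ (by simp [hq, hpq.symm])
    (mem_elemOn_erase hR (by omega) hp hbm hbp hbp') hbq hbq', hbφ⟩
  have := Finset.card_erase_add_one hp
  omega

end Cancellation

/-! ### Alternating matrices of size four -/

section Four

variable {R : Type*} [CommRing R]

/-- The matrix `σᵀ θ(a, b) σ`. -/
def normTheta (a b : Fin 3 → R) : Matrix (Fin 4) (Fin 4) R :=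
  !![0, b 0, a 1, -a 2;
     -b 0, 0, -b 2, -b 1;
     -a 1, b 2, 0, a 0;
     a 2, b 1, -a 0, 0]

theorem tv_commutator {ι : Type*} [Fintype ι] [DecidableEq ι] {u x y w : ι → R}
    (hwu : w ⬝ᵥ u = 0) (hxu : x ⬝ᵥ u = 0) (hwy : w ⬝ᵥ y = 0) (hxy : x ⬝ᵥ y = 1) :
    tv u x * tv y w * tv (-u) x * tv y (-w) = tv u w := by
  rw [mul_assoc, tv_mul_tv, tv_mul_tv]
  simp only [mul_add, add_mul, one_mul, mul_one, vecMulVec_mul_vecMulVec, hwu, hxu, hwy, hxy,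
    dotProduct_neg, neg_zero, zero_smul, smul_zero, vecMulVec_zero, add_zero, neg_vecMulVec,
    vecMulVec_neg, one_smul, smul_mul_assoc, mul_smul_comm, mul_neg, neg_mul, neg_neg, tv,
    zero_smul]
  abel

/-- Suslin's lemma: the unimodular column `a` and a Koszul relation between its entries define
an elementary matrix. -/
theorem tv_koszul_mem_elem (a : Fin 3 → R) {i j k : Fin 3} (hij : i ≠ j) (hik : i ≠ k)
    (hjk : j ≠ k) (r : R) :
    tv a (Pi.single j (r * a k) - Pi.single k (r * a j)) ∈
      elem R (fun _ _ : Fin 3 => True) := by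
  set w : Fin 3 → R := Pi.single j (r * a k) - Pi.single k (r * a j) with hw
  set a' := a - Pi.single i (a i) with ha'
  have hwi : w i = 0 := by simp [hw, hij, hik]
  have hwa : w ⬝ᵥ a = 0 := by
    simp [hw, sub_dotProduct, single_dotProduct]
    ring
  have hwa' : w ⬝ᵥ a' = 0 := by
    rw [ha', dotProduct_sub, hwa, dotProduct_single, hwi, zero_mul, sub_zero]
  have ha'i : a' i = 0 := by simp [ha']
  -- Splitting off the coordinate i of a leaves a row operation and a factor 1 + a' wᵀ in which both
  -- a' and w vanish at i, so that it is a commutator of a column and a row operation at i.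
  have e1 : tv a w = tv (Pi.single i (a i)) w * tv a' w := by
    rw [tv_mul_tv_same_right hwa', ha', add_sub_cancel]
  have e2 : tv (Pi.single i (a i)) w = tv (Pi.single i 1) (a i • w) := by
    rw [← tv_smul_left, ← Pi.single_smul, smul_eq_mul, mul_one]
  have hcol : ∀ c : Fin 3 → R, c i = 0 →
      tv c (Pi.single i 1) ∈ elem R (fun _ _ : Fin 3 => True) := fun c hc =>
    tv_single_right_mem_elem fun x hx => ⟨fun e => hx (e ▸ hc), trivial⟩
  have hrow : ∀ c : Fin 3 → R, c i = 0 →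
      tv (Pi.single i 1) c ∈ elem R (fun _ _ : Fin 3 => True) := fun c hc =>
    tv_single_left_mem_elem fun x hx => ⟨fun e => hx (e ▸ hc), trivial⟩
  rw [e1, e2, ← tv_commutator (u := a') (x := Pi.single i 1) (y := Pi.single i 1) hwa'
    (by simpa using ha'i) (by simpa using hwi) (by simp)]
  exact Submonoid.mul_mem _ (hrow _ (by simp [hwi])) (Submonoid.mul_mem _ (Submonoid.mul_mem _
    (Submonoid.mul_mem _ (hcol _ ha'i) (hrow _ hwi)) (hcol _ (by simp [ha'i])))
    (hrow _ (by simp [hwi])))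

theorem transpose_tv_mul_mul {ι : Type*} [Fintype ι] [DecidableEq ι] (M : Matrix ι ι R)
    (u v : ι → R) : (tv u v)ᵀ * M * tv u v = M + vecMulVec (M *ᵥ u) v + vecMulVec v (u ᵥ* M) +
      ((u ᵥ* M) ⬝ᵥ u) • vecMulVec v v := by
  rw [transpose_tv, tv, tv, mul_add, mul_one, add_mul, one_mul, add_mul, mul_vecMulVec,
    vecMulVec_mul, vecMulVec_mul_vecMulVec, vecMulVec_smul]
  abel

/-- The index of size four corresponding to an index of size three. -/
def coordIndex : Fin 3 → Fin 4 := ![0, 3, 2]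

/-- Row 1 of `normTheta a b` carries -b_k at position `coordIndex k`. Elementary operations among
these positions act on b directly and on a contragrediently. -/
theorem transvection_normTheta (a b : Fin 3 → R) {k l : Fin 3} (h : k ≠ l) (r : R) :
    (transvection (coordIndex k) (coordIndex l) r)ᵀ * normTheta a b *
        transvection (coordIndex k) (coordIndex l) r =
      normTheta (a - Pi.single k (r * a l)) (b ᵥ* transvection k l r) := by
  rw [transvection_eq_tv', transvection_eq_tv', vecMul_tv, dotProduct_single,
    transpose_tv_mul_mul, dotProduct_single]
  ext x y
  simp only [Matrix.add_apply, Matrix.smul_apply, vecMulVec_apply, mulVec_single_one,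
    single_one_vecMul, col_apply, row_apply]
  fin_cases k <;> fin_cases l <;> first | exact absurd rfl h | skip
  all_goals
    fin_cases x <;> fin_cases y <;> simp [normTheta, coordIndex] <;> ring

/-- Operations into column 1 leave a fixed and add to b a Koszul relation between two entries of a.
-/
theorem transvection_one_right_normTheta (a b : Fin 3 → R) (k : Fin 3) (r : R) :
    (transvection (coordIndex k) 1 r)ᵀ * normTheta a b * transvection (coordIndex k) 1 r =
      normTheta a (b + (Pi.single (k + 1) (r * a (k + 2)) - Pi.single (k + 2) (r * a (k + 1)))) := by
  rw [transvection_eq_tv', transpose_tv_mul_mul, dotProduct_single]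
  ext x y
  simp only [Matrix.add_apply, Matrix.smul_apply, vecMulVec_apply, mulVec_single_one,
    single_one_vecMul, col_apply, row_apply]
  fin_cases k <;> fin_cases x <;> fin_cases y <;> simp [normTheta, coordIndex] <;> ring

/-- Operations out of row 1 leave b fixed and add the cross product c × b to a. -/
theorem tv_normTheta (a b : Fin 3 → R) (c : Fin 3 → R) :
    (tv (Pi.single 1 1) ![c 0, 0, c 2, c 1])ᵀ * normTheta a b *
        tv (Pi.single 1 1) ![c 0, 0, c 2, c 1] =
      normTheta ![a 0 + b 2 * c 1 - b 1 * c 2, a 1 + b 0 * c 2 - b 2 * c 0,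
        a 2 + b 1 * c 0 - b 0 * c 1] b := by
  rw [transpose_tv_mul_mul, dotProduct_single]
  ext x y
  simp only [Matrix.add_apply, Matrix.smul_apply, vecMulVec_apply, mulVec_single_one,
    single_one_vecMul, col_apply, row_apply]
  fin_cases x <;> fin_cases y <;> simp [normTheta] <;> ring

theorem eq_one_or_exists_coordIndex (i : Fin 4) : i = 1 ∨ ∃ k, i = coordIndex k := by
  revert i
  decide

theorem coordIndex_injective : Function.Injective coordIndex := by
  decide

theorem exists_tv_normTheta {a a' b : Fin 3 → R} (h : a ⬝ᵥ b = 1) (h' : a' ⬝ᵥ b = 1) :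
    ∃ ε ∈ elem R (fun _ _ : Fin 4 => True), εᵀ * normTheta a b * ε = normTheta a' b := by
  set d := a' - a with hd
  -- Here v = d × a. Since d · b = 0 and a · b = 1, the triple product formula gives b × (d × a) =
  -- d, so c = -v moves a to a'.
  set v : Fin 3 → R := ![d 1 * a 2 - d 2 * a 1, d 2 * a 0 - d 0 * a 2, d 0 * a 1 - d 1 * a 0]
    with hv
  refine ⟨_, ?_, (tv_normTheta a b (-v)).trans ?_⟩
  · refine tv_single_left_mem_elem fun x hx => ⟨?_, trivial⟩
    rintro rfl
    simp at hx
  · simp only [dotProduct, Fin.sum_univ_three] at h h'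
    have e : ![a 0 + b 2 * (-v) 1 - b 1 * (-v) 2, a 1 + b 0 * (-v) 2 - b 2 * (-v) 0,
        a 2 + b 1 * (-v) 0 - b 0 * (-v) 1] = a' := by
      ext i
      fin_cases i
      · simp [hv, hd]
        linear_combination (a' 0 - a 0) * h - a 0 * (h' - h)
      · simp [hv, hd]
        linear_combination (a' 1 - a 1) * h - a 1 * (h' - h)
      · simp [hv, hd]
        linear_combination (a' 2 - a 2) * h - a 2 * (h' - h)
    rw [e]

/-- The elementary group of size four acts on the rows `b` through the elementary group of size
three. -/
theorem exists_normTheta_of_mem_elem {a b : Fin 3 → R} (h : a ⬝ᵥ b = 1)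
    {ε : Matrix (Fin 4) (Fin 4) R} (hε : ε ∈ elem R (fun _ _ : Fin 4 => True)) :
    ∃ a', ∃ η ∈ elem R (fun _ _ : Fin 3 => True), a' ⬝ᵥ (b ᵥ* η) = 1 ∧
      εᵀ * normTheta a b * ε = normTheta a' (b ᵥ* η) := by
  induction hε using elem_induction_right with
  | one => exact ⟨a, 1, Submonoid.one_mem _, by simpa using h, by simp⟩
  | mul i j hij hP r ε hε ih =>
    obtain ⟨a', η, hη, hab, e⟩ := ih
    have e' : (ε * transvection i j r)ᵀ * normTheta a b * (ε * transvection i j r) =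
        (transvection i j r)ᵀ * normTheta a' (b ᵥ* η) * transvection i j r := by
      rw [← e]
      simp only [transpose_mul, mul_assoc]
    rw [e']
    rcases eq_one_or_exists_coordIndex i with rfl | ⟨k, rfl⟩
    · rcases eq_one_or_exists_coordIndex j with rfl | ⟨l, rfl⟩
      · exact absurd rfl hij
      · set c : Fin 3 → R := Pi.single l r with hc
        have hcl : transvection 1 (coordIndex l) r =
            tv (Pi.single 1 1) ![c 0, 0, c 2, c 1] := by
          rw [transvection_eq_tv']
          congr 1
          ext x
          fin_cases l <;> fin_cases x <;> simp [hc, coordIndex]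
        refine ⟨_, η, hη, ?_, by rw [hcl]; exact tv_normTheta a' (b ᵥ* η) c⟩
        simp only [dotProduct, Fin.sum_univ_three] at hab ⊢
        simp only [Matrix.cons_val]
        linear_combination hab
    · rcases eq_one_or_exists_coordIndex j with rfl | ⟨l, rfl⟩
      · have hw : (Pi.single (k + 1) (r * a' (k + 2)) - Pi.single (k + 2) (r * a' (k + 1)) :
            Fin 3 → R) ⬝ᵥ a' = 0 := by
          simp [sub_dotProduct, single_dotProduct]
          ring
        -- Adding the Koszul relation w is right multiplication by 1 + a' wᵀ because the row has
        -- product 1 with a'; Suslin's lemma makes this matrix elementary.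
        have hb : b ᵥ* η + (Pi.single (k + 1) (r * a' (k + 2)) -
            Pi.single (k + 2) (r * a' (k + 1))) = b ᵥ* (η * tv a'
              (Pi.single (k + 1) (r * a' (k + 2)) - Pi.single (k + 2) (r * a' (k + 1)))) := by
          rw [← vecMul_vecMul, vecMul_tv, dotProduct_comm, hab, one_smul]
        refine ⟨a', _, Submonoid.mul_mem _ hη (tv_koszul_mem_elem a' (i := k) (j := k + 1)
          (k := k + 2) ?_ ?_ ?_ r), ?_, ?_⟩
        · exact (show ∀ k : Fin 3, k ≠ k + 1 by decide) k
        · exact (show ∀ k : Fin 3, k ≠ k + 2 by decide) k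
        · exact (show ∀ k : Fin 3, k + 1 ≠ k + 2 by decide) k
        · rw [← hb, dotProduct_add, hab, dotProduct_comm, hw, add_zero]
        · rw [← hb, transvection_one_right_normTheta]
      · have hkl : k ≠ l := fun e => hij (e ▸ rfl)
        refine ⟨a' - Pi.single k (r * a' l), η * transvection k l r, Submonoid.mul_mem _ hη
          (transvection_mem_elem hkl trivial r), ?_, ?_⟩
        rotate_left
        · rw [transvection_normTheta _ _ hkl, vecMul_vecMul]
        · rw [← vecMul_vecMul, transvection_eq_tv', vecMul_tv, dotProduct_single, mul_one,
            sub_dotProduct, dotProduct_add, hab, dotProduct_smul, dotProduct_single,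
            single_dotProduct]
          simp [hkl]
          ring

/-- Each generator of size three lifts to size four. The final a' can be prescribed: it is traced
back along the generators, and `exists_tv_normTheta` handles the start. -/
theorem exists_normTheta_vecMul {a b : Fin 3 → R} (h : a ⬝ᵥ b = 1)
    {η : Matrix (Fin 3) (Fin 3) R} (hη : η ∈ elem R (fun _ _ : Fin 3 => True)) {a' : Fin 3 → R}
    (h' : a' ⬝ᵥ (b ᵥ* η) = 1) :
    ∃ ε ∈ elem R (fun _ _ : Fin 4 => True), εᵀ * normTheta a b * ε = normTheta a' (b ᵥ* η) := by
  induction hη using elem_induction_right generalizing a' with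
  | one => simpa using exists_tv_normTheta h (by simpa using h')
  | mul k l hkl hP r η hη ih =>
    have hdot : ∀ x : Fin 3 → R, (a' + Pi.single k (r * a' l)) ⬝ᵥ x =
        a' ⬝ᵥ (x ᵥ* transvection k l r) := fun x => by
      rw [transvection_eq_tv', vecMul_tv, dotProduct_single, add_dotProduct, dotProduct_add,
        dotProduct_smul, single_dotProduct, dotProduct_single]
      simp
      ring
    obtain ⟨ε, hε, e⟩ := ih (a' := a' + Pi.single k (r * a' l)) (by
      rw [hdot, vecMul_vecMul, h'])
    refine ⟨ε * transvection (coordIndex k) (coordIndex l) r, Submonoid.mul_mem _ hε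
      (transvection_mem_elem (fun e => hkl (coordIndex_injective e)) trivial r), ?_⟩
    rw [← vecMul_vecMul]
    calc _ = (transvection (coordIndex k) (coordIndex l) r)ᵀ * (εᵀ * normTheta a b * ε) *
          transvection (coordIndex k) (coordIndex l) r := by
          simp only [transpose_mul, mul_assoc]
      _ = _ := by
          rw [e, transvection_normTheta _ _ hkl]
          congr 1
          simp [hkl.symm]

end Four

/-! ### The Pfaffian -/

section Pfaffian

variable {R : Type*} [CommRing R] {M : Type*} [AddCommGroup M] [Module R M]

open AlternatingMap

/-- The contraction `(v₀, …, v_N) ↦ ∑ i, (-1) ^ i * B x vᵢ * f (v₀, …, v̂ᵢ, …, v_N)`. -/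
noncomputable def contractForm {N : ℕ} (ℓ : M →ₗ[R] R) (f : M [⋀^Fin N]→ₗ[R] R) :
    M [⋀^Fin (N + 1)]→ₗ[R] R :=
  alternatizeUncurryFin (ℓ.smulRight f)

theorem contractForm_apply {N : ℕ} (ℓ : M →ₗ[R] R) (f : M [⋀^Fin N]→ₗ[R] R) (v : Fin (N + 1) → M) :
    contractForm ℓ f v = ∑ i : Fin (N + 1), (-1) ^ i.val * ℓ (v i) * f (i.removeNth v) := by
  rw [contractForm, alternatizeUncurryFin_apply]
  refine Finset.sum_congr rfl fun i _ => ?_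
  rcases Nat.even_or_odd i.val with h | h <;> simp [h.neg_one_pow]

/-- In terms of exterior multiplication this is ℓ ∧ ℓ ∧ f = 0. -/
theorem contractForm_contractForm {N : ℕ} (ℓ : M →ₗ[R] R) (f : M [⋀^Fin N]→ₗ[R] R) :
    contractForm ℓ (contractForm ℓ f) = 0 := by
  have := alternatizeUncurryFin_alternatizeUncurryFinLM_comp_of_symmetric
    (f := (LinearMap.smulRight ℓ (LinearMap.smulRight ℓ f) : M →ₗ[R] M →ₗ[R] M [⋀^Fin N]→ₗ[R] R))
    (by
      intro x y
      simp [smul_smul, mul_comm])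
  rw [← this]
  unfold contractForm
  congr 1
  ext x v
  simp [alternatizeUncurryFin_apply, Finset.mul_sum, mul_left_comm, Finset.smul_sum]

theorem contractForm_cons {N : ℕ} (ℓ : M →ₗ[R] R) (f : M [⋀^Fin (N + 1)]→ₗ[R] R)
    {x : M} (hx : ℓ x = 0) (w : Fin (N + 1) → M) (g : M [⋀^Fin N]→ₗ[R] R)
    (hg : ∀ v, f (Fin.cons x v : Fin (N + 1) → M) = g v) :
    contractForm ℓ f (Fin.cons x w : Fin (N + 2) → M) = -contractForm ℓ g w := by
  rw [contractForm_apply, contractForm_apply, Fin.sum_univ_succ]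
  simp only [Fin.cons_zero, hx, mul_zero, zero_mul, zero_add, Fin.cons_succ, Fin.val_succ,
    pow_succ, ← Finset.sum_neg_distrib]
  refine Finset.sum_congr rfl fun i _ => ?_
  have : i.succ.removeNth (Fin.cons x w : Fin (N + 2) → M) =
      (Fin.cons x (i.removeNth w) : Fin (N + 1) → M) := by
    ext j
    refine Fin.cases ?_ (fun k => ?_) j
    · simp [Fin.removeNth]
    · simp [Fin.removeNth]
  rw [this, hg]
  ring

theorem apply_eq_zero_of_cons {N : ℕ} (f : M [⋀^Fin (N + 1)]→ₗ[R] R) {x : M}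
    (hf : ∀ w, f (Fin.cons x w : Fin (N + 1) → M) = 0) {v : Fin (N + 1) → M} {k : Fin (N + 1)}
    (hv : v k = x) : f v = 0 := by
  have h0 : ∀ v : Fin (N + 1) → M, v 0 = x → f v = 0 := fun v hv => by
    rw [← Fin.cons_self_tail v, hv, hf]
  by_cases hk : k = 0
  · exact h0 v (hk ▸ hv)
  · rw [← neg_eq_zero, ← f.map_swap v (Ne.symm hk)]
    exact h0 _ (by simpa using hv)

/-- One step in the recursive definition of the Pfaffian of a bilinear form. -/
noncomputable def pfaffianStep (B : M →ₗ[R] M →ₗ[R] R) {N : ℕ} (f : M [⋀^Fin N]→ₗ[R] R)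
    (hf : ∀ x w, contractForm (B x) f (Fin.cons x w : Fin (N + 1) → M) = 0) :
    M [⋀^Fin (N + 2)]→ₗ[R] R where
  toMultilinearMap := LinearMap.uncurryLeft
    { toFun := fun x => (contractForm (B x) f).toMultilinearMap
      map_add' := fun x y => by
        ext v
        simp [contractForm_apply, mul_add, add_mul, Finset.sum_add_distrib]
      map_smul' := fun c x => by
        ext v
        simp [contractForm_apply, Finset.mul_sum, mul_left_comm, mul_assoc] }
  map_eq_zero_of_eq' := by
    have key : ∀ (v : Fin (N + 2) → M) (j : Fin (N + 1)), v 0 = v j.succ →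
        contractForm (B (v 0)) f (Fin.tail v) = 0 := fun v j h =>
      apply_eq_zero_of_cons _ (hf _) (k := j) h.symm
    intro v i j hv hij
    change contractForm (B (v 0)) f (Fin.tail v) = 0
    rcases Fin.eq_zero_or_eq_succ i with rfl | ⟨i, rfl⟩
    · rcases Fin.eq_zero_or_eq_succ j with rfl | ⟨j, rfl⟩
      · exact absurd rfl hij
      · exact key v j hv
    · rcases Fin.eq_zero_or_eq_succ j with rfl | ⟨j, rfl⟩
      · exact key v i hv.symm
      · exact AlternatingMap.map_eq_zero_of_eq _ _ (i := i) (j := j) hv fun e => hij (e ▸ rfl)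

/-- The Pfaffian of a Gram matrix is an alternating function of the vectors. Expansion along the
first row alternates in the first vector only if contraction with B x vanishes once x is an
argument, so this is carried through the induction; it persists because contracting twice with B x
gives zero. -/
theorem exists_pfaffian_eq (B : M →ₗ[R] M →ₗ[R] R) (hB : ∀ x, B x x = 0) (n : ℕ) :
    ∃ f : M [⋀^Fin (2 * n)]→ₗ[R] R,
      (∀ x w, contractForm (B x) f (Fin.cons x w : Fin (2 * n + 1) → M) = 0) ∧
      ∀ v, f v = pfaffian n (Matrix.of fun i j => B (v i) (v j)) := by
  induction n with
  | zero =>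
    refine ⟨AlternatingMap.constOfIsEmpty R M (Fin 0) 1, fun x w => ?_, fun v => rfl⟩
    rw [contractForm_apply]
    exact Fintype.sum_eq_zero _ fun i => by
      rw [Subsingleton.elim (α := Fin 1) i 0, Fin.cons_zero, hB]
      simp
  | succ n ih =>
    obtain ⟨f, hf, hfv⟩ := ih
    refine ⟨pfaffianStep B f hf, fun x w => ?_, fun v => ?_⟩
    · rw [contractForm_cons (N := 2 * n + 1) (B x) _ (hB x) w (contractForm (B x) f)
        (fun v => rfl), contractForm_contractForm]
      simp
    · change contractForm (B (v 0)) f (Fin.tail v) = _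
      rw [contractForm_apply]
      refine Finset.sum_congr rfl fun j _ => ?_
      rw [hfv]
      rfl

/-- The Pfaffian of an alternating matrix is invariant under congruences of determinant one. -/
theorem pfaffian_congruence {n : ℕ} {A ε : Matrix (Fin (2 * n)) (Fin (2 * n)) R} (hA : Aᵀ = -A)
    (hA' : ∀ i, A i i = 0) (hε : ε.det = 1) : pfaffian n (εᵀ * A * ε) = pfaffian n A := by
  have hB : ∀ x, A.toLinearMap₂' R x x = 0 := fun x => by
    rw [Matrix.toLinearMap₂'_apply', dotProduct_mulVec]
    exact vecMul_dotProduct_self hA hA' x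
  obtain ⟨f, -, hf⟩ := exists_pfaffian_eq (A.toLinearMap₂' R) hB n
  have h1 : f (fun i => ε *ᵥ Pi.single i 1) = pfaffian n (εᵀ * A * ε) := by
    rw [hf]
    congr 1
    ext i j
    rw [of_apply, Matrix.toLinearMap₂'_apply', mulVec_mulVec, ← vecMul_transpose,
      ← dotProduct_mulVec, mulVec_mulVec, ← mul_assoc]
    simp
  have h2 : f (fun i => Pi.single i 1) = pfaffian n A := by
    rw [hf]
    congr 1
    ext i j
    rw [of_apply, Matrix.toLinearMap₂'_apply']
    simp
  -- An alternating form of top degree is a multiple of the determinant, so its value on the columns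
  -- of ε is its value on the basis times det ε.
  have h3 := f.eq_smul_basis_det (Pi.basisFun R _)
  rw [← h1, ← h2, h3]
  simp only [AlternatingMap.smul_apply, Module.Basis.det_apply, Pi.basisFun_apply]
  congr 1
  have : ∀ g : Matrix (Fin (2 * n)) (Fin (2 * n)) R, (Pi.basisFun R (Fin (2 * n))).toMatrix
      (fun i => g *ᵥ Pi.single i 1) = g := fun g => by
    ext i j
    simp [Module.Basis.toMatrix_apply]
  rw [this, hε]
  have h4 := this 1
  simp only [one_mulVec] at h4
  rw [h4, det_one]

end Pfaffian

/-! ### Stabilization by hyperbolic planes and its effect on the Pfaffian. -/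

section Stabilization

variable {R : Type*} [CommRing R]

/-- The stabilization `A ⊥ χ_{N - n}` of a matrix of size `2n`. -/
def stab {n : ℕ} (A : Matrix (Fin (2 * n)) (Fin (2 * n)) R) (N : ℕ) :
    Matrix (Fin (2 * N)) (Fin (2 * N)) R :=
  of fun i j =>
    if h : i.val < 2 * n ∧ j.val < 2 * n then A ⟨i, h.1⟩ ⟨j, h.2⟩ else chi R N i j

theorem sum_eq_sum_castLE {N M : ℕ} (h : N ≤ M) (f : Fin M → R) (g : Fin N → R)
    (h₀ : ∀ j, N ≤ j.val → f j = 0) (h₁ : ∀ j, f (Fin.castLE h j) = g j) :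
    ∑ j, f j = ∑ j, g j := by
  rw [← Finset.sum_subset (Finset.subset_univ (Finset.univ.map (Fin.castLEEmb h))), Finset.sum_map]
  · exact Finset.sum_congr rfl fun j _ => h₁ j
  · intro j _ hj
    refine h₀ j ?_
    by_contra hlt
    exact hj (Finset.mem_map.mpr ⟨⟨j, by omega⟩, Finset.mem_univ _, rfl⟩)

theorem succ_succAbove_val {N : ℕ} (j : Fin (N + 1)) (k : Fin N) :
    (j.succAbove k).succ.val = if k.val < j.val then k.val + 1 else k.val + 2 := by
  rw [Fin.succAbove]
  simp only [Fin.lt_def, Fin.val_castSucc]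
  split_ifs <;> simp

/-- For nonempty A, the first row of the stabilization ends in zeros, and its remaining minors are
the stabilized minors of A: deleting two early indices shifts the last block by two, which preserves
the parity pattern of `chi`. -/
theorem pfaffian_stab_succ {n : ℕ} (A : Matrix (Fin (2 * n)) (Fin (2 * n)) R) :
    pfaffian (n + 1) (stab A (n + 1)) = pfaffian n A := by
  induction n with
  | zero => simp [pfaffian, stab, chi]
  | succ n ih =>
    refine sum_eq_sum_castLE (N := 2 * n + 1) (M := 2 * (n + 1) + 1) (by omega) _ _
      (fun j hj => ?_) fun j => ?_
    · have h1 : stab A (n + 1 + 1) 0 j.succ = 0 := by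
        have h : ¬ (j.succ.val < 2 * (n + 1)) := by
          rw [Fin.val_succ]
          omega
        rw [stab, of_apply, dif_neg fun h' => h h'.2, chi, of_apply, if_neg, if_neg]
        · exact fun h' => absurd h'.2 (by change ¬ (0 = _); omega)
        · rintro ⟨-, h'⟩
          change j.val + 1 = 0 + 1 at h'
          omega
      rw [h1, mul_zero, zero_mul]
    · have h1 : stab A (n + 1 + 1) 0 (Fin.castLE (by omega : 2 * n + 1 ≤ 2 * (n + 1) + 1) j).succ =
          A 0 j.succ := by
        have := j.2
        rw [stab, of_apply, dif_pos ⟨by change 0 < _; omega, by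
          rw [Fin.val_succ, Fin.val_castLE]
          omega⟩]
        rfl
      rw [h1, ← ih]
      congr 2
      ext k l
      have hj := j.2
      simp only [submatrix_apply, stab, of_apply]
      have hk := succ_succAbove_val (N := 2 * (n + 1))
        (Fin.castLE (by omega : 2 * n + 1 ≤ 2 * (n + 1) + 1) j) k
      have hl := succ_succAbove_val (N := 2 * (n + 1))
        (Fin.castLE (by omega : 2 * n + 1 ≤ 2 * (n + 1) + 1) j) l
      rw [Fin.val_castLE] at hk hl
      by_cases h : k.val < 2 * n ∧ l.val < 2 * n
      · rw [dif_pos h, dif_pos (by rw [hk, hl]; split_ifs <;> omega)]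
        congr 1
        · ext
          change _ = (j.succAbove ⟨k, h.1⟩).succ.val
          rw [succ_succAbove_val (N := 2 * n)]
          exact hk
        · ext
          change _ = (j.succAbove ⟨l, h.2⟩).succ.val
          rw [succ_succAbove_val (N := 2 * n)]
          exact hl
      · rw [dif_neg h, dif_neg (by rw [hk, hl]; split_ifs <;> omega)]
        simp only [chi, of_apply]
        rw [hk, hl]
        have e1 : ((if k.val < j.val then k.val + 1 else k.val + 2) % 2 = 0 ∧
          (if l.val < j.val then l.val + 1 else l.val + 2) =
            (if k.val < j.val then k.val + 1 else k.val + 2) + 1) ↔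
            k.val % 2 = 0 ∧ l.val = k.val + 1 := by
          split_ifs <;> omega
        have e2 : ((if l.val < j.val then l.val + 1 else l.val + 2) % 2 = 0 ∧
          (if k.val < j.val then k.val + 1 else k.val + 2) =
            (if l.val < j.val then l.val + 1 else l.val + 2) + 1) ↔
            l.val % 2 = 0 ∧ k.val = l.val + 1 := by
          split_ifs <;> omega
        simp only [e1, e2]

end Stabilization

/-! ### Relative elementary groups and the double ring -/

section RelElementary

variable {R : Type*} [CommRing R]

theorem coe_mul_coe_inv {n : ℕ} (g : SpecialLinearGroup (Fin n) R) :
    (g : Matrix (Fin n) (Fin n) R) * (g⁻¹ : SpecialLinearGroup (Fin n) R) = 1 := by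
  rw [← Matrix.SpecialLinearGroup.coe_mul, mul_inv_cancel, Matrix.SpecialLinearGroup.coe_one]

theorem coe_mem_elem {n : ℕ} {g : SpecialLinearGroup (Fin n) R} (hg : g ∈ elementary R n) :
    (g : Matrix (Fin n) (Fin n) R) ∈ elem R (fun _ _ : Fin n => True) := by
  induction hg using Subgroup.closure_induction with
  | mem x hx =>
    obtain ⟨i, j, h, a, rfl⟩ := hx
    exact transvection_mem_elem h trivial a
  | one => exact Submonoid.one_mem _
  | mul x y _ _ hx hy => exact Matrix.SpecialLinearGroup.coe_mul x y ▸ Submonoid.mul_mem _ hx hy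
  | inv x _ hx =>
    obtain ⟨h, hh, h1, h2⟩ := exists_inverse_mem_elem hx
    rwa [← left_inv_eq_right_inv h2 (coe_mul_coe_inv x)]

variable {ι : Type*} [Fintype ι] [DecidableEq ι]

/-- The diagonal embedding into the double. -/
def Double.diag (I : Ideal R) : R →+* Double I :=
  ((RingHom.id R).prod (RingHom.id R)).codRestrict (Double I) fun x =>
    Double.mem_iff.mpr (by simp)

theorem map_map_diag_fst (I : Ideal R) {κ : Type*} (M : Matrix ι κ R) :
    (M.map (Double.diag I)).map (Double.fst I) = M := rfl

theorem map_map_diag_snd (I : Ideal R) {κ : Type*} (M : Matrix ι κ R) :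
    (M.map (Double.diag I)).map (Double.snd I) = M := rfl

theorem map_transvection {S : Type*} [CommRing S] (f : R →+* S) (i j : ι) (r : R) :
    (transvection i j r).map f = transvection i j (f r) := by
  rw [transvection, transvection, Matrix.map_add f (map_add f), Matrix.map_one f (map_zero f)
    (map_one f), Matrix.map_single]

/-- The relative elementary group, as the set of second components of elementary matrices over
the double whose first component is trivial. -/
def relElem (I : Ideal R) (ι : Type*) [Fintype ι] [DecidableEq ι] : Submonoid (Matrix ι ι R) where
  carrier := {M | ∃ G ∈ elem (Double I) (fun _ _ : ι => True),
    G.map (Double.fst I) = 1 ∧ G.map (Double.snd I) = M}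
  one_mem' := ⟨1, Submonoid.one_mem _, by simp, by simp⟩
  mul_mem' := by
    rintro _ _ ⟨G, hG, h1, rfl⟩ ⟨H, hH, h2, rfl⟩
    exact ⟨G * H, Submonoid.mul_mem _ hG hH, by rw [Matrix.map_mul, h1, h2, mul_one],
      Matrix.map_mul⟩

theorem exists_inverse_mem_relElem {I : Ideal R} {M : Matrix ι ι R} (hM : M ∈ relElem I ι) :
    ∃ N ∈ relElem I ι, M * N = 1 ∧ N * M = 1 := by
  obtain ⟨G, hG, h1, rfl⟩ := hM
  obtain ⟨H, hH, h2, h3⟩ := exists_inverse_mem_elem hG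
  refine ⟨H.map (Double.snd I), ⟨H, hH, ?_, rfl⟩, ?_, ?_⟩
  · have := congrArg (fun X => X.map (Double.fst I)) h2
    simpa [Matrix.map_mul, h1] using this
  · rw [← Matrix.map_mul, h2]
    simp
  · rw [← Matrix.map_mul, h3]
    simp

theorem det_eq_one_of_mem_relElem {I : Ideal R} {M : Matrix ι ι R} (hM : M ∈ relElem I ι) :
    M.det = 1 := by
  obtain ⟨G, hG, -, rfl⟩ := hM
  exact det_eq_one_of_mem_elem (map_mem_elem _ hG)

theorem tv_single_left_mem_relElem {I : Ideal R} {i : ι} {c : ι → R} (hc : ∀ j, c j ∈ I)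
    (hi : c i = 0) : tv (Pi.single i 1) c ∈ relElem I ι := by
  refine ⟨tv (Pi.single i 1) fun j => Double.mk 0 (c j) (by simpa using hc j),
    tv_single_left_mem_elem fun j hj => ⟨?_, trivial⟩, ?_, ?_⟩
  · rintro rfl
    exact hj (Double.ext (by simp) (by simpa using hi))
  · ext a b
    simp [tv, vecMulVec_apply, one_apply, apply_ite (Double.fst I)]
  · ext a b
    simp [tv, vecMulVec_apply, one_apply, Pi.single_apply, apply_ite (Double.snd I)]

theorem coe_mem_relElem {I : Ideal R} {n : ℕ} {ε : SpecialLinearGroup (Fin n) R}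
    (hε : ε ∈ relElementary I n) : (ε : Matrix (Fin n) (Fin n) R) ∈ relElem I (Fin n) := by
  induction hε using Subgroup.closure_induction with
  | mem x hx =>
    obtain ⟨β, hβ, i, j, h, a, ha, rfl⟩ := hx
    -- The generator β e_{ij}(a) β⁻¹ lifts to the conjugate of e_{ij}((0, a)) by the constant pair
    -- (β, β).
    refine ⟨(β : Matrix (Fin n) (Fin n) R).map (Double.diag I) *
      transvection i j (Double.mk 0 a (by simpa using ha)) *
      ((β⁻¹ : SpecialLinearGroup (Fin n) R) : Matrix (Fin n) (Fin n) R).map (Double.diag I),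
      Submonoid.mul_mem _ (Submonoid.mul_mem _ (map_mem_elem _ (coe_mem_elem hβ))
        (transvection_mem_elem h trivial _))
        (map_mem_elem _ (coe_mem_elem (Subgroup.inv_mem _ hβ))), ?_, ?_⟩
    · rw [Matrix.map_mul, Matrix.map_mul, map_map_diag_fst, map_map_diag_fst, map_transvection,
        Double.fst_mk, transvection_zero, mul_one, coe_mul_coe_inv]
    · rw [Matrix.map_mul, Matrix.map_mul, map_map_diag_snd, map_map_diag_snd, map_transvection,
        Double.snd_mk, Matrix.SpecialLinearGroup.coe_mul, Matrix.SpecialLinearGroup.coe_mul]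
      rfl
  | one => exact Submonoid.one_mem _
  | mul x y _ _ hx hy => exact Matrix.SpecialLinearGroup.coe_mul x y ▸ Submonoid.mul_mem _ hx hy
  | inv x _ hx =>
    obtain ⟨h, hh, h1, h2⟩ := exists_inverse_mem_relElem hx
    rwa [← left_inv_eq_right_inv h2 (coe_mul_coe_inv x)]

theorem relElementary_conj_mem {I : Ideal R} {n : ℕ} {ε β : SpecialLinearGroup (Fin n) R}
    (hε : ε ∈ relElementary I n) (hβ : β ∈ elementary R n) :
    β * ε * β⁻¹ ∈ relElementary I n := by
  induction hε using Subgroup.closure_induction with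
  | mem x hx =>
    obtain ⟨γ, hγ, i, j, h, a, ha, rfl⟩ := hx
    exact Subgroup.subset_closure ⟨β * γ, Subgroup.mul_mem _ hβ hγ, i, j, h, a, ha, by group⟩
  | one => simp [Subgroup.one_mem]
  | mul x y _ _ hx hy =>
    have := Subgroup.mul_mem _ hx hy
    rwa [show β * x * β⁻¹ * (β * y * β⁻¹) = β * (x * y) * β⁻¹ by group] at this
  | inv x _ hx =>
    have := Subgroup.inv_mem _ hx
    rwa [show (β * x * β⁻¹)⁻¹ = β * x⁻¹ * β⁻¹ by group] at this

/-- A generator over the double is e_{ij}(x) paired with e_{ij}(x) e_{ij}(y - x), where y - x ∈ I;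
normality of the relative group allows the relative factors to be collected on the right. -/
theorem exists_relElementary_of_mem_elem {I : Ideal R} {n : ℕ}
    {G : Matrix (Fin n) (Fin n) (Double I)} (hG : G ∈ elem (Double I) (fun _ _ : Fin n => True)) :
    ∃ e ∈ elementary R n, ∃ ρ ∈ relElementary I n,
      G.map (Double.fst I) = (e : Matrix (Fin n) (Fin n) R) ∧
      G.map (Double.snd I) = ((e * ρ : SpecialLinearGroup (Fin n) R) :
        Matrix (Fin n) (Fin n) R) := by
  induction hG using elem_induction_right with
  | one => exact ⟨1, Subgroup.one_mem _, 1, Subgroup.one_mem _, by simp, by simp⟩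
  | mul i j hij hP r G hG ih =>
    obtain ⟨e, he, ρ, hρ, h1, h2⟩ := ih
    set t := SpecialLinearGroup.transvection hij (Double.fst I r) with ht
    set s := SpecialLinearGroup.transvection hij (Double.snd I r - Double.fst I r) with hs
    have htE : t ∈ elementary R n := Subgroup.subset_closure ⟨i, j, hij, _, rfl⟩
    have hsE : s ∈ relElementary I n := Subgroup.subset_closure
      ⟨1, Subgroup.one_mem _, i, j, hij, _, Double.snd_sub_fst_mem r, by simp [hs]⟩
    have hts : (t : Matrix (Fin n) (Fin n) R) * s = transvection i j (Double.snd I r) := by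
      have := transvection_mul_transvection_same (i := i) (j := j) hij (Double.fst I r)
        (Double.snd I r - Double.fst I r)
      rw [add_sub_cancel] at this
      exact this
    refine ⟨e * t, Subgroup.mul_mem _ he htE, t⁻¹ * ρ * t⁻¹⁻¹ * s,
      Subgroup.mul_mem _ (relElementary_conj_mem hρ (Subgroup.inv_mem _ htE)) hsE, ?_, ?_⟩
    · rw [Matrix.map_mul, h1, map_transvection, Matrix.SpecialLinearGroup.coe_mul]
      rfl
    · rw [Matrix.map_mul, h2, map_transvection, ← hts, ← Matrix.SpecialLinearGroup.coe_mul,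
        ← Matrix.SpecialLinearGroup.coe_mul,
        show e * t * (t⁻¹ * ρ * t⁻¹⁻¹ * s) = e * ρ * (t * s) by group]

theorem exists_mem_relElementary {I : Ideal R} {n : ℕ} {M : Matrix (Fin n) (Fin n) R}
    (hM : M ∈ relElem I (Fin n)) :
    ∃ ε ∈ relElementary I n, (ε : Matrix (Fin n) (Fin n) R) = M := by
  obtain ⟨G, hG, h1, rfl⟩ := hM
  obtain ⟨e, he, ρ, hρ, h2, h3⟩ := exists_relElementary_of_mem_elem hG
  have he : e = 1 := Subtype.ext (by rw [← h2, h1]; rfl)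
  rw [he, one_mul] at h3
  exact ⟨ρ, hρ, h3.symm⟩

end RelElementary

/-! ### Orthogonal sums -/

section Perp

variable {R : Type*} [CommRing R] {m n N : ℕ}

/-- The index set of an orthogonal sum. -/
def perpEquiv (h : m + n = N) : Fin (2 * N) ≃ Fin (2 * m) ⊕ Fin (2 * n) :=
  (finSumFinEquiv.trans (finCongr (by omega))).symm

theorem perp_eq (h : m + n = N) (A : Matrix (Fin (2 * m)) (Fin (2 * m)) R)
    (B : Matrix (Fin (2 * n)) (Fin (2 * n)) R) :
    perp h A B = (fromBlocks A 0 0 B).submatrix (perpEquiv h) (perpEquiv h) := rfl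

theorem perp_mul (h : m + n = N) (A A' : Matrix (Fin (2 * m)) (Fin (2 * m)) R)
    (B B' : Matrix (Fin (2 * n)) (Fin (2 * n)) R) :
    perp h A B * perp h A' B' = perp h (A * A') (B * B') := by
  simp only [perp_eq, submatrix_mul_equiv, fromBlocks_multiply]
  simp

theorem perp_transpose (h : m + n = N) (A : Matrix (Fin (2 * m)) (Fin (2 * m)) R)
    (B : Matrix (Fin (2 * n)) (Fin (2 * n)) R) : (perp h A B)ᵀ = perp h Aᵀ Bᵀ := by
  simp [perp_eq, fromBlocks_transpose]

theorem perp_one (h : m + n = N) :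
    perp h (1 : Matrix (Fin (2 * m)) (Fin (2 * m)) R) (1 : Matrix (Fin (2 * n)) (Fin (2 * n)) R) =
      1 := by
  rw [perp_eq, fromBlocks_one, submatrix_one_equiv]

theorem perp_map {S : Type*} [CommRing S] (f : R →+* S) (h : m + n = N)
    (A : Matrix (Fin (2 * m)) (Fin (2 * m)) R) (B : Matrix (Fin (2 * n)) (Fin (2 * n)) R) :
    (perp h A B).map f = perp h (A.map f) (B.map f) := by
  rw [perp_eq, perp_eq, ← submatrix_map, fromBlocks_map, Matrix.map_zero f (map_zero f),
    Matrix.map_zero f (map_zero f)]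

theorem perp_left_injective (h : m + n = N) {A A' : Matrix (Fin (2 * m)) (Fin (2 * m)) R}
    {B B' : Matrix (Fin (2 * n)) (Fin (2 * n)) R} (e : perp h A B = perp h A' B') : A = A' := by
  have := congrArg (fun X => X.submatrix (perpEquiv h).symm (perpEquiv h).symm) e
  simp only [perp_eq, submatrix_submatrix, Equiv.self_comp_symm, submatrix_id_id,
    fromBlocks_inj] at this
  exact this.1

theorem perp_apply (h : m + n = N) (A : Matrix (Fin (2 * m)) (Fin (2 * m)) R)
    (B : Matrix (Fin (2 * n)) (Fin (2 * n)) R) (i j : Fin (2 * N)) :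
    perp h A B i j = if hA : i.val < 2 * m ∧ j.val < 2 * m then A ⟨i, hA.1⟩ ⟨j, hA.2⟩
      else if hB : 2 * m ≤ i.val ∧ 2 * m ≤ j.val then
        B ⟨i - 2 * m, by omega⟩ ⟨j - 2 * m, by omega⟩ else 0 := by
  obtain ⟨x, rfl⟩ := (perpEquiv h).symm.surjective i
  obtain ⟨y, rfl⟩ := (perpEquiv h).symm.surjective j
  have hl : ∀ k, ((perpEquiv h).symm (Sum.inl k)).val = k.val := fun k => rfl
  have hr : ∀ k, ((perpEquiv h).symm (Sum.inr k)).val = 2 * m + k.val := fun k => rfl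
  rw [perp_eq, submatrix_apply, Equiv.apply_symm_apply, Equiv.apply_symm_apply]
  rcases x with x | x <;> rcases y with y | y <;> simp [hl, hr]

theorem transvection_perp_one (h : m + n = N) (i j : Fin (2 * m)) (r : R) :
    perp h (transvection i j r) 1 =
      transvection ((perpEquiv h).symm (Sum.inl i)) ((perpEquiv h).symm (Sum.inl j)) r := by
  have : fromBlocks (transvection i j r) 0 0 (1 : Matrix (Fin (2 * n)) (Fin (2 * n)) R) =
      transvection (Sum.inl i) (Sum.inl j) r := by
    ext x y
    rcases x with x | x <;> rcases y with y | y <;>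
      simp [transvection, Matrix.single_apply, one_apply]
  rw [perp_eq, this]
  ext x y
  simp [transvection, Matrix.single_apply, one_apply, Equiv.symm_apply_eq]

theorem perp_one_mem_elem (h : m + n = N) {M : Matrix (Fin (2 * m)) (Fin (2 * m)) R}
    (hM : M ∈ elem R (fun _ _ : Fin (2 * m) => True)) :
    perp h M 1 ∈ elem R (fun _ _ : Fin (2 * N) => True) := by
  induction hM using elem_induction_left with
  | one => rw [perp_one]; exact Submonoid.one_mem _
  | mul i j hij hP r g hg ih =>
    rw [← one_mul (1 : Matrix (Fin (2 * n)) (Fin (2 * n)) R), ← perp_mul, transvection_perp_one]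
    exact Submonoid.mul_mem _ (transvection_mem_elem (by simpa using hij) trivial r) ih

theorem exists_eq_perp_one (h : m + n = N) {M : Matrix (Fin (2 * N)) (Fin (2 * N)) R}
    (hM : M ∈ elem R (fun i j : Fin (2 * N) => i.val < 2 * m ∧ j.val < 2 * m)) :
    ∃ M' ∈ elem R (fun _ _ : Fin (2 * m) => True), M = perp h M' 1 := by
  induction hM using elem_induction_left with
  | one => exact ⟨1, Submonoid.one_mem _, (perp_one h).symm⟩
  | mul i j hij hP r g hg ih =>
    obtain ⟨g', hg', rfl⟩ := ih
    refine ⟨transvection ⟨i, hP.1⟩ ⟨j, hP.2⟩ r * g',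
      Submonoid.mul_mem _ (transvection_mem_elem ?_ trivial r) hg', ?_⟩
    · simpa [Fin.ext_iff] using hij
    · conv_rhs => rw [← one_mul (1 : Matrix (Fin (2 * n)) (Fin (2 * n)) R), ← perp_mul,
        transvection_perp_one]
      rfl

theorem perp_one_mem_relElem {I : Ideal R} (h : m + n = N)
    {M : Matrix (Fin (2 * m)) (Fin (2 * m)) R} (hM : M ∈ relElem I (Fin (2 * m))) :
    perp h M 1 ∈ relElem I (Fin (2 * N)) := by
  obtain ⟨G, hG, h1, rfl⟩ := hM
  refine ⟨perp h G 1, perp_one_mem_elem h hG, ?_, ?_⟩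
  · rw [perp_map, h1, Matrix.map_one _ (map_zero _) (map_one _), perp_one]
  · rw [perp_map, Matrix.map_one _ (map_zero _) (map_one _)]

theorem chi_map {S : Type*} [CommRing S] (f : R →+* S) : (chi R n).map f = chi S n := by
  ext i j
  simp [chi, apply_ite f]

/-- This removes the chosen decomposition of N: `stab` depends only on the final size. -/
theorem perp_chi_eq_stab (h : m + n = N) (A : Matrix (Fin (2 * m)) (Fin (2 * m)) R) :
    perp h A (chi R n) = stab A N := by
  ext i j
  rw [perp_apply, stab, of_apply]
  split_ifs with h1 h2
  · rfl
  · simp only [chi, of_apply]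
    have e1 : ((i.val - 2 * m) % 2 = 0 ∧ j.val - 2 * m = i.val - 2 * m + 1) ↔
      (i.val % 2 = 0 ∧ j.val = i.val + 1) := by omega
    have e2 : ((j.val - 2 * m) % 2 = 0 ∧ i.val - 2 * m = j.val - 2 * m + 1) ↔
      (j.val % 2 = 0 ∧ i.val = j.val + 1) := by omega
    simp only [e1, e2]
  · simp only [chi, of_apply]
    rw [if_neg (by omega), if_neg (by omega)]

theorem stab_self (A : Matrix (Fin (2 * n)) (Fin (2 * n)) R) : stab A n = A := by
  ext i j
  simp [stab]

theorem stab_stab {k : ℕ} (A : Matrix (Fin (2 * k)) (Fin (2 * k)) R) (hk : k ≤ n) (hn : n ≤ N) :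
    stab (stab A n) N = stab A N := by
  ext i j
  simp only [stab, of_apply]
  split_ifs with h1 h2 h2 h2
  · rfl
  · rfl
  · omega
  · rfl

theorem stab_map {S : Type*} [CommRing S] (f : R →+* S)
    (A : Matrix (Fin (2 * n)) (Fin (2 * n)) R) : (stab A N).map f = stab (A.map f) N := by
  ext i j
  simp only [stab, of_apply, map_apply, ← chi_map f]
  split_ifs <;> rfl

theorem chi_mul_neg_chi : chi R n * -chi R n = 1 := by
  have key : ∀ i : Fin (2 * n), ∃ k : Fin (2 * n), (k.val = if i.val % 2 = 0 then i.val + 1 else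
      i.val - 1) := fun i => ⟨⟨if i.val % 2 = 0 then i.val + 1 else i.val - 1, by
        have := i.2
        split_ifs <;> omega⟩, rfl⟩
  ext i j
  obtain ⟨k, hk⟩ := key i
  rw [mul_apply, Finset.sum_eq_single k]
  · simp only [chi, of_apply, Matrix.neg_apply, one_apply, Fin.ext_iff]
    split_ifs at hk ⊢ <;> first | omega | simp
  · intro l _ hl
    simp only [chi, of_apply, Matrix.neg_apply, Fin.ext_iff] at hl ⊢
    rw [if_neg, if_neg, zero_mul] <;> split_ifs at hk <;> omega
  · exact fun h => absurd (Finset.mem_univ _) h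

theorem stab_mul_eq_one {A B : Matrix (Fin (2 * n)) (Fin (2 * n)) R} (h : A * B = 1)
    (hN : n ≤ N) : ∃ B', stab A N * B' = 1 := by
  obtain ⟨k, rfl⟩ := Nat.exists_eq_add_of_le hN
  refine ⟨perp rfl B (-chi R k), ?_⟩
  rw [← perp_chi_eq_stab rfl, perp_mul, h, chi_mul_neg_chi, perp_one]

end Perp

/-! ### Stable congruence -/

section StableCongruence

variable {R : Type*} [CommRing R] {n N : ℕ}

theorem stab_transpose {A : Matrix (Fin (2 * n)) (Fin (2 * n)) R} (hA : Aᵀ = -A) :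
    (stab A N)ᵀ = -stab A N := by
  ext i j
  simp only [transpose_apply, Matrix.neg_apply, stab, of_apply]
  have h1 : ∀ i j, A j i = -A i j := fun i j => congrFun (congrFun hA i) j
  by_cases h : i.val < 2 * n ∧ j.val < 2 * n
  · rw [dif_pos h, dif_pos h.symm]
    exact h1 _ _
  · rw [dif_neg h, dif_neg fun h' => h h'.symm]
    simp only [chi, of_apply]
    split_ifs <;> first | omega | simp

theorem stab_diag {A : Matrix (Fin (2 * n)) (Fin (2 * n)) R} (hA : ∀ i, A i i = 0)
    (i : Fin (2 * N)) : stab A N i i = 0 := by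
  simp only [stab, of_apply]
  split_ifs with h
  · exact hA _
  · simp [chi]

theorem isHyperbolicAt_stab {A : Matrix (Fin (2 * n)) (Fin (2 * n)) R} (hA : Aᵀ = -A)
    (hA' : ∀ i, A i i = 0) {m : ℕ} (hm : n ≤ m) (hmN : m < N) :
    IsHyperbolicAt (stab A N) (⟨2 * m, by omega⟩ : Fin (2 * N)) ⟨2 * m + 1, by omega⟩ where
  skew := stab_transpose hA
  diag_zero := stab_diag hA'
  row_left := by
    ext j
    simp only [single_one_vecMul, row_apply, stab, of_apply, chi, Pi.single_apply, Fin.ext_iff]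
    rw [dif_neg (by omega)]
    split_ifs <;> first | omega | rfl
  row_right := by
    ext j
    simp only [single_one_vecMul, row_apply, stab, of_apply, chi, Pi.single_apply, Fin.ext_iff,
      Pi.neg_apply]
    rw [dif_neg (by omega)]
    split_ifs <;> first | omega | simp

/-- Hyperbolic planes are cancelled one at a time. All matrices keep the size 2N during the descent;
only the index set of the elementary group shrinks. At each step it still has at least six elements,
as cancellation requires for stable rank 3. -/
theorem exists_congruence_of_stab (hR : StableRankLE R 3)
    {A A' Ai : Matrix (Fin (2 * n)) (Fin (2 * n)) R} (hA : Aᵀ = -A) (hA₀ : ∀ i, A i i = 0)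
    (hA' : A'ᵀ = -A') (hA₀' : ∀ i, A' i i = 0) (hAi : A * Ai = 1) (hn : 2 ≤ n) (hN : n ≤ N)
    {g : Matrix (Fin (2 * N)) (Fin (2 * N)) R} (hg : g ∈ elem R (fun _ _ : Fin (2 * N) => True))
    (hgA : gᵀ * stab A N * g = stab A' N) :
    ∃ g' ∈ elem R (fun _ _ : Fin (2 * n) => True), g'ᵀ * A * g' = A' := by
  obtain ⟨B, hB⟩ := stab_mul_eq_one hAi hN
  have key : ∀ k ≤ N - n, ∃ g ∈ elemOn R (Finset.univ.filter fun i : Fin (2 * N) =>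
      i.val < 2 * (N - k)), gᵀ * stab A N * g = stab A' N := by
    intro k
    induction k with
    | zero =>
      intro _
      exact ⟨g, elem_mono (fun i j _ => by simp) hg, hgA⟩
    | succ k ih =>
      intro hk
      obtain ⟨g, hg, hgA⟩ := ih (by omega)
      obtain ⟨m, hm⟩ : ∃ m, N - k = m + 1 := ⟨N - k - 1, by omega⟩
      have hm' : N - (k + 1) = m := by omega
      rw [hm] at hg
      rw [hm']
      obtain ⟨g', hg', h⟩ := (isHyperbolicAt_stab hA hA₀ (m := m) (N := N) (by omega)
        (by omega)).exists_mem_elemOn_erase hR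
        (isHyperbolicAt_stab hA' hA₀' (by omega) (by omega))
        (by simp) (by simp; omega) (by simp) (fun i hi j hj => by
          simp only [Finset.mem_filter, Finset.mem_univ, true_and] at hi hj
          simp only [stab, of_apply, chi]
          rw [dif_neg (by omega), if_neg (by omega), if_neg (by omega)]) hB (by
          have : (Finset.univ.filter fun i : Fin (2 * N) => i.val < 2 * (m + 1)).card =
              2 * (m + 1) := by
            rw [Fin.card_filter_val_lt]
            omega
          omega) hg hgA
      refine ⟨g', elemOn_mono ?_ hg', h⟩
      intro i hi
      simp only [Finset.mem_erase, Finset.mem_filter, Finset.mem_univ, true_and, Fin.ext_iff,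
        ne_eq] at hi ⊢
      omega
  obtain ⟨g, hg, hgA⟩ := key (N - n) le_rfl
  rw [Nat.sub_sub_self hN] at hg
  obtain ⟨k, rfl⟩ := Nat.exists_eq_add_of_le hN
  obtain ⟨g', hg', rfl⟩ := exists_eq_perp_one rfl (elem_mono (fun i j h => by simpa using h) hg)
  refine ⟨g', hg', ?_⟩
  rw [← perp_chi_eq_stab rfl, ← perp_chi_eq_stab rfl, perp_transpose, perp_mul, perp_mul] at hgA
  exact perp_left_injective rfl hgA

/-- Congruence of stabilizations under relative elementary matrices. -/
def StablyCongruent (I : Ideal R) (α β : Σ n, Alt I n) : Prop :=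
  ∃ N, α.1 ≤ N ∧ β.1 ≤ N ∧ ∃ M ∈ relElem I (Fin (2 * N)),
    stab α.2.mat N = Mᵀ * stab β.2.mat N * M

variable {I : Ideal R} {α β γ : Σ n, Alt I n}

theorem exists_relElem_stab {m n : ℕ} {A : Matrix (Fin (2 * m)) (Fin (2 * m)) R}
    {B : Matrix (Fin (2 * n)) (Fin (2 * n)) R} {N N' : ℕ} (hm : m ≤ N) (hn : n ≤ N) (hN : N ≤ N')
    (h : ∃ M ∈ relElem I (Fin (2 * N)), stab A N = Mᵀ * stab B N * M) :
    ∃ M ∈ relElem I (Fin (2 * N')), stab A N' = Mᵀ * stab B N' * M := by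
  obtain ⟨M, hM, e⟩ := h
  obtain ⟨k, rfl⟩ := Nat.exists_eq_add_of_le hN
  refine ⟨perp rfl M 1, perp_one_mem_relElem rfl hM, ?_⟩
  rw [← stab_stab A hm hN, ← stab_stab B hn hN, ← perp_chi_eq_stab rfl, ← perp_chi_eq_stab rfl,
    perp_transpose, perp_mul, perp_mul, e]
  simp

theorem StablyCongruent.refl (α : Σ n, Alt I n) : StablyCongruent I α α :=
  ⟨α.1, le_rfl, le_rfl, 1, Submonoid.one_mem _, by simp⟩

theorem StablyCongruent.symm (h : StablyCongruent I α β) : StablyCongruent I β α := by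
  obtain ⟨N, h1, h2, M, hM, e⟩ := h
  obtain ⟨M', hM', e1, -⟩ := exists_inverse_mem_relElem hM
  refine ⟨N, h2, h1, M', hM', ?_⟩
  rw [e]
  calc stab β.2.mat N = (M * M')ᵀ * stab β.2.mat N * (M * M') := by simp [e1]
    _ = _ := by simp only [transpose_mul, mul_assoc]

theorem StablyCongruent.trans (h : StablyCongruent I α β) (h' : StablyCongruent I β γ) :
    StablyCongruent I α γ := by
  obtain ⟨N, h1, h2, h3⟩ := h
  obtain ⟨N', h1', h2', h3'⟩ := h'
  obtain ⟨M, hM, e⟩ := exists_relElem_stab h1 h2 (le_max_left N N') h3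
  obtain ⟨M', hM', e'⟩ := exists_relElem_stab h1' h2' (le_max_right N N') h3'
  refine ⟨max N N', h1.trans (le_max_left _ _), h2'.trans (le_max_right _ _), M' * M,
    Submonoid.mul_mem _ hM' hM, ?_⟩
  rw [e, e']
  simp only [transpose_mul, mul_assoc]

/-- Any common size can be enlarged, so the particular sizes in `AltRel` do not matter. Consequently
that relation is already an equivalence. -/
theorem altRel_iff : AltRel I α β ↔ StablyCongruent I α β := by
  constructor
  · rintro ⟨t, ε, hε, e⟩
    rw [perp_chi_eq_stab, perp_chi_eq_stab] at e
    exact ⟨_, by omega, by omega, _, coe_mem_relElem hε, e⟩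
  · rintro ⟨N, h1, h2, h3⟩
    obtain ⟨M, hM, e⟩ := exists_relElem_stab h1 h2 (show N ≤ α.1 + β.1 + N by omega) h3
    obtain ⟨ε, hε, rfl⟩ := exists_mem_relElementary hM
    refine ⟨N, ε, hε, ?_⟩
    rw [perp_chi_eq_stab, perp_chi_eq_stab, e]

end StableCongruence

/-! ### Comparison of orbits of rows with stable congruence classes of size-four matrices. -/

section Classes

universe u

variable {R : Type u} [CommRing R] {I : Ideal R}

theorem WE.mk_eq_mk_iff {m n : ℕ} {α : Alt I m} {β : Alt I n} :
    WE.mk α = WE.mk β ↔ StablyCongruent I ⟨m, α⟩ ⟨n, β⟩ := by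
  rw [← altRel_iff]
  exact Equivalence.quot_mk_eq_iff (r := AltRel I) ⟨fun _ => altRel_iff.mpr (.refl _),
    fun h => altRel_iff.mpr (altRel_iff.mp h).symm,
    fun h h' => altRel_iff.mpr ((altRel_iff.mp h).trans (altRel_iff.mp h'))⟩ _ _

theorem MSE3.mk_eq_mk_iff {b b' : Um3 I} : MSE3.mk b = MSE3.mk b' ↔
    ∃ M ∈ relElem I (Fin 3), b'.row = b.row ᵥ* M := by
  refine Quotient.eq.trans ⟨?_, ?_⟩
  · rintro ⟨ε, hε, e⟩
    exact ⟨_, coe_mem_relElem hε, e⟩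
  · rintro ⟨M, hM, e⟩
    obtain ⟨ε, hε, rfl⟩ := exists_mem_relElementary hM
    exact ⟨ε, hε, e⟩

/-- A row over the double with given components. -/
def Um3.pair (b b' : Um3 I) : Fin 3 → Double I := fun i =>
  Double.mk (b.row i) (b'.row i) (by
    have h0 := I.sub_mem b'.congr_zero b.congr_zero
    have h1 := I.sub_mem b'.congr_one b.congr_one
    have h2 := I.sub_mem b'.congr_two b.congr_two
    fin_cases i
    · simpa using h0
    · exact h1
    · exact h2)

theorem Um3.pair_dotProduct {a a' b b' : Um3 I} (h : a.row ⬝ᵥ b.row = 1)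
    (h' : a'.row ⬝ᵥ b'.row = 1) : a.pair a' ⬝ᵥ b.pair b' = 1 := by
  refine Double.ext ?_ ?_
  · simpa [dotProduct, Fin.sum_univ_three, Um3.pair] using h
  · simpa [dotProduct, Fin.sum_univ_three, Um3.pair] using h'

theorem map_normTheta {S : Type*} [CommRing S] (f : R →+* S) (a b : Fin 3 → R) :
    (normTheta a b).map f = normTheta (f ∘ a) (f ∘ b) := by
  ext i j
  fin_cases i <;> fin_cases j <;> simp [normTheta]

theorem thetaAlt_mat (a b : Um3 I) (h : a.row ⬝ᵥ b.row = 1) :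
    (thetaAlt a b h).mat = normTheta a.row b.row := normTheta_eq _ _

theorem normTheta_transpose (a b : Fin 3 → R) : (normTheta a b)ᵀ = -normTheta a b := by
  ext i j
  fin_cases i <;> fin_cases j <;> simp [normTheta]

theorem normTheta_diag (a b : Fin 3 → R) (i : Fin 4) : normTheta a b i i = 0 := by
  fin_cases i <;> simp [normTheta]

theorem exists_normTheta_mul_eq_one {a b : Fin 3 → R} (h : a ⬝ᵥ b = 1) :
    ∃ X, normTheta a b * X = 1 := by
  refine ⟨!![0, -a 0, -b 1, b 2; a 0, 0, a 2, a 1; b 1, -a 2, 0, -b 0; -b 2, -a 1, b 0, 0], ?_⟩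
  simp only [dotProduct, Fin.sum_univ_three] at h
  ext i j
  fin_cases i <;> fin_cases j <;> simp [normTheta, Matrix.mul_apply, Fin.sum_univ_four] <;>
    first | ring1 | linear_combination h

theorem exists_relElem_of_elem_double {n : ℕ}
    {G : Matrix (Fin n) (Fin n) (Double I)} (hG : G ∈ elem (Double I) (fun _ _ : Fin n => True)) :
    ∃ e ei, ∃ ρ ∈ relElem I (Fin n), e * ei = 1 ∧ ei * e = 1 ∧
      G.map (Double.fst I) = e ∧ G.map (Double.snd I) = e * ρ := by
  obtain ⟨e, he, ρ, hρ, h1, h2⟩ := exists_relElementary_of_mem_elem hG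
  refine ⟨e, (e⁻¹ : Matrix.SpecialLinearGroup (Fin n) R), ρ, coe_mem_relElem hρ,
    coe_mul_coe_inv e, ?_, h1, h2⟩
  rw [← Matrix.SpecialLinearGroup.coe_mul, inv_mul_cancel, Matrix.SpecialLinearGroup.coe_one]

theorem matrix_double_ext {κ : Type*} {X Y : Matrix κ κ (Double I)}
    (h₁ : X.map (Double.fst I) = Y.map (Double.fst I))
    (h₂ : X.map (Double.snd I) = Y.map (Double.snd I)) : X = Y :=
  Matrix.ext fun i j => Double.ext (congrFun (congrFun h₁ i) j) (congrFun (congrFun h₂ i) j)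

theorem comp_vecMul {S : Type*} [CommRing S] (f : R →+* S) {κ : Type*} [Fintype κ] (v : κ → R)
    (M : Matrix κ κ R) : f ∘ (v ᵥ* M) = (f ∘ v) ᵥ* M.map f :=
  funext fun i => RingHom.map_vecMul f M v i

theorem normTheta_right_injective {a a' b b' : Fin 3 → R} (h : normTheta a b = normTheta a' b') :
    b = b' := by
  ext i
  fin_cases i
  · simpa [normTheta] using congrFun (congrFun h 0) 1
  · simpa [normTheta] using congrFun (congrFun h 1) 3
  · simpa [normTheta] using congrFun (congrFun h 1) 2

theorem transpose_map_congruence {S : Type*} [CommRing S] (f : R →+* S) {κ : Type*} [Fintype κ]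
    (M X : Matrix κ κ R) : (Mᵀ * X * M).map f = (M.map f)ᵀ * X.map f * M.map f := by
  rw [Matrix.map_mul, Matrix.map_mul, transpose_map]

/-- Over the double, the constant row (b, b) is moved to (b, b'), and the size-four lift is a pair
(x, xρ). Its first component x is an isometry of θ(a, b), so the relative matrix ρ alone gives the
congruence. -/
theorem stablyCongruent_thetaAlt {a a' b b' : Um3 I} (h : a.row ⬝ᵥ b.row = 1)
    (h' : a'.row ⬝ᵥ b'.row = 1) (hb : ∃ M ∈ relElem I (Fin 3), b'.row = b.row ᵥ* M) :
    StablyCongruent I ⟨2, thetaAlt a' b' h'⟩ ⟨2, thetaAlt a b h⟩ := by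
  obtain ⟨M, ⟨G, hG, h1, rfl⟩, hM⟩ := hb
  have hbG : (Double.diag I ∘ b.row) ᵥ* G = b.pair b' := by
    funext i
    refine Double.ext ?_ ?_
    · rw [RingHom.map_vecMul, h1, vecMul_one]
      rfl
    · rw [RingHom.map_vecMul]
      exact congrFun hM.symm i
  have hd : (Double.diag I ∘ a.row) ⬝ᵥ (Double.diag I ∘ b.row) = 1 := by
    rw [← RingHom.map_dotProduct, h, map_one]
  obtain ⟨ε, hε, e⟩ := exists_normTheta_vecMul hd hG (a' := a.pair a')
    (by rw [hbG]; exact Um3.pair_dotProduct h h')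
  rw [hbG] at e
  obtain ⟨x, xi, ρ, hρ, hx, -, e1, e2⟩ := exists_relElem_of_elem_double hε
  have f1 := congrArg (fun X => X.map (Double.fst I)) e
  have f2 := congrArg (fun X => X.map (Double.snd I)) e
  simp only [transpose_map_congruence, map_normTheta, e1, e2] at f1 f2
  refine ⟨2, le_rfl, le_rfl, ρ, hρ, ?_⟩
  rw [stab_self, stab_self, thetaAlt_mat, thetaAlt_mat]
  change xᵀ * normTheta a.row b.row * x = normTheta a.row b.row at f1
  change (x * ρ)ᵀ * normTheta a.row b.row * (x * ρ) = normTheta a'.row b'.row at f2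
  rw [← f2]
  conv_rhs => rw [← f1]
  simp only [transpose_mul, mul_assoc]

/-- Cancellation over the double yields an elementary congruence of size four from the constant
pair, hence an elementary matrix (x, xρ) of size three taking (b, b) to (b, b'). As x fixes b, ρ
takes b to b'. -/
theorem exists_row_eq_of_stablyCongruent (hR : StableRankLE R 3) {a a' b b' : Um3 I}
    (h : a.row ⬝ᵥ b.row = 1) (h' : a'.row ⬝ᵥ b'.row = 1)
    (hs : StablyCongruent I ⟨2, thetaAlt a' b' h'⟩ ⟨2, thetaAlt a b h⟩) :
    ∃ M ∈ relElem I (Fin 3), b'.row = b.row ᵥ* M := by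
  obtain ⟨N, hN, -, M, ⟨G, hG, h1, rfl⟩, e⟩ := hs
  rw [thetaAlt_mat, thetaAlt_mat] at e
  have hd : (Double.diag I ∘ a.row) ⬝ᵥ (Double.diag I ∘ b.row) = 1 := by
    rw [← RingHom.map_dotProduct, h, map_one]
  obtain ⟨X, hX⟩ := exists_normTheta_mul_eq_one hd
  obtain ⟨g, hg, hgA⟩ := exists_congruence_of_stab (n := 2) (hR.double I)
    (A := normTheta (Double.diag I ∘ a.row) (Double.diag I ∘ b.row))
    (A' := normTheta (a.pair a') (b.pair b')) (normTheta_transpose _ _) (normTheta_diag _ _)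
    (normTheta_transpose _ _) (normTheta_diag _ _) hX le_rfl hN hG (matrix_double_ext (by
      rw [transpose_map_congruence, h1, stab_map, stab_map, map_normTheta, map_normTheta,
        transpose_one, one_mul, mul_one]
      rfl) (by
      rw [transpose_map_congruence, stab_map, stab_map, map_normTheta, map_normTheta]
      exact e.symm))
  obtain ⟨A, η, hη, -, e'⟩ := exists_normTheta_of_mem_elem hd hg
  have hb : b.pair b' = (Double.diag I ∘ b.row) ᵥ* η :=
    normTheta_right_injective (hgA.symm.trans e')
  obtain ⟨x, xi, ρ, hρ, hx, -, e1, e2⟩ := exists_relElem_of_elem_double hη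
  have f1 := congrArg (fun v => Double.fst I ∘ v) hb
  have f2 := congrArg (fun v => Double.snd I ∘ v) hb
  simp only [comp_vecMul, e1, e2] at f1 f2
  change b.row = b.row ᵥ* x at f1
  change b'.row = b.row ᵥ* (x * ρ) at f2
  rw [← vecMul_vecMul, ← f1] at f2
  exact ⟨ρ, hρ, f2⟩

end Classes

/-! ### Reduction of alternating matrices to size four -/

section Reduction

variable {R : Type*} [CommRing R] {n : ℕ}

theorem eq_stab_of_isHyperbolicAt {X : Matrix (Fin (2 * (n + 1))) (Fin (2 * (n + 1))) R}
    (h : IsHyperbolicAt X ⟨2 * n, by omega⟩ ⟨2 * n + 1, by omega⟩) :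
    X = stab (X.submatrix (Fin.castLE (by omega : 2 * n ≤ 2 * (n + 1)))
      (Fin.castLE (by omega : 2 * n ≤ 2 * (n + 1)))) (n + 1) := by
  have hskew : ∀ i j, X j i = -X i j := fun i j => congrFun (congrFun h.skew i) j
  have hp : ∀ i j, i.val = 2 * n → X i j = chi R (n + 1) i j := fun i j hi => by
    have := congrFun h.row_left j
    rw [single_one_vecMul, row_apply, show (⟨2 * n, by omega⟩ : Fin (2 * (n + 1))) = i from
      Fin.ext hi.symm] at this
    rw [this]
    simp only [chi, of_apply, Pi.single_apply, Fin.ext_iff]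
    split_ifs <;> first | omega | rfl
  have hq : ∀ i j, i.val = 2 * n + 1 → X i j = chi R (n + 1) i j := fun i j hi => by
    have := congrFun h.row_right j
    rw [single_one_vecMul, row_apply, show (⟨2 * n + 1, by omega⟩ : Fin (2 * (n + 1))) = i from
      Fin.ext hi.symm] at this
    rw [this]
    simp only [chi, of_apply, Pi.single_apply, Fin.ext_iff, Pi.neg_apply]
    split_ifs <;> first | omega | simp
  have hrow : ∀ i j, 2 * n ≤ i.val → X i j = chi R (n + 1) i j := fun i j hi => by
    rcases (by omega : i.val = 2 * n ∨ i.val = 2 * n + 1) with h' | h'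
    · exact hp i j h'
    · exact hq i j h'
  ext i j
  rw [stab, of_apply]
  split_ifs with h'
  · rfl
  · by_cases hi : 2 * n ≤ i.val
    · exact hrow i j hi
    · rw [hskew j i, hrow j i (by omega)]
      simp only [chi, of_apply]
      split_ifs <;> first | omega | simp

theorem isUnit_of_isUnit_stab {N : ℕ} (hN : n ≤ N) {A : Matrix (Fin (2 * n)) (Fin (2 * n)) R}
    (h : IsUnit (stab A N)) : IsUnit A := by
  obtain ⟨k, rfl⟩ := Nat.exists_eq_add_of_le hN
  rw [Matrix.isUnit_iff_isUnit_det, ← perp_chi_eq_stab rfl, perp_eq, det_submatrix_equiv_self,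
    det_fromBlocks_zero₂₁] at h
  exact (Matrix.isUnit_iff_isUnit_det _).mpr (isUnit_of_mul_isUnit_left h)

theorem congruence_skew {κ : Type*} [Fintype κ] {A : Matrix κ κ R} (hA : Aᵀ = -A)
    (M : Matrix κ κ R) : (Mᵀ * A * M)ᵀ = -(Mᵀ * A * M) := by
  simp [transpose_mul, hA, mul_assoc]

theorem congruence_diag {κ : Type} [Fintype κ] [DecidableEq κ] {A : Matrix κ κ R} (hA : Aᵀ = -A)
    (hA₀ : ∀ i, A i i = 0) (M : Matrix κ κ R) (i : κ) : (Mᵀ * A * M) i i = 0 := by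
  have := vecMul_dotProduct_self hA hA₀ (M *ᵥ Pi.single i 1)
  rw [← vecMul_transpose, vecMul_vecMul, vecMul_transpose, dotProduct_mulVec, vecMul_vecMul] at this
  simpa using this

/-- The pair (χ, A) is a matrix over the double, and a congruence with trivial first component
leaves χ in place. -/
theorem congruence_sub_chi_mem {I : Ideal R} {A M : Matrix (Fin (2 * n)) (Fin (2 * n)) R}
    (hA : ∀ i j, A i j - chi R n i j ∈ I) (hM : M ∈ relElem I (Fin (2 * n)))
    (i j : Fin (2 * n)) : (Mᵀ * A * M) i j - chi R n i j ∈ I := by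
  obtain ⟨G, hG, h1, rfl⟩ := hM
  set Y : Matrix (Fin (2 * n)) (Fin (2 * n)) (Double I) :=
    of fun i j => Double.mk (chi R n i j) (A i j) (hA i j) with hY
  have e1 : (Gᵀ * Y * G).map (Double.fst I) = chi R n := by
    rw [transpose_map_congruence, h1, transpose_one, one_mul, mul_one]
    rfl
  have e2 : (Gᵀ * Y * G).map (Double.snd I) =
      (G.map (Double.snd I))ᵀ * A * G.map (Double.snd I) := by
    rw [transpose_map_congruence]
    rfl
  rw [← e2, ← e1]
  exact Double.snd_sub_fst_mem _

variable {I : Ideal R}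

/-- The alternating matrix underlying a stabilization. -/
def Alt.ofStab (A : Matrix (Fin (2 * n)) (Fin (2 * n)) R) (hskew : (stab A (n + 1))ᵀ = -stab A (n + 1))
    (hdiag : ∀ i, stab A (n + 1) i i = 0) (hunit : IsUnit (stab A (n + 1)))
    (hpf : pfaffian (n + 1) (stab A (n + 1)) = 1)
    (hI : ∀ i j, stab A (n + 1) i j - chi R (n + 1) i j ∈ I) : Alt I n where
  mat := A
  skew := by
    ext i j
    have := congrFun (congrFun hskew (Fin.castLE (by omega) i)) (Fin.castLE (by omega) j)
    simpa [stab] using this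
  diag_zero i := by
    simpa [stab] using hdiag (Fin.castLE (by omega) i)
  isUnit := isUnit_of_isUnit_stab (Nat.le_succ n) hunit
  pf_one := by rw [← pfaffian_stab_succ, hpf]
  congr_chi i j := by
    have := hI (Fin.castLE (by omega) i) (Fin.castLE (by omega) j)
    simpa [stab, chi] using this

/-- The stabilization of an alternating matrix by one hyperbolic plane. -/
def Alt.succ (α : Alt I n) : Alt I (n + 1) where
  mat := stab α.mat (n + 1)
  skew := stab_transpose α.skew
  diag_zero := stab_diag α.diag_zero
  isUnit := by
    obtain ⟨u, hu⟩ := α.isUnit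
    obtain ⟨B, hB⟩ := stab_mul_eq_one (N := n + 1) (hu ▸ u.mul_inv) (Nat.le_succ n)
    exact IsUnit.of_mul_eq_one B hB
  pf_one := by rw [pfaffian_stab_succ, α.pf_one]
  congr_chi i j := by
    rw [stab, of_apply]
    split_ifs with h
    · simpa [chi] using α.congr_chi ⟨i, h.1⟩ ⟨j, h.2⟩
    · simp

theorem stablyCongruent_succ (α : Alt I n) : StablyCongruent I ⟨n, α⟩ ⟨n + 1, α.succ⟩ :=
  ⟨n + 1, Nat.le_succ n, le_rfl, 1, Submonoid.one_mem _, by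
    simp [Alt.succ, stab_self]⟩

/-- Transitivity over the double moves the pair (e_p, c) to e_p. The first component of the matrix
used fixes e_p, so dividing by its constant pair makes the matrix relative without changing the
effect. -/
theorem exists_mem_relElem_vecMul_eq_single (hR : StableRankLE R 3) {ι : Type} [Fintype ι]
    [DecidableEq ι] {S : Finset ι} {p : ι} (hp : p ∈ S) (hS : 4 ≤ S.card) {c w : ι → R}
    (hc : ∀ x ∉ S, c x = 0) (hw : w ⬝ᵥ c = 1) (hI : ∀ i, c i - (Pi.single p 1 : ι → R) i ∈ I) :
    ∃ ρ ∈ relElem I ι, ρ ∈ elemOn R S ∧ c ᵥ* ρ = Pi.single p 1 := by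
  set u : ι → Double I := fun i => Double.mk ((Pi.single p 1 : ι → R) i) (c i) (hI i) with hu
  have hcp : 1 - c p ∈ I := by
    have := I.neg_mem (hI p)
    simpa using this
  set v : ι → Double I := fun i => Double.mk ((Pi.single p 1 : ι → R) i)
    ((Pi.single p 1 : ι → R) i + (1 - c p) * w i) (by simpa using I.mul_mem_right _ hcp) with hv
  have hvu : v ⬝ᵥ u = 1 := by
    refine Double.ext ?_ ?_
    · rw [RingHom.map_dotProduct]
      change Pi.single p 1 ⬝ᵥ Pi.single p 1 = _
      simp
    · rw [RingHom.map_dotProduct]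
      change (Pi.single p 1 + (1 - c p) • w) ⬝ᵥ c = _
      rw [add_dotProduct, smul_dotProduct, hw, single_one_dotProduct]
      simp
  obtain ⟨G, hG, e⟩ := exists_vecMul_eq_single (hR.double I) hp hS (u := u) (w := v)
    (fun x hx => Double.ext (by
      have : x ≠ p := fun h => hx (h ▸ hp)
      simp [hu, this]) (by simp [hu, hc x hx])) hvu
  have f1 : Pi.single p 1 ᵥ* G.map (Double.fst I) = Pi.single p 1 := by
    have := congrArg (fun v => Double.fst I ∘ v) e
    simp only [comp_vecMul] at this
    refine this.trans ?_
    ext i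
    simp [Pi.single_apply, apply_ite (Double.fst I)]
  have f2 : c ᵥ* G.map (Double.snd I) = Pi.single p 1 := by
    have := congrArg (fun v => Double.snd I ∘ v) e
    simp only [comp_vecMul] at this
    refine this.trans ?_
    ext i
    simp [Pi.single_apply, apply_ite (Double.snd I)]
  obtain ⟨K, hK, h1, h2⟩ := exists_inverse_mem_elem (map_mem_elem (Double.fst I) hG)
  refine ⟨G.map (Double.snd I) * K, ⟨G * K.map (Double.diag I), elem_mono (fun _ _ _ => trivial)
    (Submonoid.mul_mem _ hG (map_mem_elem _ hK)), ?_, ?_⟩,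
    Submonoid.mul_mem _ (map_mem_elem _ hG) hK, ?_⟩
  · rw [Matrix.map_mul, map_map_diag_fst, h1]
  · rw [Matrix.map_mul, map_map_diag_snd]
  · rw [← vecMul_vecMul, f2]
    conv_lhs => rw [← f1]
    rw [vecMul_vecMul, h1, vecMul_one]

/-- An alternating matrix of size at least six splits off a hyperbolic plane. -/
theorem exists_stablyCongruent_of_succ (hR : StableRankLE R 3) (hn : 2 ≤ n) (α : Alt I (n + 1)) :
    ∃ β : Alt I n, StablyCongruent I ⟨n, β⟩ ⟨n + 1, α⟩ := by
  set A := α.mat with hA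
  obtain ⟨p, hp⟩ : ∃ p : Fin (2 * (n + 1)), p = ⟨2 * n, by omega⟩ := ⟨_, rfl⟩
  obtain ⟨q, hq⟩ : ∃ q : Fin (2 * (n + 1)), q = ⟨2 * n + 1, by omega⟩ := ⟨_, rfl⟩
  have hpq : p ≠ q := by simp [hp, hq]
  -- Minus the row q of A vanishes at q and is congruent to e_p modulo I, so it can be moved to e_p
  -- by a relative elementary matrix on the indices other than q.
  obtain ⟨c, hc⟩ : ∃ c : Fin (2 * (n + 1)) → R, c = fun i => -A q i := ⟨_, rfl⟩
  obtain ⟨U, hU⟩ := α.isUnit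
  have hAU : A * (U⁻¹ : (Matrix _ _ R)ˣ) = 1 := hA ▸ hU ▸ U.mul_inv
  obtain ⟨ρ, hρ, hρS, hcρ⟩ := exists_mem_relElem_vecMul_eq_single hR (I := I)
    (S := Finset.univ.erase q) (p := p) (c := c)
    (w := fun i => -((U⁻¹ : (Matrix _ _ R)ˣ) : Matrix _ _ R) i q) (by simp [hpq])
    (by
      rw [Finset.card_erase_of_mem (Finset.mem_univ _), Finset.card_univ, Fintype.card_fin]
      omega)
    (fun x hx => by
      have : x = q := by simpa using hx
      simp only [hc, this, hA, α.diag_zero, neg_zero])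
    (by
      have := congrFun (congrFun hAU q) q
      rw [one_apply_eq, mul_apply] at this
      rw [← this, hc, dotProduct]
      exact Finset.sum_congr rfl fun i _ => by ring)
    (fun i => by
      have := I.neg_mem (α.congr_chi q i)
      rw [neg_sub, ← hA, sub_eq_neg_add] at this
      refine (congrArg (· ∈ I) ?_).mp this
      rw [hc, sub_eq_add_neg]
      congr 1
      simp only [chi, of_apply, hp, hq, Pi.single_apply, Fin.ext_iff]
      split_ifs <;> first | omega | simp)
  have hB := congruence_skew α.skew ρ
  have hB₀ := congruence_diag α.skew α.diag_zero ρ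
  have hBI := congruence_sub_chi_mem α.congr_chi hρ
  obtain ⟨B, hBdef⟩ : ∃ B, B = ρᵀ * A * ρ := ⟨_, rfl⟩
  rw [← hA, ← hBdef] at hB hB₀ hBI
  have hBq : Pi.single q 1 ᵥ* B = -Pi.single p 1 := by
    rw [hBdef, ← vecMul_vecMul, ← vecMul_vecMul, vecMul_transpose,
      mulVec_single_of_mem_elem hρS (by simp), ← hcρ, hc, ← neg_vecMul]
    congr 1
    ext i
    simp
  have hBq' : B *ᵥ Pi.single q 1 = Pi.single p 1 := by
    rw [mulVec_eq_neg_vecMul hB, hBq, neg_neg]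
  have hskew : ∀ i j, B j i = -B i j := fun i j => congrFun (congrFun hB i) j
  have hBpq : B p q = 1 := by
    simpa using congrFun hBq' p
  -- Row q of B is already standard. The defect d of row p has entries in I and vanishes at p and q,
  -- so the relative row operation T removes it without disturbing row q.
  obtain ⟨d, hd⟩ : ∃ d : Fin (2 * (n + 1)) → R, d = Pi.single q 1 - Pi.single p 1 ᵥ* B :=
    ⟨_, rfl⟩
  have hdp : d p = 0 := by simp [hd, hpq, hB₀]
  have hdq : d q = 0 := by simp [hd, hBpq]
  have hdI : ∀ i, d i ∈ I := fun i => by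
    have := I.neg_mem (hBI p i)
    refine (congrArg (· ∈ I) ?_).mp this
    rw [hd, neg_sub, Pi.sub_apply, single_one_vecMul, row_apply]
    congr 1
    simp only [chi, of_apply, hp, hq, Pi.single_apply, Fin.ext_iff]
    split_ifs <;> first | omega | simp
  have hT := tv_single_left_mem_relElem hdI hdq
  set T := tv (Pi.single q 1) d
  obtain ⟨X, hX⟩ : ∃ X, X = (ρ * T)ᵀ * A * (ρ * T) := ⟨_, rfl⟩
  have hρT : ρ * T ∈ relElem I _ := Submonoid.mul_mem _ hρ hT
  have hXB : X = B + vecMulVec (Pi.single p 1) d - vecMulVec d (Pi.single p 1) := by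
    have : X = Tᵀ * B * T := by
      rw [hX, hBdef]
      simp only [transpose_mul, mul_assoc]
    rw [this, transpose_tv_mul_mul, hBq, hBq']
    simp [hpq, sub_eq_add_neg, vecMulVec_neg]
  have hyp : IsHyperbolicAt X p q := by
    refine ⟨hX ▸ congruence_skew α.skew _, hX ▸ congruence_diag α.skew α.diag_zero _, ?_, ?_⟩
    · rw [hXB, vecMul_sub, vecMul_add, vecMul_vecMulVec, vecMul_vecMulVec, single_one_dotProduct,
        single_one_dotProduct, hdp, Pi.single_eq_same, one_smul, zero_smul, sub_zero, hd]
      abel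
    · rw [hXB, vecMul_sub, vecMul_add, vecMul_vecMulVec, vecMul_vecMulVec, single_one_dotProduct,
        single_one_dotProduct, hdq, Pi.single_eq_of_ne hpq.symm, zero_smul, zero_smul, sub_zero,
        add_zero, hBq]
  have hXs := eq_stab_of_isHyperbolicAt (hp ▸ hq ▸ hyp)
  set Y := X.submatrix (Fin.castLE (by omega : 2 * n ≤ 2 * (n + 1)))
      (Fin.castLE (by omega : 2 * n ≤ 2 * (n + 1)))
  refine ⟨Alt.ofStab Y (hXs ▸ hyp.skew) (hXs ▸ hyp.diag_zero) ?_ ?_ ?_, n + 1, Nat.le_succ n,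
    le_rfl, ρ * T, hρT, ?_⟩
  · rw [← hXs, hX, Matrix.isUnit_iff_isUnit_det, det_mul, det_mul, det_transpose,
      det_eq_one_of_mem_relElem hρT, one_mul, mul_one, ← Matrix.isUnit_iff_isUnit_det]
    exact α.isUnit
  · rw [← hXs, hX, pfaffian_congruence α.skew α.diag_zero (det_eq_one_of_mem_relElem hρT)]
    exact α.pf_one
  · rw [← hXs, hX]
    exact congruence_sub_chi_mem α.congr_chi hρT
  · rw [stab_self]
    exact hXs.symm.trans hX

theorem exists_stablyCongruent_two (hR : StableRankLE R 3) (n : ℕ) (α : Alt I n) :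
    ∃ β : Alt I 2, StablyCongruent I ⟨n, α⟩ ⟨2, β⟩ := by
  have key : ∀ k, ∀ α : Alt I (2 + k), ∃ β : Alt I 2, StablyCongruent I ⟨2 + k, α⟩ ⟨2, β⟩ := by
    intro k
    induction k with
    | zero => exact fun α => ⟨α, .refl _⟩
    | succ k ih =>
      intro α
      obtain ⟨β, hβ⟩ := exists_stablyCongruent_of_succ (n := 2 + k) hR (by omega) α
      obtain ⟨γ, hγ⟩ := ih β
      exact ⟨γ, hβ.symm.trans hγ⟩
  match n, α with
  -- Sizes below four are stabilized upwards.
  | 0, α => exact ⟨α.succ.succ, (stablyCongruent_succ α).trans (stablyCongruent_succ α.succ)⟩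
  | 1, α => exact ⟨α.succ, stablyCongruent_succ α⟩
  | n + 2, α =>
    have := key n
    rw [Nat.add_comm 2 n] at this
    exact this α

theorem exists_thetaAlt_mat_eq (α : Alt I 2) :
    ∃ (a b : Um3 I) (h : a.row ⬝ᵥ b.row = 1), (thetaAlt a b h).mat = α.mat := by
  have hskew : ∀ i j, α.mat j i = -α.mat i j := fun i j => congrFun (congrFun α.skew i) j
  have hI := α.congr_chi
  set A : Matrix (Fin 4) (Fin 4) R := α.mat with hA
  have hpf : A 2 3 * A 0 1 + A 0 2 * -A 1 3 + -A 0 3 * -A 1 2 = 1 := by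
    have := α.pf_one
    simp [pfaffian, Fin.sum_univ_succ, Fin.succAbove] at this
    linear_combination this
  have hdot : ![A 2 3, A 0 2, -A 0 3] ⬝ᵥ ![A 0 1, -A 1 3, -A 1 2] = 1 := by
    simpa [dotProduct, Fin.sum_univ_three] using hpf
  refine ⟨⟨![A 2 3, A 0 2, -A 0 3], ⟨_, hdot⟩, ?_, ?_, ?_⟩,
    ⟨![A 0 1, -A 1 3, -A 1 2], ⟨_, (dotProduct_comm _ _).trans hdot⟩, ?_, ?_, ?_⟩, hdot, ?_⟩
  · simpa [chi] using hI 2 3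
  · simpa [chi] using hI 0 2
  · simpa [chi] using hI 0 3
  · simpa [chi] using hI 0 1
  · simpa [chi] using hI 1 3
  · simpa [chi] using hI 1 2
  · rw [thetaAlt_mat]
    ext i j
    have h0 : ∀ i, A i i = 0 := α.diag_zero
    fin_cases i <;> fin_cases j
    all_goals
      simp [normTheta, h0]
      try rw [hskew, neg_neg]

end Reduction

end RelVaserstein

/-- For a commutative ring `R` of Krull dimension two and an ideal `I`, the assignment
`b ↦ [σᵀ θ(a, b) σ]`, where `a` is any row with `a · b = 1`, is independent of `a` and constant on
orbits, and the induced map (the relative Vaserstein symbol) is a bijection. -/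
theorem corollary5p10 {R : Type*} [CommRing R] (hdim : ringKrullDim R = 2) (I : Ideal R) :
    ∃ V : RelVaserstein.MSE3 I → RelVaserstein.WE I,
      (∀ (a b : RelVaserstein.Um3 I) (h : a.row ⬝ᵥ b.row = 1),
        V (RelVaserstein.MSE3.mk b) = RelVaserstein.WE.mk (RelVaserstein.thetaAlt a b h)) ∧
      Function.Bijective V := by
  open RelVaserstein in
  -- The only use of the dimension.
  have hR : StableRankLE R 3 := StableRankLE.of_ringKrullDim_lt (by rw [hdim]; norm_num)
  have hwd : ∀ (a a' b b' : Um3 I) (h : a.row ⬝ᵥ b.row = 1) (h' : a'.row ⬝ᵥ b'.row = 1),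
      MSE3.mk b = MSE3.mk b' → WE.mk (thetaAlt a b h) = WE.mk (thetaAlt a' b' h') :=
    fun a a' b b' h h' e =>
      (WE.mk_eq_mk_iff.mpr (stablyCongruent_thetaAlt h h' (MSE3.mk_eq_mk_iff.mp e))).symm
  choose f hf using fun b : Um3 I => exists_partner b
  obtain ⟨V, hV⟩ : ∃ V : MSE3 I → WE I, ∀ b, V (MSE3.mk b) = WE.mk (thetaAlt (f b) b (hf b)) :=
    ⟨Quotient.lift (fun b => WE.mk (thetaAlt (f b) b (hf b))) fun b b' h =>
      hwd _ _ _ _ _ _ (Quotient.sound h), fun b => rfl⟩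
  have hVab : ∀ (a b : Um3 I) (h : a.row ⬝ᵥ b.row = 1),
      V (MSE3.mk b) = WE.mk (thetaAlt a b h) := fun a b h => by
    rw [hV]
    exact hwd _ _ _ _ _ _ rfl
  refine ⟨V, hVab, ?_, ?_⟩
  · intro x y hxy
    obtain ⟨b, rfl⟩ := Quotient.exists_rep x
    obtain ⟨b', rfl⟩ := Quotient.exists_rep y
    change V (MSE3.mk b) = V (MSE3.mk b') at hxy
    rw [hV, hV] at hxy
    exact MSE3.mk_eq_mk_iff.mpr (exists_row_eq_of_stablyCongruent hR _ _
      (WE.mk_eq_mk_iff.mp hxy.symm))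
  · intro y
    obtain ⟨⟨n, α⟩, rfl⟩ := Quot.exists_rep y
    obtain ⟨β, hβ⟩ := exists_stablyCongruent_two hR n α
    obtain ⟨a, b, h, e⟩ := exists_thetaAlt_mat_eq β
    have hβ' : thetaAlt a b h = β := by
      cases β
      cases e
      rfl
    refine ⟨MSE3.mk b, (hVab a b h).trans ?_⟩
    rw [hβ']
    exact WE.mk_eq_mk_iff.mpr hβ.symm
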